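/- **Setting.** Let $V$ be a finite-dimensional real vector space and $X=[a_1,\dots,a_m]$ a list of nonzero vectors spanning $V$. "Distribution" means real-valued or complex-valued distribution on $V$. For a list $Y$ of vectors put $\partial_Y=\prod_{a\in Y}\partial_a$; for a subspace $r$ let $Y\cap r$ and $Y\setminus r$ be the sublists of the vectors of $Y$ lying, respectively not lying, in $r$, and let $\mathcal D(V,r)$ be the space of distributions on $V$ that vanish on all test functions vanishing on $r$ (it is identified with the space of distributions on $r$). Let $Y$ be a list of nonzero vectors with span $W$. A subspace is *rational* for $Y$ if it is spanned by a subset of $Y$; $S_Y$ is the set of these. A *tope* of $Y$ is a connected component of the complement in $W$ of the union of the rational hyperplanes of $W$. Put $$G(Y)=\{f : \partial_{Y\setminus r}f\in\mathcal D(V,r)\ \text{for all } r\in S_Y\},$$ $$D(Y)=\{f\in\mathcal D(V,W) : \partial_{Y\setminus t}f=0\ \text{for every rational hyperplane } t \text{ of } W\}.$$ For a tope $\tau$ of $Y$ and a distribution $f\in\mathcal D(V,W)$, $f^{\tau}$ denotes the polynomial density on $W$ that lies in $D(Y)$ and coincides with $f$, as a distribution on $W$, on $\tau$, when it exists and is unique.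 If $Y$ generates a pointed cone (a cone containing no line), $T_Y$ is the distribution $\langle T_Y,\varphi\rangle=\int_{[0,\infty)^k}\varphi(\sum_i t_iy_i)\,dt$, where $Y=[y_1,\dots,y_k]$. If $F$ is an open half-line of linear forms on $V$ that are nonzero on every vector of $Y$, and $A$, $B$ are the sublists of the vectors of $Y$ on which $F$ is positive, respectively negative, put $T_Y^F=(-1)^{|B|}\,T_{[A,-B]}$. **Theorem.** Let $\tau_1,\tau_2$ be two adjacent topes of $X$, i.e. such that $\overline{\tau_1}\cap\overline{\tau_2}$ spans a hyperplane $H$ of $V$, and let $F_H$ be the half-line in $H^\perp\subset V^*$ that is positive on $\tau_1$. Then $H$ is rational for $X$, there is a unique tope $\tau_{12}$ of $X\cap H$ with $\overline{\tau_1}\cap\overline{\tau_2}\subset\overline{\tau_{12}}$, and the following hold. 1. For every $f\in G(X)$: $\partial_{X\setminus H}f\in G(X\cap H)$; the polynomial densities $f^{\tau_1},f^{\tau_2}\in D(X)$ and $(\partial_{X\setminus H}f)^{\tau_{12}}\in D(X\cap H)$ exist and are unique; the following convolution is well defined; and $$f^{\tau_1}-f^{\tau_2}=\bigl(T_{X\setminus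 H}^{F_H}-T_{X\setminus H}^{-F_H}\bigr)*(\partial_{X\setminus H}f)^{\tau_{12}}.$$ 2. If $X$ generates a pointed cone, then $T_X\in G(X)$, the polynomial densities $T_X^{\tau_1},T_X^{\tau_2}\in D(X)$ and $T_{X\cap H}^{\tau_{12}}\in D(X\cap H)$ exist and are unique, and $$T_X^{\tau_1}-T_X^{\tau_2}=\bigl(T_{X\setminus H}^{F_H}-T_{X\setminus H}^{-F_H}\bigr)*T_{X\cap H}^{\tau_{12}}.$$ -/

import Mathlib

open scoped Distributions LineDeriv
open TopologicalSpace MeasureTheory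

noncomputable section

namespace WallCrossing

/-! ### Lists of vectors, rational subspaces, topes -/

section Lists

variable {V : Type*} [NormedAddCommGroup V] [NormedSpace ℝ V]

/-- The linear span of the vectors of the list `X`. -/
def spanOf (X : List V) : Submodule ℝ V := Submodule.span ℝ {a | a ∈ X}

open Classical in
/-- The sublist `X ∩ r` of the vectors of `X` lying in the subspace `r`. -/
def inside (X : List V) (r : Submodule ℝ V) : List V := X.filter (fun a => a ∈ r)

open Classical in
/-- The sublist `X \ r` of the vectors of `X` not lying in the subspace `r`. -/
def outside (X : List V) (r : Submodule ℝ V) : List V := X.filter (fun a => a ∉ r)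

/-- The set `S_X` of rational subspaces: those generated by a subset of the elements of `X`. -/
def rationalSubspaces (X : List V) : Set (Submodule ℝ V) :=
  {r | ∃ s : Set V, s ⊆ {a | a ∈ X} ∧ r = Submodule.span ℝ s}

/-- The rational hyperplanes of the space spanned by `X`. The cocircuits of `X` are the sublists
`X \ t` for `t` such a hyperplane. -/
def rationalHyperplanes (X : List V) : Set (Submodule ℝ V) :=
  {t | t ∈ rationalSubspaces X ∧ Module.finrank ℝ t + 1 = Module.finrank ℝ (spanOf X)}

/-- The complement, in the space spanned by `X`, of the union of the rational hyperplanes. -/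
def regularLocus (X : List V) : Set V :=
  (spanOf X : Set V) \ ⋃ t ∈ rationalHyperplanes X, (t : Set V)

/-- A tope of `X` is a connected component of the complement, in the space spanned by `X`, of the
union of the hyperplanes generated by subsets of `X`. -/
def IsTope (X : List V) (τ : Set V) : Prop :=
  ∃ x ∈ regularLocus X, τ = connectedComponentIn (regularLocus X) x

/-- The cone generated by `X` contains no line. -/
def GeneratesPointedCone (X : List V) : Prop :=
  ∀ v : V, v ∈ Submodule.span NNReal {a | a ∈ X} → -v ∈ Submodule.span NNReal {a | a ∈ X} → v = 0

end Lists

/-! ### Distributions -/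

section Distributions

variable {V : Type*} [NormedAddCommGroup V] [NormedSpace ℝ V]
variable {𝕜 : Type*} [RCLike 𝕜]

variable (V) in
/-- Test functions on `V`. -/
abbrev Test := 𝓓((⊤ : Opens V), ℝ)

variable (V 𝕜) in
/-- Real or complex distributions on `V`. -/
abbrev Dist := 𝓓'((⊤ : Opens V), 𝕜)

/-- The differential operator `∂_Y = ∏_{a ∈ Y} ∂_a` on distributions. -/
def derivList (Y : List V) (f : Dist V 𝕜) : Dist V 𝕜 := Y.foldr (fun a g => ∂_{a} g) f

variable (𝕜) in
/-- `𝓓(V, r)`: the distributions on `V` that vanish on all test functions vanishing on `r`;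
equivalently, the images in `V` of the distributions on `r`. -/
def distOn (r : Submodule ℝ V) : Set (Dist V 𝕜) :=
  {f | ∀ φ : Test V, (∀ v ∈ r, φ v = 0) → f φ = 0}

variable (𝕜) in
/-- The space `G(X)` for a list `X`. Taking for `r` the span `W` of `X` shows that its elements
lie in `𝓓(V, W)`, i.e. are distributions on `W`. -/
def G (X : List V) : Set (Dist V 𝕜) :=
  {f | ∀ r ∈ rationalSubspaces X, derivList (outside X r) f ∈ distOn 𝕜 r}

variable (𝕜) in
/-- The space `D(X)` for a list `X`: the distributions on the span of `X`, viewed as distributions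
on `V`, that are annihilated by `∂_Y` for every cocircuit `Y` of `X`. -/
def D (X : List V) : Set (Dist V 𝕜) :=
  {f | f ∈ distOn 𝕜 (spanOf X) ∧
    ∀ t ∈ rationalHyperplanes X, derivList (outside X t) f = 0}

/-- For `f, g ∈ 𝓓(V, W)` and `τ` open in `W`: `f` and `g`, as distributions on `W`, agree
on `τ`. -/
def AgreeOn (W : Submodule ℝ V) (τ : Set V) (f g : Dist V 𝕜) : Prop :=
  ∀ φ : Test V, tsupport φ ∩ (W : Set V) ⊆ τ → f φ = g φ

/-- `p ∈ 𝓓(V, W)` is given by `P(x) dx`, where `P` is a polynomial function on `W` and `dx` is a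
Lebesgue measure on `W`. -/
def IsPolynomialDensity [FiniteDimensional ℝ V] [MeasurableSpace V] [BorelSpace V]
    (W : Submodule ℝ V) (p : Dist V 𝕜) : Prop :=
  ∃ P ∈ Algebra.adjoin 𝕜 (Set.range fun (l : W →ₗ[ℝ] ℝ) (w : W) => ((l w : ℝ) : 𝕜)),
    ∀ φ : Test V, p φ = ∫ w : W, φ (w : V) • P w ∂(Measure.addHaar : Measure W)

/-- `p` is the local piece `f^τ` of `f` on the tope `τ` of `X`: a polynomial density belonging to
`D(X)` that coincides with `f` on `τ`. -/
def IsPiece [FiniteDimensional ℝ V] [MeasurableSpace V] [BorelSpace V]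
    (X : List V) (τ : Set V) (f p : Dist V 𝕜) : Prop :=
  p ∈ D 𝕜 X ∧ IsPolynomialDensity (spanOf X) p ∧ AgreeOn (spanOf X) τ f p

/-! ### Multivariate splines -/

variable (𝕜) in
/-- The multivariate spline `T_Y`, i.e. the distribution
`φ ↦ ∫_{t ≥ 0} φ (∑ i, t i • Y i) dt`: integration against the image, under
`t ↦ ∑ i, t i • Y i`, of Lebesgue measure on the orthant. (This image is locally finite when `Y`
consists of nonzero vectors generating a pointed cone.) -/
def spline [MeasurableSpace V] [BorelSpace V] (Y : List V) : Dist V 𝕜 :=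
  (TestFunction.integralAgainstBilinCLM (Ω := (⊤ : Opens V)) (n := ⊤)
    (ContinuousLinearMap.lsmul ℝ ℝ : ℝ →L[ℝ] 𝕜 →L[ℝ] 𝕜)
    (Measure.map (fun t : Fin Y.length → ℝ => ∑ i, t i • Y.get i)
      (volume.restrict {t | ∀ i, 0 ≤ t i}))
    (fun _ => (1 : 𝕜)) : 𝓓((⊤ : Opens V), ℝ) →L[ℝ] 𝕜)

open Classical in
/-- The distribution `T_Y^F = (-1)^|B| T_{[A, -B]}`, where `F` is the regular face for `Y`
containing the linear form `u`, and `A`, `B` are the sublists of vectors of `Y` on which `u` is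
positive, respectively negative. -/
def faceSpline [MeasurableSpace V] [BorelSpace V] (u : Module.Dual ℝ V) (Y : List V) : Dist V ℝ :=
  let A := Y.filter (fun a => 0 < u a)
  let B := Y.filter (fun a => u a < 0)
  (-1 : ℝ) ^ B.length • spline ℝ (A ++ B.map (fun b => -b))

/-! ### Convolution -/

/-- The test function `x ↦ χ(x) φ(x + y)`. -/
def cutoffTranslate (χ φ : Test V) (y : V) : Test V where
  toFun x := χ x * φ (x + y)
  contDiff' := χ.contDiff.mul (φ.contDiff.comp (contDiff_id.add contDiff_const))
  hasCompactSupport' := χ.hasCompactSupport.mul_right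
  tsupport_subset' := fun _ _ => trivial

/-- `R` is the convolution `S * T`, that is `⟨R, φ⟩ = ⟨S_x ⊗ T_y, φ(x + y)⟩`, where the function
`φ(x + y)`, which is not compactly supported, is replaced by `χ(x) χ(y) φ(x + y)` with `χ` any test
function equal to `1` on a large enough compact set. This determines `R`, and is the usual
convolution of two distributions on whose supports the addition map is proper. -/
def IsConvolution (S : Dist V ℝ) (T R : Dist V 𝕜) : Prop :=
  ∀ φ : Test V, ∃ K : Set V, IsCompact K ∧
    ∀ χ : Test V, (∀ x ∈ K, χ x = 1) →
      ∃ ψ : Test V, (∀ y, ψ y = χ y * S (cutoffTranslate χ φ y)) ∧ R φ = T ψ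

end Distributions

end WallCrossing

end

noncomputable section

namespace WallCrossing

/-! ### Differential operators on test functions -/

section Operators

variable {E : Type*} [NormedAddCommGroup E] [NormedSpace ℝ E]

/-! Everything is moved to the side of test functions: distributions enter as linear functionals
`L`, and `∂_Y` acts through the commuting endomorphisms `dList Y`. Continuity of `L` plays no role
in the core arguments.

Local pieces. Let `f ∈ G(X)` and let `τ` be a tope. For a rational hyperplane `t` the distribution
`∂_{X∖t} f` is carried by `t`, which misses `τ`, so all cocircuit operators kill `f` on `τ`. A prime
ideal of the algebra of constant coefficient operators that contains every cocircuit product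
contains a vector of each cocircuit, and the vectors it contains form a subspace, which must contain
the span of `X` (`spanOf_le_of_meets_cocircuits`). Hence every derivative along the span is
nilpotent on `f` (`exists_pow_dOp_eq_zero`). A functional with nilpotent derivatives on a connected
open set is a polynomial density (`isPolyOn_of_nilpotent`), and a polynomial is determined by its
values on an open set. This gives existence and uniqueness of the pieces (`exists_isPiece`).

Wall crossing. Put `Y = X∖H`, let `u` be the form vanishing on `H`, and let `q` be the piece of `∂_Y
f` on `τ₁₂`. Choose `x₀` in the common wall and off all the other rational hyperplanes
(`exists_wall_point`). Since `T_Y^u` is a fundamental solution of `∂_Y` (`faceSmear_dList`), the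
functional `L = f - f₂ - T_Y^u * q` satisfies `∂_Y L = 0` near `x₀`; it vanishes there on the side
`u < 0`, where `f = f₂` and `T_Y^u * q` has no mass. No vector of `Y` lies in `H`, so `H` is
noncharacteristic and the zero propagates across it (`exists_ball_forall_eq_zero`). On the side `u >
0` this reads `f₁ - f₂ = T_Y^u * q`, and `T_Y^{-u} * q` vanishes there. So `f₁ - f₂ - (T_Y^u -
T_Y^{-u}) * q` is zero on a nonempty open set. It is killed by `∂_Y` and by powers of the
derivatives along `H`, so it is a polynomial density and vanishes everywhere
(`sub_eq_faceConv_sub`).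

The statement for splines is the case `f = T_X`, because `∂_{X∖H} T_X = T_{X∩H}`. -/

theorem Test.differentiable (φ : Test E) : Differentiable ℝ φ :=
  φ.contDiff.differentiable (by simp)

/-- Directional derivatives, as linear endomorphisms of the space of test functions, depending
linearly on the direction. -/
def dOp : E →ₗ[ℝ] Module.End ℝ (Test E) where
  toFun v := (TestFunction.lineDerivCLM ℝ v : Test E →L[ℝ] Test E).toLinearMap
  map_add' v w := by
    rw [TestFunction.lineDerivCLM_add]; rfl
  map_smul' c v := by
    rw [TestFunction.lineDerivCLM_smul]; rfl

theorem dOp_apply (v : E) (φ : Test E) (x : E) : dOp v φ x = fderiv ℝ φ x v := by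
  change (TestFunction.lineDerivCLM ℝ v φ : Test E) x = _
  rw [TestFunction.lineDerivCLM_eq_fderivCLM, TestFunction.fderivCLM_apply_of_le]
  simp

theorem dOp_apply_eq_deriv (v : E) (φ : Test E) (x : E) :
    dOp v φ x = deriv (fun t : ℝ => φ (x + t • v)) 0 := by
  rw [dOp_apply, ← (Test.differentiable φ x).lineDeriv_eq_fderiv]; rfl

theorem hasDerivAt_dOp (v : E) (φ : Test E) (x : E) (t : ℝ) :
    HasDerivAt (fun t : ℝ => φ (x + t • v)) (dOp v φ (x + t • v)) t := by
  rw [dOp_apply]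
  have h1 : HasDerivAt (fun t : ℝ => x + t • v) v t := by
    simpa using ((hasDerivAt_id t).smul_const v).const_add x
  exact (Test.differentiable φ (x + t • v)).hasFDerivAt.comp_hasDerivAt t h1

theorem two_le_top : (2 : WithTop ℕ∞) ≤ ((⊤ : ℕ∞) : WithTop ℕ∞) :=
  WithTop.coe_le_coe.2 (le_top : (2 : ℕ∞) ≤ ⊤)

theorem dOp_commute (v w : E) : Commute (dOp v) (dOp w) := by
  refine LinearMap.ext fun φ => TestFunction.ext fun x => ?_
  change dOp v (dOp w φ) x = dOp w (dOp v φ) x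
  have h2 : DifferentiableAt ℝ (fderiv ℝ φ) x :=
    (φ.contDiff.fderiv_right (m := 1) (by rw [one_add_one_eq_two]; exact two_le_top)).differentiable (by simp) x
  have key : ∀ v w : E, dOp v (dOp w φ) x = fderiv ℝ (fderiv ℝ φ) x v w := by
    intro v w
    have : (dOp w φ : E → ℝ) = fun y => fderiv ℝ φ y w := funext fun y => dOp_apply w φ y
    rw [dOp_apply, this, fderiv_clm_apply h2 (differentiableAt_const w)]
    simp
  rw [key, key]
  have hs : IsSymmSndFDerivAt ℝ φ x := φ.contDiff.contDiffAt.isSymmSndFDerivAt (by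
    rw [minSmoothness_of_isRCLikeNormedField]; exact two_le_top)
  exact hs v w

theorem tsupport_dOp_subset (v : E) (φ : Test E) : tsupport (dOp v φ) ⊆ tsupport φ := by
  have : (dOp v φ : E → ℝ) = fun y => fderiv ℝ φ y v := funext fun y => dOp_apply v φ y
  rw [this]
  exact tsupport_fderiv_apply_subset ℝ v

/-- The operator `∂_Y` on test functions. -/
def dList (Y : List E) : Module.End ℝ (Test E) := (Y.map dOp).prod

@[simp] theorem dList_nil : dList ([] : List E) = 1 := rfl

@[simp] theorem dList_cons (a : E) (Y : List E) : dList (a :: Y) = dOp a * dList Y := by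
  simp [dList]

theorem dList_append (Y Z : List E) : dList (Y ++ Z) = dList Y * dList Z := by
  simp [dList]

theorem dList_replicate (n : ℕ) (v : E) : dList (List.replicate n v) = dOp v ^ n := by
  simp [dList]

theorem dOp_commute_dList (v : E) (Y : List E) : Commute (dOp v) (dList Y) := by
  induction Y with
  | nil => exact Commute.one_right _
  | cons a Y ih => rw [dList_cons]; exact (dOp_commute v a).mul_right ih

theorem dList_perm {Y Z : List E} (h : Y.Perm Z) : dList Y = dList Z := by
  induction h with
  | nil => rfl
  | cons a _ ih => rw [dList_cons, dList_cons, ih]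
  | swap a b Y =>
    rw [dList_cons, dList_cons, dList_cons, dList_cons, ← mul_assoc, ← mul_assoc,
      (dOp_commute b a).eq]
  | trans _ _ h₁ h₂ => exact h₁.trans h₂

theorem tsupport_dList_subset (Y : List E) (φ : Test E) : tsupport (dList Y φ) ⊆ tsupport φ := by
  induction Y with
  | nil => exact subset_rfl
  | cons a Y ih =>
    rw [dList_cons]
    exact (tsupport_dOp_subset a (dList Y φ)).trans ih

theorem tsupport_dOp_pow_subset (v : E) (n : ℕ) (φ : Test E) :
    tsupport ((dOp v ^ n) φ) ⊆ tsupport φ := by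
  rw [← dList_replicate]; exact tsupport_dList_subset _ _

variable {𝕜 : Type*} [RCLike 𝕜]

/-- Each `∂_a` costs a sign when it is transposed. This is the bridge through which every statement
about derivatives of distributions becomes one about `dList` on test functions. -/
theorem derivList_apply (Y : List E) (f : Dist E 𝕜) (φ : Test E) :
    derivList Y f φ = (-1 : ℝ) ^ Y.length • f (dList Y φ) := by
  induction Y generalizing φ with
  | nil => simp [derivList]
  | cons a Y ih =>
    have h1 : derivList (a :: Y) f φ = - derivList Y f (dOp a φ) := by
      change (∂_{a} (derivList Y f)) φ = _
      rw [Distribution.lineDerivOp_apply_apply, map_neg]; rfl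
    have h2 : dList Y (dOp a φ) = dList (a :: Y) φ := by
      rw [dList_cons, (dOp_commute_dList a Y).eq]; rfl
    rw [h1, ih, h2, List.length_cons, pow_succ, mul_neg_one, neg_smul]

theorem dList_apply_eq_derivList (Y : List E) (f : Dist E 𝕜) (φ : Test E) :
    f (dList Y φ) = (-1 : ℝ) ^ Y.length • derivList Y f φ := by
  rw [derivList_apply, smul_smul, ← mul_pow]; simp

theorem derivList_perm {Y Z : List E} (h : Y.Perm Z) (f : Dist E 𝕜) :
    derivList Y f = derivList Z f := by
  ext φ
  rw [derivList_apply, derivList_apply, h.length_eq, dList_perm h]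

theorem derivList_append (Y Z : List E) (f : Dist E 𝕜) :
    derivList (Y ++ Z) f = derivList Y (derivList Z f) := by
  simp [derivList]

end Operators

/-! ### Averages of test functions over translations -/

section Smear

variable {E : Type*} [NormedAddCommGroup E] [NormedSpace ℝ E]
  [MeasurableSpace E] [BorelSpace E]

/-- The average of the translates of `φ` with respect to the weight `w` and the measure `μ`. -/
def smear (μ : Measure E) (w : E → ℝ) (φ : E → ℝ) (y : E) : ℝ := ∫ v, w v * φ (y + v) ∂μ

-- Reflecting both `φ` and `y` turns the average into a genuine convolution, so the smoothness
-- theory of convolutions applies. The weight `w` is `1` for splines and a cutoff `χ` when testing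
-- `IsConvolution`.
omit [NormedSpace ℝ E] [BorelSpace E] in
theorem smear_eq_convolution (μ : Measure E) (w : E → ℝ) (φ : E → ℝ) (y : E) :
    smear μ w φ y =
      (convolution w (fun z => φ (-z)) (ContinuousLinearMap.lsmul ℝ ℝ) μ) (-y) := by
  simp [smear, convolution_def]
  congr 1; ext v; congr 2; abel

theorem contDiff_smear {μ : Measure E} {w : E → ℝ} (hw : LocallyIntegrable w μ) (φ : Test E) :
    ContDiff ℝ (⊤ : ℕ∞) (smear μ w φ) := by
  have h1 : HasCompactSupport (fun z => φ (-z)) :=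
    φ.hasCompactSupport.comp_homeomorph (Homeomorph.neg E)
  have h2 : ContDiff ℝ (⊤ : ℕ∞) (fun z => φ (-z)) := φ.contDiff.comp contDiff_neg
  have h3 := h1.contDiff_convolution_right (ContinuousLinearMap.lsmul ℝ ℝ) hw h2
  have : smear μ w φ = fun y => (convolution w (fun z => φ (-z))
      (ContinuousLinearMap.lsmul ℝ ℝ) μ) (-y) := funext fun y => smear_eq_convolution μ w φ y
  rw [this]
  exact h3.comp contDiff_neg

theorem fderiv_smear {μ : Measure E} {w : E → ℝ} (hw : LocallyIntegrable w μ) (φ : Test E)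
    (y a : E) : fderiv ℝ (smear μ w φ) y a = smear μ w (dOp a φ) y := by
  have h1 : HasCompactSupport (fun z => φ (-z)) :=
    φ.hasCompactSupport.comp_homeomorph (Homeomorph.neg E)
  have h2 : ContDiff ℝ (⊤ : ℕ∞) (fun z => φ (-z)) := φ.contDiff.comp contDiff_neg
  have h2' : ContDiff ℝ 1 (fun z => φ (-z)) := h2.of_le (by exact_mod_cast le_top)
  -- A family constant in a dummy real parameter; only derivatives in the directions `(0, -a)` are
  -- used below.
  let g : ℝ → E → ℝ := fun _ z => φ (-z)
  have hg : ContDiff ℝ 1 ↿g := h2'.comp contDiff_snd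
  have h3 := hasFDerivAt_convolution_right_with_param (ContinuousLinearMap.lsmul ℝ ℝ) (g := g)
    (s := Set.univ) isOpen_univ h1.isCompact
    (fun p x _ hx => image_eq_zero_of_notMem_tsupport hx) hw hg.contDiffOn ((0 : ℝ), -y) trivial
  have this : smear μ w φ = (fun q : ℝ × E => (convolution w (g q.1)
      (ContinuousLinearMap.lsmul ℝ ℝ) μ) q.2) ∘ (fun y => ((0 : ℝ), -y)) :=
    funext fun y => smear_eq_convolution μ w φ y
  have h4 := HasFDerivAt.comp (f := fun y : E => ((0 : ℝ), -y)) y h3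
    ((hasFDerivAt_const (0 : ℝ) y).prodMk (hasFDerivAt_id y).neg)
  rw [← this] at h4
  rw [h4.fderiv, smear_eq_convolution]
  have h6 : (fun z => dOp a φ (-z)) = fun z => fderiv ℝ ↿g (0, z) (0, -a) := by
    ext z
    have h7 := HasFDerivAt.comp (f := fun q : ℝ × E => -q.2) ((0 : ℝ), z)
      (Test.differentiable φ (-z)).hasFDerivAt (hasFDerivAt_snd (𝕜 := ℝ)).neg
    have h8 : fderiv ℝ ↿g ((0 : ℝ), z) = _ := h7.fderiv
    rw [dOp_apply, h8]; simp
  have h9 : ∀ x, fderiv ℝ ↿g ((0 : ℝ), x) =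
      (fderiv ℝ (fun z => φ (-z)) x).comp (ContinuousLinearMap.snd ℝ ℝ E) := by
    intro x
    have h7 := HasFDerivAt.comp (f := fun q : ℝ × E => q.2) ((0 : ℝ), x)
      (h2'.differentiable (by simp) x).hasFDerivAt (hasFDerivAt_snd (𝕜 := ℝ))
    exact h7.fderiv
  have h10 : HasCompactSupport (fun x => fderiv ℝ ↿g ((0 : ℝ), x)) := by
    refine (h1.fderiv ℝ).mono fun x hx hx' => hx ?_
    exact (h9 x).trans (by rw [hx', ContinuousLinearMap.zero_comp])
  have h11 : Continuous (fun x => fderiv ℝ ↿g ((0 : ℝ), x)) :=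
    (hg.continuous_fderiv (by simp)).comp (by fun_prop)
  rw [h6]
  refine Eq.trans ?_ (convolution_precompR_apply (L := ContinuousLinearMap.lsmul ℝ ℝ) (μ := μ)
    (f := w) hw h10 h11 (-y) (0, -a))
  simp

omit [NormedSpace ℝ E] [BorelSpace E] in
theorem smear_eq_zero {μ : Measure E} {w : E → ℝ} {φ : E → ℝ} {y : E}
    (h : ∀ᵐ v ∂μ, φ (y + v) = 0) : smear μ w φ y = 0 := by
  unfold smear
  rw [integral_congr_ae (g := fun _ => 0)]
  · simp
  · filter_upwards [h] with v hv; simp [hv]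

theorem integrable_translate {μ : Measure E} [IsFiniteMeasureOnCompacts μ] (φ : Test E) (y : E) :
    Integrable (fun v => φ (y + v)) μ := by
  refine Continuous.integrable_of_hasCompactSupport (by fun_prop) ?_
  exact φ.hasCompactSupport.comp_homeomorph (Homeomorph.addLeft y)

end Smear

/-! ### Primitives along a direction -/

section Primitive

variable {E : Type*} [NormedAddCommGroup E] [NormedSpace ℝ E]

/-- A smooth compactly supported function, as a test function. -/
def mkTest (f : E → ℝ) (h₁ : ContDiff ℝ (⊤ : ℕ∞) f) (h₂ : HasCompactSupport f) : Test E :=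
  ⟨f, h₁, h₂, fun _ _ => trivial⟩

@[simp] theorem mkTest_apply (f : E → ℝ) (h₁ : ContDiff ℝ (⊤ : ℕ∞) f) (h₂ : HasCompactSupport f)
    (x : E) : mkTest f h₁ h₂ x = f x := rfl

theorem integral_Ioi_dOp {a : E} (ha : a ≠ 0) (φ : Test E) (x : E) :
    ∫ t in Set.Ioi (0 : ℝ), dOp a φ (x + t • a) = -φ x := by
  have h1 : ContDiff ℝ 1 (fun t : ℝ => φ (x + t • a)) :=
    (φ.contDiff.of_le (by exact_mod_cast le_top)).comp
      (contDiff_const.add (contDiff_id.smul contDiff_const))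
  have h2 : HasCompactSupport (fun t : ℝ => φ (x + t • a)) :=
    φ.hasCompactSupport.comp_isClosedEmbedding
      ((Homeomorph.addLeft x).isClosedEmbedding.comp (isClosedEmbedding_smul_left ha))
  have h3 := h2.integral_Ioi_deriv_eq h1 0
  simp only [zero_smul, add_zero] at h3
  rw [← h3]
  congr 1; ext t
  exact (hasDerivAt_dOp a φ x t).deriv.symm

variable [FiniteDimensional ℝ E] [MeasurableSpace E] [BorelSpace E]

/-- Lebesgue measure on the half-line generated by `a`. -/
def rayMeasure (a : E) : Measure E :=
  Measure.map (fun t : ℝ => t • a) (volume.restrict (Set.Ici 0))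

/-- Lebesgue measure on the line generated by `a`. -/
def lineMeasure (a : E) : Measure E := Measure.map (fun t : ℝ => t • a) volume

theorem isLocallyFiniteMeasure_map_smul {a : E} (ha : a ≠ 0) (μ : Measure ℝ)
    [IsFiniteMeasureOnCompacts μ] :
    IsLocallyFiniteMeasure (Measure.map (fun t : ℝ => t • a) μ) := by
  have : IsFiniteMeasureOnCompacts (Measure.map (fun t : ℝ => t • a) μ) := by
    refine ⟨fun K hK => ?_⟩
    rw [Measure.map_apply (by fun_prop) hK.measurableSet]
    exact ((isClosedEmbedding_smul_left ha).isCompact_preimage hK).measure_lt_top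
  exact isLocallyFiniteMeasure_of_isFiniteMeasureOnCompacts

theorem isLocallyFiniteMeasure_rayMeasure {a : E} (ha : a ≠ 0) :
    IsLocallyFiniteMeasure (rayMeasure a) :=
  isLocallyFiniteMeasure_map_smul ha _

theorem isLocallyFiniteMeasure_lineMeasure {a : E} (ha : a ≠ 0) :
    IsLocallyFiniteMeasure (lineMeasure a) :=
  isLocallyFiniteMeasure_map_smul ha _

omit [FiniteDimensional ℝ E] in
theorem smear_rayMeasure (a : E) (φ : Test E) (x : E) :
    smear (rayMeasure a) (fun _ => 1) φ x = ∫ t in Set.Ioi (0 : ℝ), φ (x + t • a) := by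
  unfold smear rayMeasure
  rw [integral_map (by fun_prop) (Continuous.aestronglyMeasurable (by fun_prop)),
    integral_Ici_eq_integral_Ioi]
  simp

omit [FiniteDimensional ℝ E] in
theorem smear_lineMeasure (a : E) (φ : Test E) (x : E) :
    smear (lineMeasure a) (fun _ => 1) φ x = ∫ t : ℝ, φ (x + t • a) := by
  unfold smear lineMeasure
  rw [integral_map (by fun_prop) (Continuous.aestronglyMeasurable (by fun_prop))]
  simp

/-- The points lying, on a line directed by `a`, between two points of `K`. -/
def between (a : E) (K : Set E) : Set E :=
  {x | ∃ s : ℝ, 0 ≤ s ∧ ∃ s' : ℝ, 0 ≤ s' ∧ x - s • a ∈ K ∧ x + s' • a ∈ K}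

-- Closed, as the intersection of `K + ℝ≥0 a` with `K - ℝ≥0 a`, each the sum of a compact and a
-- closed set; bounded, because a point between two points of `K` is no further from the first than
-- the second is.
open scoped Pointwise in
omit [MeasurableSpace E] [BorelSpace E] in
theorem isCompact_between {a : E} (ha : a ≠ 0) {K : Set E} (hK : IsCompact K) :
    IsCompact (between a K) := by
  have hray : ∀ b : E, b ≠ 0 → IsClosed ((fun t : ℝ => t • b) '' Set.Ici 0) := fun b hb =>
    (isClosedEmbedding_smul_left hb).isClosedMap _ isClosed_Ici
  have h1 : between a K = (K + (fun t : ℝ => t • a) '' Set.Ici 0) ∩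
      (K + (fun t : ℝ => t • (-a)) '' Set.Ici 0) := by
    ext x
    constructor
    · rintro ⟨s, hs, s', hs', h, h'⟩
      exact ⟨⟨_, h, _, ⟨s, hs, rfl⟩, by simp⟩, ⟨_, h', _, ⟨s', hs', rfl⟩, by simp⟩⟩
    · rintro ⟨⟨y, hy, _, ⟨s, hs, rfl⟩, rfl⟩, ⟨y', hy', _, ⟨s', hs', rfl⟩, h⟩⟩
      refine ⟨s, hs, s', hs', by simpa using hy, ?_⟩
      rw [← h]; simpa using hy'
  have h2 : IsClosed (between a K) := by
    rw [h1]
    exact ((hray a ha).add_left_of_isCompact hK).inter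
      ((hray (-a) (neg_ne_zero.2 ha)).add_left_of_isCompact hK)
  refine Metric.isCompact_of_isClosed_isBounded h2 ?_
  obtain ⟨R, hR⟩ := hK.isBounded.exists_norm_le
  refine (isBounded_iff_forall_norm_le).2 ⟨3 * R, ?_⟩
  rintro x ⟨s, hs, s', hs', h, h'⟩
  have h3 := hR _ h
  have h4 := hR _ h'
  have h5 : ‖(s + s') • a‖ ≤ R + R := by
    have : (s + s') • a = (x + s' • a) - (x - s • a) := by rw [add_smul]; abel
    rw [this]; exact (norm_sub_le _ _).trans (add_le_add h4 h3)
  have h6 : ‖s • a‖ ≤ ‖(s + s') • a‖ := by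
    rw [norm_smul, norm_smul, Real.norm_of_nonneg hs, Real.norm_of_nonneg (add_nonneg hs hs')]
    gcongr; linarith
  calc ‖x‖ = ‖(x - s • a) + s • a‖ := by simp
    _ ≤ ‖x - s • a‖ + ‖s • a‖ := norm_add_le _ _
    _ ≤ 3 * R := by linarith

/-- A test function whose integrals along the lines directed by `a` vanish is a derivative in the
direction of `a`. -/
theorem exists_primitive {a : E} (ha : a ≠ 0) (φ : Test E)
    (h0 : ∀ x, ∫ t : ℝ, φ (x + t • a) = 0) :
    ∃ ψ : Test E, dOp a ψ = φ ∧ tsupport ψ ⊆ between a (tsupport φ) := by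
  have hna : -a ≠ 0 := neg_ne_zero.2 ha
  have := isLocallyFiniteMeasure_rayMeasure hna
  have hw : LocallyIntegrable (fun _ : E => (1 : ℝ)) (rayMeasure (-a)) := locallyIntegrable_const 1
  -- The primitive is the integral of `φ` over the backward ray from `x`.
  set f := smear (rayMeasure (-a)) (fun _ => 1) φ with hf
  have hcomp := isCompact_between ha φ.hasCompactSupport
  have hsupp : Function.support f ⊆ between a (tsupport φ) := by
    intro x hx
    rw [Function.mem_support, hf, smear_rayMeasure] at hx
    have h1 : ∃ s : ℝ, 0 ≤ s ∧ φ (x + s • (-a)) ≠ 0 := by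
      by_contra! hcon
      exact hx (setIntegral_eq_zero_of_forall_eq_zero fun t ht => hcon t (le_of_lt ht))
    -- If `φ` vanished on the forward ray, the backward integral would be the integral over the
    -- whole line, which is zero by `h0`.
    have h2 : ∃ s : ℝ, 0 ≤ s ∧ φ (x + s • a) ≠ 0 := by
      by_contra! hcon
      apply hx
      rw [setIntegral_eq_integral_of_forall_compl_eq_zero]
      · rw [← h0 x, ← integral_neg_eq_self]
        simp
      · intro t ht
        have := hcon (-t) (by simpa using ht)
        simpa using this
    obtain ⟨s, hs, h⟩ := h1
    obtain ⟨s', hs', h'⟩ := h2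
    refine ⟨s, hs, s', hs', subset_tsupport _ ?_, subset_tsupport _ h'⟩
    simpa [sub_eq_add_neg] using h
  have hts : tsupport f ⊆ between a (tsupport φ) := closure_minimal hsupp hcomp.isClosed
  refine ⟨mkTest f (contDiff_smear hw φ) (hcomp.of_isClosed_subset (isClosed_tsupport f) hts),
    TestFunction.ext fun x => ?_, hts⟩
  rw [dOp_apply]
  change fderiv ℝ f x a = φ x
  rw [hf, fderiv_smear hw, smear_rayMeasure]
  have h3 := integral_Ioi_dOp hna φ x
  have h4 : dOp (-a) φ = - dOp a φ := by rw [map_neg]; rfl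
  rw [h4] at h3
  have h5 : ∀ y, (-dOp a φ) y = -(dOp a φ y) := fun y => rfl
  simp only [h5, integral_neg, neg_inj] at h3
  exact h3

omit [FiniteDimensional ℝ E] [MeasurableSpace E] [BorelSpace E] in
/-- The translate of a test function. -/
def translate (y : E) (φ : Test E) : Test E :=
  mkTest (fun x => φ (x + y)) (φ.contDiff.comp (contDiff_id.add contDiff_const))
    (φ.hasCompactSupport.comp_homeomorph (Homeomorph.addRight y))

omit [FiniteDimensional ℝ E] [MeasurableSpace E] [BorelSpace E] in
theorem mem_tsupport_translate {y : E} {φ : Test E} {x : E} (hx : x ∈ tsupport (translate y φ)) :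
    x + y ∈ tsupport φ := by
  have h : tsupport (translate y φ) ⊆ (fun x => x + y) ⁻¹' tsupport φ :=
    closure_minimal (fun z hz => subset_tsupport _ hz)
      ((isClosed_tsupport φ).preimage (by fun_prop))
  exact h hx

/-- Translation along `a` preserves the integrals over the lines directed by `a`, so those of the
difference vanish and `exists_primitive` applies. -/
theorem exists_primitive_sub_translate (a : E) (s : ℝ) (φ : Test E) :
    ∃ ψ : Test E, dOp a ψ = φ - translate (s • a) φ ∧
      tsupport ψ ⊆ between a (tsupport φ ∪ tsupport (translate (s • a) φ)) := by
  by_cases ha : a = 0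
  · refine ⟨0, ?_, by simp⟩
    ext x
    change _ = φ x - φ (x + s • a)
    simp [ha]
  obtain ⟨ψ, h1, h2⟩ := exists_primitive ha (φ - translate (s • a) φ) (by
    intro x
    have hi : ∀ y : E, Integrable (fun t : ℝ => φ (y + t • a)) := fun y =>
      Continuous.integrable_of_hasCompactSupport (by fun_prop)
        (φ.hasCompactSupport.comp_isClosedEmbedding
          ((Homeomorph.addLeft y).isClosedEmbedding.comp (isClosedEmbedding_smul_left ha)))
    have h1 : ∀ t : ℝ, (φ - translate (s • a) φ) (x + t • a) =
        φ (x + t • a) - φ (x + (t + s) • a) := by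
      intro t
      change φ (x + t • a) - φ (x + t • a + s • a) = _
      rw [add_smul, add_assoc]
    simp_rw [h1]
    rw [integral_sub (hi x) ((hi x).comp_add_right s),
      integral_add_right_eq_self (fun t : ℝ => φ (x + t • a)) s, sub_self])
  refine ⟨ψ, h1, h2.trans ?_⟩
  rintro x ⟨t, ht, t', ht', h, h'⟩
  have h3 := tsupport_sub (φ : E → ℝ) (translate (s • a) φ)
  exact ⟨t, ht, t', ht', h3 h, h3 h'⟩

omit [FiniteDimensional ℝ E] [MeasurableSpace E] [BorelSpace E] in
theorem between_subset_of_convex {a : E} {K C : Set E} (hC : Convex ℝ C) (hK : K ⊆ C) :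
    between a K ⊆ C := by
  rintro x ⟨s, hs, s', hs', h, h'⟩
  rcases eq_or_lt_of_le (add_nonneg hs hs') with h0 | h0
  · have : s = 0 := by linarith
    subst this
    exact hK (by simpa using h)
  -- The point `x` is the barycentre of `x - s • a` and `x + s' • a` with weights `s' / (s + s')`
  -- and `s / (s + s')`.
  · have := hC (hK h) (hK h') (div_nonneg hs' h0.le) (div_nonneg hs h0.le)
      (by field_simp; ring)
    convert this using 1
    rw [smul_sub, smul_add, smul_smul, smul_smul]
    have e : x = (s' / (s + s')) • x + (s / (s + s')) • x := by
      rw [← add_smul]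
      have : s' / (s + s') + s / (s + s') = 1 := by field_simp; ring
      rw [this, one_smul]
    have e2 : (s' / (s + s') * s) = (s / (s + s') * s') := by ring
    rw [e2]
    nth_rewrite 1 [e]
    abel

end Primitive

/-! ### Propagation of zeros -/

section Propagation

variable {E : Type*} [NormedAddCommGroup E] [NormedSpace ℝ E] [FiniteDimensional ℝ E]
  {F : Type*} [AddCommGroup F] [Module ℝ F]

/-- A solution of `∂_Y L = 0` near a point of the hyperplane `u = 0`, noncharacteristic for `Y`,
vanishes near this point if it does so on one side of the hyperplane. -/
theorem exists_ball_forall_eq_zero (u : Module.Dual ℝ E) {x₀ : E} (hx₀ : u x₀ = 0) (Y : List E)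
    (hY : ∀ a ∈ Y, u a ≠ 0) {r : ℝ} (hr : 0 < r) (L : Test E →ₗ[ℝ] F)
    (h₁ : ∀ φ : Test E, tsupport φ ⊆ Metric.ball x₀ r → L (dList Y φ) = 0)
    (h₂ : ∀ φ : Test E, tsupport φ ⊆ Metric.ball x₀ r ∩ {x | u x < 0} → L φ = 0) :
    ∃ r' > 0, r' ≤ r ∧ ∀ φ : Test E, tsupport φ ⊆ Metric.ball x₀ r' → L φ = 0 := by
  borelize E
  induction Y generalizing r with
  | nil => exact ⟨r, hr, le_rfl, h₁⟩
  | cons a Y ih =>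
    have ha := hY a (by simp)
    set u' := LinearMap.toContinuousLinearMap u with hu'
    have huu : ∀ x, u x = u' x := fun x => rfl
    -- With `C` of this size, the shift lowers `u` by `(‖u'‖ + 1) * r'`, more than `u` can vary on
    -- the ball of radius `r'`. The radius `r'` below is such that a ball of radius `r'`, moved by
    -- at most `C * r' * ‖a‖`, stays inside the ball of radius `r`.
    set C := (‖u'‖ + 1) / |u a| with hC
    have hC0 : 0 < C := by positivity
    have hden : 0 < 1 + C * ‖a‖ := by positivity
    set r' := r / (1 + C * ‖a‖) with hr'
    have hr'0 : 0 < r' := by positivity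
    have hr'r : r' * (1 + C * ‖a‖) = r := by rw [hr']; field_simp
    have hle : r' ≤ r := by nlinarith [mul_nonneg hr'0.le (mul_nonneg hC0.le (norm_nonneg a))]
    -- the shift that moves the ball to the side where `L` vanishes
    set s : ℝ := SignType.sign (u a) * (C * r') with hs
    have hsu : s * u a = (‖u'‖ + 1) * r' := by
      rw [hs, hC]
      have h1 : (SignType.sign (u a) : ℝ) * u a = |u a| := sign_mul_self _
      have h2 : |u a| ≠ 0 := abs_ne_zero.2 ha
      calc (SignType.sign (u a) : ℝ) * ((‖u'‖ + 1) / |u a| * r') * u a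
          = ((SignType.sign (u a) : ℝ) * u a) * ((‖u'‖ + 1) / |u a|) * r' := by ring
        _ = _ := by rw [h1]; field_simp
    have hsa : |s| ≤ C * r' := by
      rw [hs, abs_mul, abs_of_pos (mul_pos hC0 hr'0)]
      refine mul_le_of_le_one_left (mul_pos hC0 hr'0).le ?_
      rcases lt_trichotomy (u a) 0 with h | h | h
      · simp [sign_neg h]
      · simp [h]
      · simp [sign_pos h]
    have key : ∀ φ : Test E, tsupport φ ⊆ Metric.ball x₀ r' → L (dList Y φ) = 0 := by
      intro φ hφ
      obtain ⟨ψ, hψ, hψs⟩ := exists_primitive_sub_translate a s φ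
      have hball : tsupport (translate (s • a) φ) ⊆ Metric.ball x₀ r ∩ {x | u x < 0} := by
        intro x hx
        have hx := hφ (mem_tsupport_translate hx)
        rw [Metric.mem_ball, dist_eq_norm] at hx
        refine ⟨?_, ?_⟩
        · rw [Metric.mem_ball, dist_eq_norm, ← hr'r]
          calc ‖x - x₀‖ = ‖(x + s • a - x₀) - s • a‖ := by congr 1; abel
            _ ≤ ‖x + s • a - x₀‖ + ‖s • a‖ := norm_sub_le _ _
            _ < r' + C * r' * ‖a‖ := by
              refine add_lt_add_of_lt_of_le hx ?_
              rw [norm_smul, Real.norm_eq_abs]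
              gcongr
            _ = r' * (1 + C * ‖a‖) := by ring
        · have h3 : u' (x + s • a - x₀) ≤ ‖u'‖ * r' :=
            (le_abs_self _).trans ((u'.le_opNorm _).trans (by gcongr))
          have h4 : u' (x + s • a - x₀) = u x + s * u a := by
            rw [← huu, map_sub, map_add, map_smul, hx₀, smul_eq_mul, sub_zero]
          rw [h4, hsu] at h3
          change u x < 0
          nlinarith
      have h5 : tsupport ψ ⊆ Metric.ball x₀ r :=
        hψs.trans (between_subset_of_convex (convex_ball _ _)
          (Set.union_subset (hφ.trans (Metric.ball_subset_ball hle))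
            (hball.trans Set.inter_subset_left)))
      -- Applying `∂_Y` to `∂_a ψ = φ - translate φ` removes the factor `a`: the `ψ` term is killed
      -- by `h₁` and the translate lies where `L` is zero.
      have h6 := h₁ ψ h5
      rw [dList_cons, (dOp_commute_dList a Y).eq, Module.End.mul_apply, hψ, map_sub, map_sub,
        h₂ _ ((tsupport_dList_subset _ _).trans hball), sub_zero] at h6
      exact h6
    obtain ⟨r'', h7, h8, h9⟩ := ih (fun b hb => hY b (by simp [hb])) hr'0 key
      (fun φ hφ => h₂ φ (hφ.trans
        (Set.inter_subset_inter_left _ (Metric.ball_subset_ball hle))))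
    exact ⟨r'', h7, h8.trans hle, h9⟩

open scoped Manifold ContDiff in
/-- A linear functional that vanishes locally on the support of a test function vanishes on this
test function. -/
theorem eq_zero_of_locally_eq_zero (L : Test E →ₗ[ℝ] F) (φ : Test E)
    (h : ∀ x ∈ tsupport φ, ∃ ε > 0, ∀ ψ : Test E,
      tsupport ψ ⊆ Metric.ball x ε ∩ tsupport φ → L ψ = 0) : L φ = 0 := by
  choose ε hε hL using h
  let U : tsupport φ → Set E := fun x => Metric.ball x.1 (ε x.1 x.2)
  obtain ⟨ρ, hρ⟩ := SmoothPartitionOfUnity.exists_isSubordinate 𝓘(ℝ, E) (isClosed_tsupport φ) U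
    (fun i => Metric.isOpen_ball)
    (fun x hx => Set.mem_iUnion.2 ⟨⟨x, hx⟩, Metric.mem_ball_self (hε x hx)⟩)
  -- Only finitely many members of the partition meet the compact support, so linearity of `L`
  -- suffices and no continuity is needed.
  have hfin := ρ.locallyFinite.finite_nonempty_inter_compact φ.hasCompactSupport.isCompact
  let ψ : tsupport φ → Test E := fun i =>
    mkTest (fun x => ρ i x * φ x) ((ρ i).contMDiff.contDiff.mul φ.contDiff)
      φ.hasCompactSupport.mul_left
  have hsum : φ = ∑ i ∈ hfin.toFinset, ψ i := by
    ext x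
    have h1 : (∑ i ∈ hfin.toFinset, ψ i) x = ∑ i ∈ hfin.toFinset, ρ i x * φ x := by
      have : ∀ s : Finset (tsupport φ), (∑ i ∈ s, ψ i) x = ∑ i ∈ s, ψ i x := fun s => by
        classical
        induction s using Finset.induction_on with
        | empty => rfl
        | insert i s hi ih =>
          rw [Finset.sum_insert hi, Finset.sum_insert hi, ← ih]; rfl
      rw [this]; rfl
    rw [h1, ← Finset.sum_mul]
    by_cases hx : x ∈ tsupport φ
    · rw [ρ.sum_finsupport' x hx, one_mul]
      intro i hi
      rw [ρ.mem_finsupport] at hi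
      exact hfin.mem_toFinset.2 ⟨x, hi, hx⟩
    · rw [image_eq_zero_of_notMem_tsupport hx, mul_zero]
  rw [hsum, map_sum]
  refine Finset.sum_eq_zero fun i _ => hL i.1 i.2 (ψ i) ?_
  exact Set.subset_inter ((tsupport_mul_subset_left).trans (hρ i)) tsupport_mul_subset_right

end Propagation

/-! ### Nilpotency of derivatives -/

section Nilpotent

variable {E : Type*} [NormedAddCommGroup E] [NormedSpace ℝ E]
  {F : Type*} [AddCommGroup F] [Module ℝ F]

/-- If a functional `L` is annihilated by the operators `∂_c` for `c ∈ 𝒞`, and every subspace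
meeting each `c ∈ 𝒞` contains `W`, then `L` is annihilated by powers of the derivatives along the
vectors of `W`. -/
theorem exists_pow_dOp_eq_zero (S : Submodule ℝ (Test E)) (hS : ∀ v, ∀ φ ∈ S, dOp v φ ∈ S)
    (L : Test E →ₗ[ℝ] F) (W : Submodule ℝ E) (𝒞 : Set (List E))
    (h𝒞 : ∀ c ∈ 𝒞, ∀ φ ∈ S, L (dList c φ) = 0)
    (hW : ∀ P : Submodule ℝ E, (∀ c ∈ 𝒞, ∃ a ∈ c, a ∈ P) → W ≤ P) :
    ∀ v ∈ W, ∃ N : ℕ, ∀ φ ∈ S, L ((dOp v ^ N) φ) = 0 := by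
  -- The constant coefficient operators form a commutative ring, which brings in the description of
  -- a radical as an intersection of primes.
  let A := Algebra.adjoin ℝ (Set.range (dOp : E → Module.End ℝ (Test E)))
  have hA : IsMulCommutative A := Algebra.isMulCommutative_adjoin ℝ (by
    rintro _ ⟨v, rfl⟩ _ ⟨w, rfl⟩; exact dOp_commute v w)
  let _ : CommRing A := { (inferInstance : Ring A) with mul_comm := hA.is_comm.comm }
  have hcomm : ∀ S T : A, ∀ φ, S.1 (T.1 φ) = T.1 (S.1 φ) := fun S T φ =>
    congrArg (fun U : A => U.1 φ) (mul_comm S T)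
  have hSA : ∀ T : A, ∀ φ ∈ S, T.1 φ ∈ S := by
    rintro ⟨T, hT⟩
    induction hT using Algebra.adjoin_induction with
    | mem x hx => obtain ⟨v, rfl⟩ := hx; exact hS v
    | algebraMap r => intro φ hφ; exact S.smul_mem r hφ
    | add x y _ _ hx hy => intro φ hφ; exact S.add_mem (hx φ hφ) (hy φ hφ)
    | mul x y _ _ hx hy => intro φ hφ; exact hx _ (hy φ hφ)
  -- The annihilator of `L` on `S`; closure under multiplication uses commutativity and the
  -- stability of `S` under derivatives.
  let J : Ideal A :=
    { carrier := {T | ∀ φ ∈ S, L (T.1 φ) = 0}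
      add_mem' := by
        intro T U hT hU φ hφ
        change L (T.1 φ + U.1 φ) = 0
        rw [map_add, hT φ hφ, hU φ hφ, add_zero]
      zero_mem' := by
        intro φ _
        exact map_zero L
      smul_mem' := by
        intro T U hU φ hφ
        change L (T.1 (U.1 φ)) = 0
        rw [hcomm]
        exact hU _ (hSA T φ hφ) }
  let d : E → A := fun v => ⟨dOp v, Algebra.subset_adjoin ⟨v, rfl⟩⟩
  have hdlist : ∀ c : List E, ((c.map d).prod).1 = dList c := by
    intro c
    induction c with
    | nil => rfl
    | cons a c ih =>
      rw [List.map_cons, List.prod_cons, dList_cons, ← ih]; rfl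
  have hrad : ∀ v ∈ W, d v ∈ J.radical := by
    intro v hv
    rw [Ideal.radical_eq_sInf, Submodule.mem_sInf]
    rintro Q ⟨hJQ, hQ⟩
    -- The vectors of a prime `Q` containing `J`. By primality a product `∂_c ∈ Q` has a factor in
    -- `Q`, so this subspace meets every `c ∈ 𝒞`.
    let P : Submodule ℝ E :=
      { carrier := {v | d v ∈ Q}
        add_mem' := by
          intro v w hv hw
          have : d (v + w) = d v + d w := Subtype.ext (map_add dOp v w)
          change d (v + w) ∈ Q
          rw [this]; exact Q.add_mem hv hw
        zero_mem' := by
          have : d 0 = 0 := Subtype.ext (map_zero dOp)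
          change d 0 ∈ Q
          rw [this]; exact Q.zero_mem
        smul_mem' := by
          intro t v hv
          have : d (t • v) = algebraMap ℝ A t * d v := Subtype.ext (by
            change dOp (t • v) = algebraMap ℝ _ t * dOp v
            rw [map_smul, Algebra.smul_def])
          change d (t • v) ∈ Q
          rw [this]; exact Ideal.mul_mem_left Q _ hv }
    refine hW P (fun c hc => ?_) hv
    have h1 : (c.map d).prod ∈ Q := hJQ (fun φ hφ => by
      rw [hdlist]; exact h𝒞 c hc φ hφ)
    clear hc
    induction c with
    | nil => exact absurd ((Ideal.eq_top_iff_one Q).2 h1) hQ.ne_top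
    | cons a c ih =>
      rw [List.map_cons, List.prod_cons] at h1
      rcases hQ.mem_or_mem h1 with h | h
      · exact ⟨a, by simp, h⟩
      · obtain ⟨b, hb, hb'⟩ := ih h
        exact ⟨b, by simp [hb], hb'⟩
  intro v hv
  obtain ⟨N, hN⟩ := hrad v hv
  refine ⟨N, fun φ hφ => ?_⟩
  have := hN φ hφ
  have h2 : (d v ^ N).1 = dOp v ^ N := by
    induction N with
    | zero => rfl
    | succ n ih => rfl
  rwa [h2] at this

end Nilpotent

/-! ### Polynomial functions -/

section PolyFun

variable (𝕜 : Type*) [RCLike 𝕜] (E : Type*) [NormedAddCommGroup E] [NormedSpace ℝ E]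

/-- The algebra of polynomial functions on a real vector space. -/
abbrev polyFun : Subalgebra 𝕜 (E → 𝕜) :=
  Algebra.adjoin 𝕜 (Set.range fun (l : E →ₗ[ℝ] ℝ) (w : E) => ((l w : ℝ) : 𝕜))

variable {𝕜 E} [FiniteDimensional ℝ E]

theorem analyticOnNhd_of_mem_polyFun {P : E → 𝕜} (hP : P ∈ polyFun 𝕜 E) :
    AnalyticOnNhd ℝ P Set.univ := by
  induction hP using Algebra.adjoin_induction with
  | mem x hx =>
    obtain ⟨l, rfl⟩ := hx
    exact ((RCLike.ofRealCLM (K := 𝕜)).comp (LinearMap.toContinuousLinearMap l)).analyticOnNhd _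
  | algebraMap r => exact analyticOnNhd_const
  | add x y _ _ hx hy => exact hx.add hy
  | mul x y _ _ hx hy => exact hx.mul hy

theorem contDiff_of_mem_polyFun {P : E → 𝕜} (hP : P ∈ polyFun 𝕜 E) : ContDiff ℝ 1 P :=
  (contDiffOn_univ.1 ((analyticOnNhd_of_mem_polyFun hP).contDiffOn uniqueDiffOn_univ))

theorem continuous_of_mem_polyFun {P : E → 𝕜} (hP : P ∈ polyFun 𝕜 E) : Continuous P :=
  (contDiff_of_mem_polyFun hP).continuous

theorem differentiable_of_mem_polyFun {P : E → 𝕜} (hP : P ∈ polyFun 𝕜 E) : Differentiable ℝ P :=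
  (contDiff_of_mem_polyFun hP).differentiable (by simp)

theorem fderiv_mem_polyFun {P : E → 𝕜} (hP : P ∈ polyFun 𝕜 E) (v : E) :
    (fun x => fderiv ℝ P x v) ∈ polyFun 𝕜 E := by
  induction hP using Algebra.adjoin_induction with
  | mem x hx =>
    obtain ⟨l, rfl⟩ := hx
    have : (fun x : E => fderiv ℝ (fun w : E => ((l w : ℝ) : 𝕜)) x v) =
        algebraMap 𝕜 (E → 𝕜) ((l v : ℝ) : 𝕜) := by
      ext x
      have h : HasFDerivAt (fun w : E => ((l w : ℝ) : 𝕜))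
        ((RCLike.ofRealCLM (K := 𝕜)).comp (LinearMap.toContinuousLinearMap l)) x :=
        ((RCLike.ofRealCLM (K := 𝕜)).comp (LinearMap.toContinuousLinearMap l)).hasFDerivAt
      rw [h.fderiv]; rfl
    rw [this]; exact Subalgebra.algebraMap_mem _ _
  | algebraMap r =>
    have : (fun x : E => fderiv ℝ (algebraMap 𝕜 (E → 𝕜) r) x v) = 0 := by
      ext x
      have : fderiv ℝ (algebraMap 𝕜 (E → 𝕜) r) x = 0 :=
        (hasFDerivAt_const (𝕜 := ℝ) r x).fderiv
      rw [this]; rfl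
    rw [this]; exact Subalgebra.zero_mem _
  | add P Q hP hQ hx hy =>
    have : (fun x : E => fderiv ℝ (P + Q) x v) =
        (fun x => fderiv ℝ P x v) + fun x => fderiv ℝ Q x v := by
      ext x
      rw [fderiv_add (differentiable_of_mem_polyFun hP x) (differentiable_of_mem_polyFun hQ x)]
      rfl
    rw [this]; exact Subalgebra.add_mem _ hx hy
  | mul P Q hP hQ hx hy =>
    have : (fun x : E => fderiv ℝ (P * Q) x v) =
        P * (fun x => fderiv ℝ Q x v) + Q * fun x => fderiv ℝ P x v := by
      ext x
      rw [fderiv_mul (differentiable_of_mem_polyFun hP x) (differentiable_of_mem_polyFun hQ x)]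
      rfl
    rw [this]
    exact Subalgebra.add_mem _ (Subalgebra.mul_mem _ hP hy) (Subalgebra.mul_mem _ hQ hx)

variable [MeasurableSpace E] [BorelSpace E]

theorem integrable_smul_polyFun {P : E → 𝕜} (hP : Continuous P) (φ : Test E) :
    Integrable (fun x => φ x • P x) (Measure.addHaar : Measure E) :=
  Continuous.integrable_of_hasCompactSupport (by fun_prop) φ.hasCompactSupport.smul_right

/-- Integration against the function `P`, as a functional on test functions. -/
def integralAgainst (P : E → 𝕜) (hP : P ∈ polyFun 𝕜 E) : Test E →ₗ[ℝ] 𝕜 where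
  toFun φ := ∫ x, φ x • P x ∂(Measure.addHaar : Measure E)
  map_add' φ ψ := by
    have h := continuous_of_mem_polyFun hP
    rw [← integral_add (integrable_smul_polyFun h φ) (integrable_smul_polyFun h ψ)]
    congr 1; ext x; exact add_smul _ _ _
  map_smul' c φ := by
    rw [RingHom.id_apply, ← integral_smul]
    congr 1; ext x; exact mul_smul _ _ _

theorem integralAgainst_apply {P : E → 𝕜} (hP : P ∈ polyFun 𝕜 E) (φ : Test E) :
    integralAgainst P hP φ = ∫ x, φ x • P x ∂(Measure.addHaar : Measure E) := rfl

theorem integralAgainst_dOp {P : E → 𝕜} (hP : P ∈ polyFun 𝕜 E) (v : E) (φ : Test E) :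
    integralAgainst P hP (dOp v φ) =
      - integralAgainst (fun x => fderiv ℝ P x v) (fderiv_mem_polyFun hP v) φ := by
  rw [integralAgainst_apply, integralAgainst_apply]
  have h1 : ∀ x, dOp v φ x • P x = (fderiv ℝ φ x v) • P x := fun x => by rw [dOp_apply]
  simp_rw [h1]
  rw [eq_neg_iff_add_eq_zero, ← eq_neg_iff_add_eq_zero.1
    (integral_smul_fderiv_eq_neg_fderiv_smul_of_integrable
      (f := (φ : E → ℝ)) (g := P) (v := v) (μ := (Measure.addHaar : Measure E)) ?_
      (integrable_smul_polyFun (continuous_of_mem_polyFun (fderiv_mem_polyFun hP v)) φ)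
      (integrable_smul_polyFun (continuous_of_mem_polyFun hP) φ)
      (fun x _ => Test.differentiable φ x)
      (fun x _ => differentiable_of_mem_polyFun hP x)), add_comm]
  have := integrable_smul_polyFun (continuous_of_mem_polyFun hP) (dOp v φ)
  simp_rw [h1] at this
  exact this

/-- A polynomial whose density vanishes on a nonempty open set is zero. -/
theorem polyFun_eq_zero {P : E → 𝕜} (hP : P ∈ polyFun 𝕜 E) {U : Set E} (hU : IsOpen U)
    (hne : U.Nonempty) (h : ∀ φ : Test E, tsupport φ ⊆ U → integralAgainst P hP φ = 0) :
    P = 0 := by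
  have hc := continuous_of_mem_polyFun hP
  have h1 := hU.ae_eq_zero_of_integral_contDiff_smul_eq_zero (f := P)
    (μ := (Measure.addHaar : Measure E)) (hc.locallyIntegrable.locallyIntegrableOn U)
    (fun g hg hgc hgs => h (mkTest g hg hgc) hgs)
  have h2 : P =ᵐ[(Measure.addHaar : Measure E).restrict U] 0 := by
    rw [Filter.EventuallyEq, ae_restrict_iff' hU.measurableSet]
    exact h1
  have h3 := Measure.eqOn_open_of_ae_eq h2 hU hc.continuousOn continuousOn_const
  obtain ⟨x, hx⟩ := hne
  exact (analyticOnNhd_of_mem_polyFun hP).eq_of_eventuallyEq (z₀ := x)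
    (analyticOnNhd_of_mem_polyFun (Subalgebra.zero_mem _))
    (Filter.eventually_of_mem (hU.mem_nhds hx) h3)

theorem polyFun_eq_of_integralAgainst_eq {P Q : E → 𝕜} (hP : P ∈ polyFun 𝕜 E)
    (hQ : Q ∈ polyFun 𝕜 E) {U : Set E} (hU : IsOpen U) (hne : U.Nonempty)
    (h : ∀ φ : Test E, tsupport φ ⊆ U → integralAgainst P hP φ = integralAgainst Q hQ φ) :
    P = Q := by
  refine sub_eq_zero.1 (polyFun_eq_zero (Subalgebra.sub_mem _ hP hQ) hU hne fun φ hφ => ?_)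
  rw [← sub_eq_zero.2 (h φ hφ)]
  simp only [integralAgainst_apply]
  rw [← integral_sub (integrable_smul_polyFun (continuous_of_mem_polyFun hP) φ)
    (integrable_smul_polyFun (continuous_of_mem_polyFun hQ) φ)]
  congr 1; ext x; exact smul_sub _ _ _

end PolyFun

/-! ### Functionals with nilpotent derivatives are polynomial densities -/

section Box

variable {𝕜 : Type*} [RCLike 𝕜] {E : Type*} [NormedAddCommGroup E] [NormedSpace ℝ E]
  {ι : Type*}

/-- The open box of radius `ε` around `c` in the coordinates given by a basis. -/
def box (b : Module.Basis ι ℝ E) (c : E) (ε : ℝ) : Set E := {x | ∀ i, |b.coord i (x - c)| < ε}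

/-- The test functions supported in a set. -/
def supportedIn (U : Set E) : Submodule ℝ (Test E) where
  carrier := {φ | tsupport φ ⊆ U}
  add_mem' {φ ψ} hφ hψ := (tsupport_add (φ : E → ℝ) ψ).trans (Set.union_subset hφ hψ)
  zero_mem' := by
    change tsupport (0 : E → ℝ) ⊆ U
    simp
  smul_mem' c φ hφ :=
    (closure_mono (Function.support_const_smul_subset c (φ : E → ℝ))).trans hφ

theorem dOp_mem_supportedIn {U : Set E} (v : E) {φ : Test E} (hφ : φ ∈ supportedIn U) :
    dOp v φ ∈ supportedIn U :=
  (tsupport_dOp_subset v φ).trans hφ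

variable [FiniteDimensional ℝ E] [Fintype ι]

omit [Fintype ι] in
theorem coord_continuous (b : Module.Basis ι ℝ E) (i : ι) : Continuous (b.coord i) :=
  (b.coord i).continuous_of_finiteDimensional

theorem isOpen_box (b : Module.Basis ι ℝ E) (c : E) (ε : ℝ) : IsOpen (box b c ε) := by
  have : box b c ε = ⋂ i, {x | |b.coord i (x - c)| < ε} := by ext x; simp [box]
  rw [this]
  refine isOpen_iInter_of_finite fun i => isOpen_lt ?_ continuous_const
  have := coord_continuous b i
  fun_prop

omit [FiniteDimensional ℝ E] [Fintype ι] in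
theorem mem_box_self (b : Module.Basis ι ℝ E) (c : E) {ε : ℝ} (hε : 0 < ε) : c ∈ box b c ε := by
  intro i; simpa using hε

omit [FiniteDimensional ℝ E] in
theorem exists_box_subset (b : Module.Basis ι ℝ E) (c : E) {r : ℝ} (hr : 0 < r) :
    ∃ ε > 0, box b c ε ⊆ Metric.ball c r := by
  have hpos : 0 < 1 + ∑ i, ‖b i‖ := by positivity
  refine ⟨r / (1 + ∑ i, ‖b i‖), by positivity, fun x hx => ?_⟩
  rw [Metric.mem_ball, dist_eq_norm]
  calc ‖x - c‖ = ‖∑ i, b.coord i (x - c) • b i‖ := by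
        congr 1; exact (b.sum_repr (x - c)).symm
    _ ≤ ∑ i, ‖b.coord i (x - c) • b i‖ := norm_sum_le _ _
    _ ≤ ∑ i, r / (1 + ∑ i, ‖b i‖) * ‖b i‖ := by
        refine Finset.sum_le_sum fun i _ => ?_
        rw [norm_smul]
        exact mul_le_mul_of_nonneg_right (hx i).le (norm_nonneg _)
    _ = r / (1 + ∑ i, ‖b i‖) * ∑ i, ‖b i‖ := by rw [Finset.mul_sum]
    _ < r / (1 + ∑ i, ‖b i‖) * (1 + ∑ i, ‖b i‖) := by
        refine mul_lt_mul_of_pos_left (by linarith) (by positivity)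
    _ = r := by field_simp

/-- A bump function on the real line, of integral `1`. -/
def lineBump {ε : ℝ} (hε : 0 < ε) : ContDiffBump (0 : ℝ) :=
  ⟨ε / 4, ε / 2, by positivity, by linarith⟩

/-- A bump function on the real line, normalized to have integral `1`. -/
def rho {ε : ℝ} (hε : 0 < ε) : ℝ → ℝ := (lineBump hε).normed volume

theorem rho_contDiff {ε : ℝ} (hε : 0 < ε) : ContDiff ℝ (⊤ : ℕ∞) (rho hε) :=
  (lineBump hε).contDiff_normed

theorem integral_rho {ε : ℝ} (hε : 0 < ε) : ∫ t, rho hε t = 1 := (lineBump hε).integral_normed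

theorem rho_ne_zero_imp {ε : ℝ} (hε : 0 < ε) {t : ℝ} (h : rho hε t ≠ 0) : |t| ≤ ε / 2 := by
  have : t ∈ tsupport (rho hε) := subset_tsupport _ h
  rw [rho, ContDiffBump.tsupport_normed_eq, mem_closedBall_zero_iff] at this
  exact this

theorem rho_nonneg {ε : ℝ} (hε : 0 < ε) (t : ℝ) : 0 ≤ rho hε t := (lineBump hε).nonneg_normed t

theorem rho_zero_ne {ε : ℝ} (hε : 0 < ε) : rho hε 0 ≠ 0 := by
  have : (0 : ℝ) ∈ Function.support (rho hε) := by
    rw [rho, ContDiffBump.support_normed_eq]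
    exact Metric.mem_ball_self (lineBump hε).rOut_pos
  exact this

omit [FiniteDimensional ℝ E] [Fintype ι] in
theorem between_box_subset (b : Module.Basis ι ℝ E) (c : E) (ε : ℝ) {a : E} {K : Set E}
    (hK : K ⊆ box b c ε) : between a K ⊆ box b c ε := by
  refine between_subset_of_convex ?_ hK
  have : box b c ε = ⋂ i, (b.coord i) ⁻¹' Metric.ball (b.coord i c) ε := by
    ext x; simp [box, Real.dist_eq]
  rw [this]
  exact convex_iInter fun i => (convex_ball _ _).linear_preimage (b.coord i)

omit [Fintype ι] in
open scoped Classical in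
/-- Averaging a test function over a coordinate line. -/
theorem exists_average (b : Module.Basis ι ℝ E) (c : E) {ε : ℝ} (hε : 0 < ε) (i : ι) (φ : Test E)
    (hφ : tsupport φ ⊆ box b c ε) :
    ∃ φ' : Test E, tsupport φ' ⊆ box b c ε ∧
      (∀ x, φ' x = rho hε (b.coord i (x - c)) * ∫ t : ℝ, φ (x + t • b i)) ∧
      ∃ ψ : Test E, tsupport ψ ⊆ box b c ε ∧ dOp (b i) ψ = φ - φ' := by
  borelize E
  have hbi : b i ≠ 0 := b.ne_zero i
  have := isLocallyFiniteMeasure_lineMeasure hbi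
  have hw : LocallyIntegrable (fun _ : E => (1 : ℝ)) (lineMeasure (b i)) :=
    locallyIntegrable_const 1
  have hcoord := coord_continuous b i
  have hcd : ContDiff ℝ (⊤ : ℕ∞) (b.coord i) :=
    (LinearMap.toContinuousLinearMap (b.coord i)).contDiff
  set f : E → ℝ := fun x => rho hε (b.coord i (x - c)) * ∫ t : ℝ, φ (x + t • b i) with hf
  have hfc : ContDiff ℝ (⊤ : ℕ∞) f := by
    refine ((rho_contDiff hε).comp (hcd.comp (contDiff_id.sub contDiff_const))).mul ?_
    have h : (fun x => ∫ t : ℝ, φ (x + t • b i)) = smear (lineMeasure (b i)) (fun _ => 1) φ :=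
      funext fun x => (smear_lineMeasure _ _ _).symm
    rw [h]
    exact contDiff_smear hw φ
  -- The points of the support of `φ`, slid along `b i` until their `i`-th coordinate relative to
  -- `c` is at most `ε / 2` in absolute value. The other coordinates do not move, so `K` stays in
  -- the box.
  set K : Set E := (fun p : E × ℝ => p.1 + (p.2 - b.coord i (p.1 - c)) • b i) ''
    (tsupport φ ×ˢ Metric.closedBall 0 (ε / 2)) with hK
  have hKc : IsCompact K :=
    (φ.hasCompactSupport.isCompact.prod (isCompact_closedBall _ _)).image (by fun_prop)
  have hsupp : Function.support f ⊆ K := by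
    intro x hx
    have h1 : rho hε (b.coord i (x - c)) ≠ 0 := left_ne_zero_of_mul hx
    have h2 : ∫ t : ℝ, φ (x + t • b i) ≠ 0 := right_ne_zero_of_mul hx
    obtain ⟨t, ht⟩ : ∃ t : ℝ, φ (x + t • b i) ≠ 0 := by
      by_contra! hcon
      exact h2 (by simp [hcon])
    refine ⟨(x + t • b i, b.coord i (x - c)), ⟨subset_tsupport _ ht, ?_⟩, ?_⟩
    · exact mem_closedBall_zero_iff.2 (rho_ne_zero_imp hε h1)
    · have : b.coord i (x + t • b i - c) = b.coord i (x - c) + t := by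
        rw [add_sub_right_comm, map_add, map_smul]; simp
      change x + t • b i + (b.coord i (x - c) - b.coord i (x + t • b i - c)) • b i = x
      rw [this, sub_add_cancel_left, neg_smul, add_neg_cancel_right]
  have hts : tsupport f ⊆ K := closure_minimal hsupp hKc.isClosed
  have hKbox : K ⊆ box b c ε := by
    rintro _ ⟨⟨y, s⟩, ⟨hy, hs⟩, rfl⟩ j
    have h1 := hφ hy j
    rw [mem_closedBall_zero_iff, Real.norm_eq_abs] at hs
    simp only
    rw [add_sub_right_comm, map_add, map_smul]
    by_cases hij : j = i
    · subst hij
      have : b.coord j (y - c) + (s - b.coord j (y - c)) • b.coord j (b j) = s := by simp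
      rw [this]; linarith
    · have : b.coord j (b i) = 0 := by simp [Ne.symm hij]
      rw [this, smul_zero, add_zero]; exact h1
  let φ' : Test E := mkTest f hfc (hKc.of_isClosed_subset (isClosed_tsupport f) hts)
  have hφ'K : tsupport φ' ⊆ box b c ε := hts.trans hKbox
  refine ⟨φ', hφ'K, fun x => rfl, ?_⟩
  -- Since `rho` has integral `1`, replacing `φ` by its average does not change the integrals along
  -- the lines directed by `b i`.
  obtain ⟨ψ, h1, h2⟩ := exists_primitive hbi (φ - φ') (by
    intro x
    have hi : ∀ (η : Test E), Integrable (fun t : ℝ => η (x + t • b i)) := fun η =>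
      Continuous.integrable_of_hasCompactSupport (by fun_prop)
        (η.hasCompactSupport.comp_isClosedEmbedding
          ((Homeomorph.addLeft x).isClosedEmbedding.comp (isClosedEmbedding_smul_left hbi)))
    have h3 : ∀ t : ℝ, (φ - φ') (x + t • b i) = φ (x + t • b i) - φ' (x + t • b i) :=
      fun t => rfl
    simp_rw [h3]
    rw [integral_sub (hi φ) (hi φ')]
    have h4 : ∀ t : ℝ, φ' (x + t • b i) =
        rho hε (t + b.coord i (x - c)) * ∫ s : ℝ, φ (x + s • b i) := by
      intro t
      have e1 : b.coord i (x + t • b i - c) = t + b.coord i (x - c) := by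
        rw [add_sub_right_comm, map_add, map_smul]; simp [add_comm]
      have e2 : ∫ s : ℝ, φ (x + t • b i + s • b i) = ∫ s : ℝ, φ (x + s • b i) := by
        rw [← integral_add_right_eq_self (fun s : ℝ => φ (x + s • b i)) t]
        congr 1; ext s; rw [add_smul, add_assoc, add_comm (t • b i)]
      change rho hε (b.coord i (x + t • b i - c)) * ∫ s : ℝ, φ (x + t • b i + s • b i) = _
      rw [e1, e2]
    simp_rw [h4]
    rw [integral_mul_const, integral_add_right_eq_self (rho hε), integral_rho, one_mul, sub_self])
  refine ⟨ψ, h2.trans (between_box_subset b c ε ?_), h1⟩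
  exact (tsupport_sub (φ : E → ℝ) φ').trans (Set.union_subset hφ hφ'K)

/-- The product of the bump functions in all coordinates. -/
def boxBump (b : Module.Basis ι ℝ E) (c : E) {ε : ℝ} (hε : 0 < ε) (x : E) : ℝ :=
  ∏ i, rho hε (b.coord i (x - c))

theorem exists_boxBump (b : Module.Basis ι ℝ E) (c : E) {ε : ℝ} (hε : 0 < ε) :
    ∃ η : Test E, tsupport η ⊆ box b c ε ∧ ∀ x, η x = boxBump b c hε x := by
  have hcd : ∀ i, ContDiff ℝ (⊤ : ℕ∞) (b.coord i) := fun i =>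
    (LinearMap.toContinuousLinearMap (b.coord i)).contDiff
  have h1 : ContDiff ℝ (⊤ : ℕ∞) (boxBump b c hε) :=
    contDiff_prod fun i _ =>
      (rho_contDiff hε).comp ((hcd i).comp (contDiff_id.sub contDiff_const))
  set K : Set E := (fun t : ι → ℝ => c + ∑ i, t i • b i) '' Metric.closedBall 0 (ε / 2) with hK
  have hKc : IsCompact K := (isCompact_closedBall _ _).image (by fun_prop)
  have hsupp : Function.support (boxBump b c hε) ⊆ K := by
    intro x hx
    have h2 : ∀ i, rho hε (b.coord i (x - c)) ≠ 0 := fun i =>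
      (Finset.prod_ne_zero_iff.1 hx) i (Finset.mem_univ i)
    refine ⟨fun i => b.coord i (x - c), ?_, ?_⟩
    · rw [mem_closedBall_zero_iff, pi_norm_le_iff_of_nonneg (by positivity)]
      exact fun i => rho_ne_zero_imp hε (h2 i)
    · change c + ∑ i, b.coord i (x - c) • b i = x
      have := b.sum_repr (x - c)
      simp only [Module.Basis.coord_apply]
      rw [this]; abel
  have hts : tsupport (boxBump b c hε) ⊆ K := closure_minimal hsupp hKc.isClosed
  refine ⟨mkTest _ h1 (hKc.of_isClosed_subset (isClosed_tsupport _) hts), hts.trans ?_,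
    fun x => rfl⟩
  rintro _ ⟨t, ht, rfl⟩ i
  rw [mem_closedBall_zero_iff, pi_norm_le_iff_of_nonneg (by positivity)] at ht
  have := ht i
  rw [Real.norm_eq_abs] at this
  have e : b.coord i (c + ∑ j, t j • b j - c) = t i := by
    rw [add_sub_cancel_left]
    classical simp [Finsupp.single_apply]
  change |b.coord i (c + ∑ j, t j • b j - c)| < ε
  rw [e]; linarith

/-- Modulo derivatives, every test function supported in a box is a multiple of a fixed one. -/
theorem exists_smul_boxBump (b : Module.Basis ι ℝ E) (c : E) {ε : ℝ} (hε : 0 < ε) (φ : Test E)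
    (hφ : tsupport φ ⊆ box b c ε) (η : Test E) (hη : ∀ x, η x = boxBump b c hε x) :
    ∃ k : ℝ, ∀ L : Test E →ₗ[ℝ] 𝕜,
      (∀ i, ∀ ψ : Test E, tsupport ψ ⊆ box b c ε → L (dOp (b i) ψ) = 0) → L φ = k • L η := by
  classical
  -- Average one coordinate at a time. After the coordinates in `s` have been treated, the function
  -- is a product of bumps in these coordinates times a factor `F` independent of them; once `s` is
  -- everything, `F` is constant.
  have key : ∀ s : Finset ι, ∃ φ' : Test E, tsupport φ' ⊆ box b c ε ∧
      (∃ F : E → ℝ, (∀ x, φ' x = (∏ i ∈ s, rho hε (b.coord i (x - c))) * F x) ∧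
        ∀ i ∈ s, ∀ x, ∀ t : ℝ, F (x + t • b i) = F x) ∧
      ∀ L : Test E →ₗ[ℝ] 𝕜,
        (∀ i, ∀ ψ : Test E, tsupport ψ ⊆ box b c ε → L (dOp (b i) ψ) = 0) → L φ = L φ' := by
    intro s
    induction s using Finset.induction_on with
    | empty => exact ⟨φ, hφ, ⟨φ, by simp, by simp⟩, fun L _ => rfl⟩
    | insert i s hi ih =>
      obtain ⟨φ₁, h1, ⟨F, hF, hFinv⟩, h2⟩ := ih
      obtain ⟨φ₂, h3, h4, ψ, hψ, hψ'⟩ := exists_average b c hε i φ₁ h1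
      refine ⟨φ₂, h3, ⟨fun x => ∫ t : ℝ, F (x + t • b i), fun x => ?_, fun j hj x t => ?_⟩,
        fun L hL => ?_⟩
      · have e : ∫ t : ℝ, φ₁ (x + t • b i) =
            (∏ j ∈ s, rho hε (b.coord j (x - c))) * ∫ t : ℝ, F (x + t • b i) := by
          rw [← integral_const_mul]
          refine integral_congr_ae (.of_forall fun t => ?_)
          simp only
          rw [hF]
          congr 1
          refine Finset.prod_congr rfl fun j hj => ?_
          have hij : j ≠ i := fun h => hi (h ▸ hj)
          have : b.coord j (b i) = 0 := by simp [Ne.symm hij]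
          rw [add_sub_right_comm, map_add, map_smul, this, smul_zero, add_zero]
        rw [h4, Finset.prod_insert hi, mul_assoc, e]
      · rcases Finset.mem_insert.1 hj with rfl | hj
        · change ∫ s : ℝ, F (x + t • b j + s • b j) = ∫ s : ℝ, F (x + s • b j)
          rw [← integral_add_right_eq_self (fun s : ℝ => F (x + s • b j)) t]
          congr 1; ext s; rw [add_smul, add_assoc, add_comm (t • b j)]
        · change ∫ s : ℝ, F (x + t • b j + s • b i) = ∫ s : ℝ, F (x + s • b i)
          congr 1; ext s
          rw [add_right_comm, hFinv j hj]
      · have := hL i ψ hψ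
        rw [hψ', map_sub, sub_eq_zero] at this
        rw [h2 L hL, this]
  obtain ⟨φ', -, ⟨F, hF, hFinv⟩, hL⟩ := key Finset.univ
  have hconst : ∀ x, F x = F c := by
    intro x
    have h1 : ∀ s : Finset ι, F (c + ∑ i ∈ s, b.coord i (x - c) • b i) = F c := by
      intro s
      induction s using Finset.induction_on with
      | empty => simp
      | insert i s hi ih =>
        rw [Finset.sum_insert hi, add_comm (_ • b i), ← add_assoc,
          hFinv i (Finset.mem_univ i), ih]
    have h2 := h1 Finset.univ
    have h3 : ∑ i, b.coord i (x - c) • b i = x - c := b.sum_repr (x - c)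
    rw [h3, add_sub_cancel] at h2
    exact h2
  refine ⟨F c, fun L hL' => ?_⟩
  rw [hL L hL', ← map_smul]
  congr 1
  ext x
  change φ' x = F c * η x
  rw [hF, hconst, hη, boxBump, mul_comm]

variable [MeasurableSpace E] [BorelSpace E]

/-- A functional all of whose derivatives vanish on a box is, on this box, a multiple of the
integral. -/
theorem exists_eq_integral_of_flat (b : Module.Basis ι ℝ E) (c : E) {ε : ℝ} (hε : 0 < ε)
    (L : Test E →ₗ[ℝ] 𝕜)
    (hL : ∀ i, ∀ ψ : Test E, tsupport ψ ⊆ box b c ε → L (dOp (b i) ψ) = 0) :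
    ∃ (P : E → 𝕜) (hP : P ∈ polyFun 𝕜 E), ∀ φ : Test E, tsupport φ ⊆ box b c ε →
      L φ = integralAgainst P hP φ := by
  obtain ⟨η, hηs, hη⟩ := exists_boxBump b c hε
  have hone : (1 : E → 𝕜) ∈ polyFun 𝕜 E := Subalgebra.one_mem _
  have hone_flat : ∀ v, ∀ ψ : Test E, integralAgainst (1 : E → 𝕜) hone (dOp v ψ) = 0 := by
    intro v ψ
    rw [integralAgainst_dOp, integralAgainst_apply, neg_eq_zero]
    have : ∀ x, fderiv ℝ (1 : E → 𝕜) x v = 0 := by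
      intro x
      have : fderiv ℝ (1 : E → 𝕜) x = 0 := (hasFDerivAt_const (𝕜 := ℝ) (1 : 𝕜) x).fderiv
      rw [this]; rfl
    simp only [this, smul_zero, integral_zero]
  have hm : integralAgainst (1 : E → 𝕜) hone η ≠ 0 := by
    rw [integralAgainst_apply]
    have h1 : ∫ x, η x • (1 : E → 𝕜) x ∂(Measure.addHaar : Measure E) =
        ((∫ x, η x ∂(Measure.addHaar : Measure E) : ℝ) : 𝕜) := by
      rw [← integral_ofReal]
      congr 1; ext x
      simp [RCLike.real_smul_eq_coe_mul]
    rw [h1]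
    have h2 : 0 < ∫ x, η x ∂(Measure.addHaar : Measure E) := by
      refine η.continuous.integral_pos_of_hasCompactSupport_nonneg_nonzero η.hasCompactSupport
        (x := c) (fun x => ?_) ?_
      · rw [hη]; exact Finset.prod_nonneg fun i _ => rho_nonneg hε _
      · rw [hη]
        refine Finset.prod_ne_zero_iff.2 fun i _ => ?_
        rw [sub_self, map_zero]
        exact rho_zero_ne hε
    exact_mod_cast h2.ne'
  set m := integralAgainst (1 : E → 𝕜) hone η with hmdef
  refine ⟨algebraMap 𝕜 (E → 𝕜) (m⁻¹ * L η), Subalgebra.algebraMap_mem _ _, fun φ hφ => ?_⟩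
  -- The same `k` serves for every flat functional, so `L` can be compared with integration against
  -- `1`, for which `η` has nonzero integral.
  obtain ⟨k, hk⟩ := exists_smul_boxBump (𝕜 := 𝕜) b c hε φ hφ η hη
  have h1 := hk L hL
  have h2 := hk (integralAgainst (1 : E → 𝕜) hone) (fun i ψ _ => hone_flat _ ψ)
  have h3 : integralAgainst (algebraMap 𝕜 (E → 𝕜) (m⁻¹ * L η)) (Subalgebra.algebraMap_mem _ _) φ =
      integralAgainst (1 : E → 𝕜) hone φ * (m⁻¹ * L η) := by
    simp only [integralAgainst_apply]
    rw [← integral_mul_const]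
    congr 1; ext x
    simp [RCLike.real_smul_eq_coe_mul, Pi.algebraMap_apply]
  rw [h3, h2, h1, RCLike.real_smul_eq_coe_mul, RCLike.real_smul_eq_coe_mul, ← hmdef]
  field_simp

end Box

/-! ### Weyl algebra relations and polynomial densities -/

section Weyl

variable {𝕜 : Type*} [RCLike 𝕜] {E : Type*} [NormedAddCommGroup E] [NormedSpace ℝ E]
  [FiniteDimensional ℝ E] {ι : Type*}

/-- Multiplication of test functions by a linear form. -/
def mulLin (l : Module.Dual ℝ E) : Module.End ℝ (Test E) where
  toFun φ := mkTest (fun x => l x * φ x)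
    ((LinearMap.toContinuousLinearMap l).contDiff.mul φ.contDiff) φ.hasCompactSupport.mul_left
  map_add' φ ψ := by
    ext x
    exact mul_add _ _ _
  map_smul' c φ := by
    ext x
    exact mul_left_comm _ _ _

theorem mulLin_mem_supportedIn {U : Set E} (l : Module.Dual ℝ E) {φ : Test E}
    (hφ : φ ∈ supportedIn U) : mulLin l φ ∈ supportedIn U :=
  (tsupport_mul_subset_right).trans hφ

theorem mulLin_pow_mem_supportedIn {U : Set E} (l : Module.Dual ℝ E) (k : ℕ) {φ : Test E}
    (hφ : φ ∈ supportedIn U) : (mulLin l ^ k) φ ∈ supportedIn U := by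
  induction k with
  | zero => exact hφ
  | succ k ih => rw [pow_succ']; exact mulLin_mem_supportedIn l ih

/-- Leibniz rule, in the form of the canonical commutation relation of the Weyl algebra. -/
theorem dOp_mul_mulLin (v : E) (l : Module.Dual ℝ E) :
    dOp v * mulLin l = mulLin l * dOp v + l v • (1 : Module.End ℝ (Test E)) := by
  refine LinearMap.ext fun φ => TestFunction.ext fun x => ?_
  change dOp v (mulLin l φ) x = l x * dOp v φ x + l v * φ x
  have h1 : HasFDerivAt (mulLin l φ)
      (l x • fderiv ℝ φ x + φ x • LinearMap.toContinuousLinearMap l) x :=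
    (LinearMap.toContinuousLinearMap l).hasFDerivAt.mul (Test.differentiable φ x).hasFDerivAt
  rw [dOp_apply, dOp_apply, h1.fderiv]
  simp [mul_comm]

theorem dOp_commute_mulLin {v : E} {l : Module.Dual ℝ E} (h : l v = 0) :
    Commute (dOp v) (mulLin l) := by
  rw [commute_iff_eq, dOp_mul_mulLin, h, zero_smul, add_zero]

theorem dOp_mul_mulLin_pow {v : E} {l : Module.Dual ℝ E} (h : l v = 1) (k : ℕ) :
    dOp v * mulLin l ^ (k + 1) =
      mulLin l ^ (k + 1) * dOp v + ((k : ℝ) + 1) • mulLin l ^ k := by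
  induction k with
  | zero => simp [dOp_mul_mulLin, h]
  | succ k ih =>
    rw [pow_succ (mulLin l) (k + 1), ← mul_assoc, ih, add_mul, mul_assoc, dOp_mul_mulLin, h,
      one_smul, mul_add, mul_one, smul_mul_assoc, ← pow_succ, ← mul_assoc, add_assoc]
    congr 1
    push_cast
    module

/-- As `G` kills derivatives along `v`, commuting one `∂_v` to the left past `l ^ (k + 1)` leaves
just the factor `-(k + 1)`; iterating yields the signed factorial. Multiplication by `l ^ k` thus
undoes `∂_v ^ k` up to a nonzero constant, which is how a polynomial is integrated back. -/
theorem apply_mulLin_pow_dOp_pow {U : Set E} {v : E} {l : Module.Dual ℝ E} (h : l v = 1)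
    (G : Test E →ₗ[ℝ] 𝕜) (hG : ∀ φ ∈ supportedIn U, G (dOp v φ) = 0) (k : ℕ) :
    ∀ φ ∈ supportedIn U,
      G ((mulLin l ^ k) ((dOp v ^ k) φ)) = ((-1 : ℝ) ^ k * (k.factorial : ℝ)) • G φ := by
  intro φ hφ
  induction k with
  | zero => simp
  | succ k ih =>
    set ψ := (dOp v ^ k) φ with hψ
    have hψS : ψ ∈ supportedIn U := (tsupport_dOp_pow_subset v k φ).trans hφ
    have h1 : dOp v ((mulLin l ^ (k + 1)) ψ) =
        (mulLin l ^ (k + 1)) (dOp v ψ) + ((k : ℝ) + 1) • (mulLin l ^ k) ψ :=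
      congrArg (fun T : Module.End ℝ (Test E) => T ψ) (dOp_mul_mulLin_pow h k)
    have h2 := hG _ (mulLin_pow_mem_supportedIn l (k + 1) hψS)
    rw [h1, map_add, map_smul, ih, smul_smul] at h2
    rw [pow_succ' (dOp v) k, Module.End.mul_apply, eq_neg_of_add_eq_zero_left h2, ← neg_smul]
    congr 1
    rw [Nat.factorial_succ, pow_succ]
    push_cast
    ring

variable [MeasurableSpace E] [BorelSpace E]

/-- On test functions supported in `U`, the functional `L` is a polynomial density. -/
def IsPolyOn (U : Set E) (L : Test E →ₗ[ℝ] 𝕜) : Prop :=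
  ∃ (P : E → 𝕜) (hP : P ∈ polyFun 𝕜 E), ∀ φ ∈ supportedIn U, L φ = integralAgainst P hP φ

theorem IsPolyOn.add {U : Set E} {L L' : Test E →ₗ[ℝ] 𝕜} (h : IsPolyOn U L) (h' : IsPolyOn U L') :
    IsPolyOn U (L + L') := by
  obtain ⟨P, hP, h⟩ := h
  obtain ⟨Q, hQ, h'⟩ := h'
  refine ⟨P + Q, Subalgebra.add_mem _ hP hQ, fun φ hφ => ?_⟩
  rw [LinearMap.add_apply, h φ hφ, h' φ hφ]
  simp only [integralAgainst_apply]
  rw [← integral_add (integrable_smul_polyFun (continuous_of_mem_polyFun hP) φ)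
    (integrable_smul_polyFun (continuous_of_mem_polyFun hQ) φ)]
  congr 1; ext x; exact (smul_add _ _ _).symm

theorem IsPolyOn.smul {U : Set E} {L : Test E →ₗ[ℝ] 𝕜} (h : IsPolyOn U L) (c : ℝ) :
    IsPolyOn U (c • L) := by
  obtain ⟨P, hP, h⟩ := h
  refine ⟨(c : 𝕜) • P, Subalgebra.smul_mem _ hP _, fun φ hφ => ?_⟩
  rw [LinearMap.smul_apply, h φ hφ]
  simp only [integralAgainst_apply]
  rw [← integral_smul]
  congr 1; ext x
  simp only [Pi.smul_apply, RCLike.real_smul_eq_coe_mul, smul_eq_mul]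
  ring

theorem IsPolyOn.comp_mulLin {U : Set E} {L : Test E →ₗ[ℝ] 𝕜} (h : IsPolyOn U L)
    (l : Module.Dual ℝ E) : IsPolyOn U (L ∘ₗ mulLin l) := by
  obtain ⟨P, hP, h⟩ := h
  refine ⟨(fun w => ((l w : ℝ) : 𝕜)) * P,
    Subalgebra.mul_mem _ (Algebra.subset_adjoin ⟨l, rfl⟩) hP, fun φ hφ => ?_⟩
  rw [LinearMap.comp_apply, h _ (mulLin_mem_supportedIn l hφ)]
  simp only [integralAgainst_apply]
  congr 1; ext x
  change (l x * φ x) • P x = φ x • (((l x : ℝ) : 𝕜) * P x)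
  simp only [RCLike.real_smul_eq_coe_mul]
  push_cast; ring

theorem IsPolyOn.comp_mulLin_pow {U : Set E} {L : Test E →ₗ[ℝ] 𝕜} (h : IsPolyOn U L)
    (l : Module.Dual ℝ E) (k : ℕ) : IsPolyOn U (L ∘ₗ (mulLin l ^ k)) := by
  induction k generalizing L with
  | zero => exact h
  | succ k ih =>
    have : L ∘ₗ (mulLin l ^ (k + 1)) = (L ∘ₗ mulLin l) ∘ₗ (mulLin l ^ k) := by
      rw [pow_succ']; rfl
    rw [this]; exact ih (h.comp_mulLin l)

/-- Induction on the total degree bound. The exponents are `m i + 1`, so that a zero sum is exactly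
the flat case `exists_eq_integral_of_flat`. Otherwise the leading coefficient in one coordinate is
split off and both parts have a smaller bound. -/
theorem isPolyOn_box [Fintype ι] (b : Module.Basis ι ℝ E) (c : E) {ε : ℝ} (hε : 0 < ε) (N : ℕ) :
    ∀ (m : ι → ℕ), ∑ i, m i = N → ∀ L : Test E →ₗ[ℝ] 𝕜,
      (∀ i, ∀ φ ∈ supportedIn (box b c ε), L ((dOp (b i) ^ (m i + 1)) φ) = 0) →
      IsPolyOn (box b c ε) L := by
  classical
  induction N using Nat.strong_induction_on with
  | _ N ih =>
  intro m hm L hL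
  by_cases h0 : ∀ i, m i = 0
  · obtain ⟨P, hP, h⟩ := exists_eq_integral_of_flat b c hε L (fun i ψ hψ => by
      have := hL i ψ hψ
      rw [h0 i] at this
      simpa using this)
    exact ⟨P, hP, h⟩
  push Not at h0
  obtain ⟨i, hi⟩ := h0
  obtain ⟨k, hk⟩ : ∃ k, m i = k + 1 := Nat.exists_eq_succ_of_ne_zero hi
  have hsum : ∀ j : ℕ, j < m i → ∑ t, Function.update m i j t < N := by
    intro j hj
    rw [← hm]
    refine Finset.sum_lt_sum (fun t _ => ?_) ⟨i, Finset.mem_univ i, by simpa using hj⟩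
    by_cases ht : t = i
    · subst ht; simpa using hj.le
    · simp [ht]
  have hcoord : ∀ j, j ≠ i → b.coord i (b j) = 0 := fun j hj => by simp [hj]
  have hcoord1 : b.coord i (b i) = 1 := by simp
  set S := supportedIn (box b c ε) with hS
  have hpow : ∀ v n, ∀ φ ∈ S, (dOp v ^ n) φ ∈ S := fun v n φ hφ =>
    (tsupport_dOp_pow_subset v n φ).trans hφ
  -- the top coefficient in the direction of `b i`
  set G : Test E →ₗ[ℝ] 𝕜 := L ∘ₗ (dOp (b i) ^ (m i)) with hG
  have hGi : ∀ φ ∈ S, G (dOp (b i) φ) = 0 := fun φ hφ => hL i φ hφ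
  have hGj : ∀ j, ∀ φ ∈ S, G ((dOp (b j) ^ (m j + 1)) φ) = 0 := by
    intro j φ hφ
    have hc : Commute (dOp (b i) ^ m i) (dOp (b j) ^ (m j + 1)) :=
      (dOp_commute (b i) (b j)).pow_pow _ _
    change L ((dOp (b i) ^ m i * dOp (b j) ^ (m j + 1)) φ) = 0
    rw [hc.eq]
    exact hL j _ (hpow _ _ φ hφ)
  -- `G` is flat in the direction `b i`, so its `i`-th bound drops from `m i > 0` to `0`.
  have hGpoly : IsPolyOn (box b c ε) G := by
    refine ih _ (hsum 0 (by omega)) (Function.update m i 0) rfl G fun j φ hφ => ?_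
    by_cases hj : j = i
    · subst hj; simpa using hGi φ hφ
    · rw [Function.update_of_ne hj]; exact hGj j φ hφ
  set r : ℝ := ((-1 : ℝ) ^ m i * ((m i).factorial : ℝ))⁻¹ with hr
  have hr' : r * ((-1 : ℝ) ^ m i * ((m i).factorial : ℝ)) = 1 := by
    rw [hr]
    exact inv_mul_cancel₀ (mul_ne_zero (pow_ne_zero _ (by norm_num))
      (Nat.cast_ne_zero.2 (Nat.factorial_ne_zero _)))
  set M : Module.End ℝ (Test E) := mulLin (b.coord i) ^ m i with hM
  -- Subtracting `x_i ^ (m i)` times the top coefficient, normalized by `r`, makes `∂_i ^ (m i)`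
  -- vanish and lowers the `i`-th bound to `k = m i - 1`. The other bounds survive because `x_i`
  -- commutes with `∂_j`.
  have hLpoly : IsPolyOn (box b c ε) (L - r • (G ∘ₗ M)) := by
    refine ih _ (hsum k (by omega)) (Function.update m i k) rfl _ fun j φ hφ => ?_
    rw [LinearMap.sub_apply, LinearMap.smul_apply, LinearMap.comp_apply]
    by_cases hj : j = i
    · subst hj
      rw [Function.update_self, ← hk, hM,
        apply_mulLin_pow_dOp_pow hcoord1 G hGi (m j) φ hφ, smul_smul, hr', one_smul, hG]
      exact sub_self _
    · rw [Function.update_of_ne hj, hL j φ hφ, zero_sub, neg_eq_zero]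
      have hc : Commute M (dOp (b j) ^ (m j + 1)) :=
        ((dOp_commute_mulLin (hcoord j hj)).symm).pow_pow _ _
      have : M ((dOp (b j) ^ (m j + 1)) φ) = (dOp (b j) ^ (m j + 1)) (M φ) :=
        congrArg (fun T : Module.End ℝ (Test E) => T φ) hc.eq
      rw [this, hGj j _ (mulLin_pow_mem_supportedIn _ _ hφ), smul_zero]
  have : L = (L - r • (G ∘ₗ M)) + r • (G ∘ₗ M) := by abel
  rw [this]
  exact hLpoly.add ((hGpoly.comp_mulLin_pow _ _).smul r)

/-- A functional on a connected open set all of whose derivatives are nilpotent is a polynomial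
density. -/
theorem isPolyOn_of_nilpotent {U : Set E} (hU : IsOpen U) (hconn : IsPreconnected U)
    (hne : U.Nonempty) (L : Test E →ₗ[ℝ] 𝕜)
    (hL : ∀ v : E, ∃ N : ℕ, ∀ φ ∈ supportedIn U, L ((dOp v ^ N) φ) = 0) : IsPolyOn U L := by
  have hloc : ∀ x ∈ U, ∃ r > 0, Metric.ball x r ⊆ U ∧ IsPolyOn (Metric.ball x r) L := by
    intro x hx
    obtain ⟨R, hR, hRU⟩ := Metric.isOpen_iff.1 hU x hx
    let b := Module.finBasis ℝ E
    obtain ⟨ε, hε, hbox⟩ := exists_box_subset b x hR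
    choose N hN using hL
    obtain ⟨P, hP, h⟩ := isPolyOn_box b x hε _ (fun i => N (b i)) rfl L (fun i φ hφ => by
      rw [pow_succ, Module.End.mul_apply]
      exact hN (b i) _ (dOp_mem_supportedIn _ (hφ.trans (hbox.trans hRU))))
    obtain ⟨r, hr, hrbox⟩ := Metric.isOpen_iff.1 (isOpen_box b x ε) x (mem_box_self b x hε)
    exact ⟨r, hr, hrbox.trans (hbox.trans hRU), P, hP, fun φ hφ => h φ (hφ.trans hrbox)⟩
  obtain ⟨x₀, hx₀⟩ := hne
  obtain ⟨r₀, hr₀, -, P, hP, hLP⟩ := hloc x₀ hx₀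
  -- The points near which `L` has density `Q`. These sets are open and cover `U`; for distinct
  -- polynomials they are disjoint, since a polynomial is determined on a ball. Connectedness leaves
  -- one polynomial for all of `U`.
  let good (Q : E → 𝕜) : Set E := {x | ∃ r > 0, ∃ hQ : Q ∈ polyFun 𝕜 E,
    ∀ φ ∈ supportedIn (Metric.ball x r), L φ = integralAgainst Q hQ φ}
  have hopen : ∀ Q, IsOpen (good Q) := by
    intro Q
    rw [Metric.isOpen_iff]
    rintro x ⟨r, hr, hQ, h⟩
    refine ⟨r, hr, fun y hy => ?_⟩
    obtain ⟨δ, hδ, hsub⟩ := Metric.isOpen_iff.1 (Metric.isOpen_ball (x := x) (ε := r)) y hy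
    exact ⟨δ, hδ, hQ, fun φ hφ => h φ (hφ.trans hsub)⟩
  have hdisj : Disjoint (good P) (⋃ Q ∈ {Q | Q ≠ P}, good Q) := by
    rw [Set.disjoint_left]
    rintro x ⟨r, hr, hP', h⟩ hx
    obtain ⟨Q, hQP, r', hr', hQ, h'⟩ := Set.mem_iUnion₂.1 hx
    refine hQP (polyFun_eq_of_integralAgainst_eq hQ hP (Metric.isOpen_ball (x := x)
      (ε := min r r')) ⟨x, Metric.mem_ball_self (lt_min hr hr')⟩ fun φ hφ => ?_)
    rw [← h φ (hφ.trans (Metric.ball_subset_ball (min_le_left _ _))),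
      ← h' φ (hφ.trans (Metric.ball_subset_ball (min_le_right _ _)))]
  have hsub : U ⊆ good P := by
    refine IsPreconnected.subset_left_of_subset_union (hopen P)
      (isOpen_biUnion fun Q _ => hopen Q) hdisj (fun x hx => ?_)
      ⟨x₀, hx₀, r₀, hr₀, hP, hLP⟩ hconn
    obtain ⟨r, hr, -, Q, hQ, h⟩ := hloc x hx
    by_cases hQP : Q = P
    · subst hQP; exact Or.inl ⟨r, hr, hQ, h⟩
    · exact Or.inr (Set.mem_iUnion₂.2 ⟨Q, hQP, r, hr, hQ, h⟩)
  refine ⟨P, hP, fun φ hφ => ?_⟩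
  rw [← sub_eq_zero, ← LinearMap.sub_apply]
  refine eq_zero_of_locally_eq_zero _ φ fun x hx => ?_
  obtain ⟨r, hr, hP', h⟩ := hsub (hφ hx)
  refine ⟨r, hr, fun ψ hψ => ?_⟩
  rw [LinearMap.sub_apply, sub_eq_zero]
  exact h ψ (hψ.trans Set.inter_subset_left)

end Weyl

/-! ### Rational subspaces -/

section Rational

variable {V : Type*} [NormedAddCommGroup V] [NormedSpace ℝ V]

theorem mem_inside {X : List V} {r : Submodule ℝ V} {a : V} :
    a ∈ inside X r ↔ a ∈ X ∧ a ∈ r := by simp [inside]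

theorem mem_outside {X : List V} {r : Submodule ℝ V} {a : V} :
    a ∈ outside X r ↔ a ∈ X ∧ a ∉ r := by simp [outside]

theorem mem_spanOf {X : List V} {a : V} (h : a ∈ X) : a ∈ spanOf X := Submodule.subset_span h

theorem outside_append_inside_perm (X : List V) (r : Submodule ℝ V) :
    (outside X r ++ inside X r).Perm X := by
  classical
  have := List.filter_append_perm (fun a => decide (a ∈ r)) X
  refine (List.perm_append_comm.trans ?_)
  convert this using 2
  · unfold inside; congr
  · unfold outside; congr; ext a; simp

theorem le_spanOf_of_rational {X : List V} {r : Submodule ℝ V} (h : r ∈ rationalSubspaces X) :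
    r ≤ spanOf X := by
  obtain ⟨s, hs, rfl⟩ := h
  exact Submodule.span_mono hs

theorem spanOf_mem_rationalSubspaces (X : List V) : spanOf X ∈ rationalSubspaces X :=
  ⟨_, subset_rfl, rfl⟩

theorem sup_span_mem_rationalSubspaces {X : List V} {r : Submodule ℝ V}
    (h : r ∈ rationalSubspaces X) {a : V} (ha : a ∈ X) :
    r ⊔ Submodule.span ℝ {a} ∈ rationalSubspaces X := by
  obtain ⟨s, hs, rfl⟩ := h
  refine ⟨s ∪ {a}, Set.union_subset hs (by simpa using ha), ?_⟩
  rw [Submodule.span_union]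

theorem rationalHyperplanes_finite (X : List V) : (rationalHyperplanes X).Finite := by
  have h1 : (Set.powerset {a | a ∈ X}).Finite := (List.finite_toSet X).finite_subsets
  refine (h1.image (Submodule.span ℝ)).subset ?_
  rintro t ⟨⟨s, hs, rfl⟩, -⟩
  exact ⟨s, hs, rfl⟩

theorem spanOf_inside {X : List V} {r : Submodule ℝ V} (h : r ∈ rationalSubspaces X) :
    spanOf (inside X r) = r := by
  apply le_antisymm
  · exact Submodule.span_le.2 fun a ha => (mem_inside.1 ha).2
  · obtain ⟨s, hs, rfl⟩ := h
    refine Submodule.span_mono fun a ha => mem_inside.2 ⟨hs ha, Submodule.subset_span ha⟩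

theorem rational_of_rational_inside {X : List V} {r H : Submodule ℝ V}
    (h : r ∈ rationalSubspaces (inside X H)) : r ∈ rationalSubspaces X ∧ r ≤ H := by
  obtain ⟨s, hs, rfl⟩ := h
  exact ⟨⟨s, fun a ha => (mem_inside.1 (hs ha)).1, rfl⟩,
    Submodule.span_le.2 fun a ha => (mem_inside.1 (hs ha)).2⟩

theorem outside_inside_append_perm {X : List V} {r H : Submodule ℝ V} (h : r ≤ H) :
    (outside (inside X H) r ++ outside X H).Perm (outside X r) := by
  classical
  have h1 := (outside_append_inside_perm (outside X r) H)
  have h2 : outside (outside X r) H = outside X H := by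
    unfold outside
    rw [List.filter_filter]
    congr 1; ext a
    by_cases ha : a ∈ H
    · simp [ha]
    · have : a ∉ r := fun h' => ha (h h')
      simp [ha, this]
  have h3 : inside (outside X r) H = outside (inside X H) r := by
    unfold outside inside
    rw [List.filter_filter, List.filter_filter]
    congr 1; ext a
    exact Bool.and_comm _ _
  rw [h2, h3] at h1
  exact List.perm_append_comm.trans h1

variable [FiniteDimensional ℝ V]

theorem finrank_sup_span_singleton {r : Submodule ℝ V} {a : V} (ha : a ∉ r) :
    Module.finrank ℝ ↥(r ⊔ Submodule.span ℝ {a}) = Module.finrank ℝ r + 1 := by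
  have h0 : a ≠ 0 := fun h => ha (h ▸ r.zero_mem)
  have h1 := Submodule.finrank_sup_add_finrank_inf_eq r (Submodule.span ℝ {a})
  have h2 : r ⊓ Submodule.span ℝ {a} = ⊥ := by
    rw [Submodule.eq_bot_iff]
    rintro x ⟨hx, hx'⟩
    obtain ⟨c, rfl⟩ := Submodule.mem_span_singleton.1 hx'
    by_contra hc
    have hc0 : c ≠ 0 := fun h => hc (by simp [h])
    exact ha ((r.smul_mem_iff hc0).1 hx)
  rw [h2, finrank_bot, add_zero, finrank_span_singleton h0] at h1
  exact h1

/-- A proper rational subspace is contained in a rational hyperplane. -/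
theorem exists_rationalHyperplane {X : List V} {r : Submodule ℝ V} (h : r ∈ rationalSubspaces X)
    (hr : r ≠ spanOf X) : ∃ t ∈ rationalHyperplanes X, r ≤ t := by
  have hle := le_spanOf_of_rational h
  have hlt : Module.finrank ℝ r < Module.finrank ℝ (spanOf X) :=
    Submodule.finrank_lt_finrank_of_lt (lt_of_le_of_ne hle hr)
  obtain ⟨k, hk⟩ : ∃ k, Module.finrank ℝ r + 1 + k = Module.finrank ℝ (spanOf X) :=
    ⟨_, Nat.add_sub_cancel' hlt⟩
  clear hlt hle
  induction k generalizing r with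
  | zero => exact ⟨r, ⟨h, hk⟩, le_rfl⟩
  | succ k ih =>
    obtain ⟨a, ha, har⟩ : ∃ a ∈ X, a ∉ r := by
      by_contra! hcon
      exact hr (le_antisymm (le_spanOf_of_rational h) (Submodule.span_le.2 hcon))
    have h1 := finrank_sup_span_singleton har
    have h2 := sup_span_mem_rationalSubspaces h ha
    obtain ⟨t, ht, hrt⟩ := ih h2 (fun he => by rw [← he, h1] at hk; omega) (by rw [h1]; omega)
    exact ⟨t, ht, le_sup_left.trans hrt⟩

omit [FiniteDimensional ℝ V] in
theorem ne_spanOf_of_rationalHyperplane {X : List V} {t : Submodule ℝ V}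
    (h : t ∈ rationalHyperplanes X) : t ≠ spanOf X := by
  rintro rfl
  have := h.2
  omega

/-- A subspace meeting all cocircuits contains the span of the list. -/
theorem spanOf_le_of_meets_cocircuits {X : List V} {P : Submodule ℝ V}
    (h : ∀ t ∈ rationalHyperplanes X, ∃ a ∈ outside X t, a ∈ P) : spanOf X ≤ P := by
  set r := Submodule.span ℝ {a | a ∈ X ∧ a ∈ P} with hr
  have hrat : r ∈ rationalSubspaces X := ⟨_, fun a ha => ha.1, rfl⟩
  have hrP : r ≤ P := Submodule.span_le.2 fun a ha => ha.2
  by_cases he : r = spanOf X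
  · rw [← he]; exact hrP
  · obtain ⟨t, ht, hrt⟩ := exists_rationalHyperplane hrat he
    obtain ⟨a, ha, haP⟩ := h t ht
    obtain ⟨haX, hat⟩ := mem_outside.1 ha
    exact absurd (hrt (Submodule.subset_span ⟨haX, haP⟩)) hat

/-- Add to `s` any vector of `X` outside `H`. Thus a point of `H` avoiding the other rational
hyperplanes of `X` is regular for `X ∩ H`. -/
theorem exists_rationalHyperplane_ne {X : List V} {H s : Submodule ℝ V}
    (hH : H ∈ rationalHyperplanes X) (hs : s ∈ rationalHyperplanes (inside X H)) :
    ∃ t ∈ rationalHyperplanes X, t ≠ H ∧ s ≤ t := by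
  obtain ⟨a, ha, haH⟩ : ∃ a ∈ X, a ∉ H := by
    by_contra! hcon
    exact ne_spanOf_of_rationalHyperplane hH
      (le_antisymm (le_spanOf_of_rational hH.1) (Submodule.span_le.2 hcon))
  obtain ⟨hsX, hsH⟩ := rational_of_rational_inside hs.1
  have has : a ∉ s := fun h => haH (hsH h)
  have h1 := finrank_sup_span_singleton has
  have h2 := hs.2
  rw [spanOf_inside hH.1] at h2
  refine ⟨s ⊔ Submodule.span ℝ {a}, ⟨sup_span_mem_rationalSubspaces hsX ha, ?_⟩, ?_, le_sup_left⟩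
  · rw [h1, h2]; exact hH.2
  · intro he
    exact haH (he ▸ le_sup_right (a := s) (Submodule.mem_span_singleton_self a))

end Rational

/-! ### Topes -/

section Topes

variable {V : Type*} [NormedAddCommGroup V] [NormedSpace ℝ V]

theorem IsTope.nonempty {X : List V} {τ : Set V} (h : IsTope X τ) : τ.Nonempty := by
  obtain ⟨x, hx, rfl⟩ := h
  exact ⟨x, mem_connectedComponentIn hx⟩

theorem IsTope.isPreconnected {X : List V} {τ : Set V} (h : IsTope X τ) : IsPreconnected τ := by
  obtain ⟨x, hx, rfl⟩ := h
  exact isPreconnected_connectedComponentIn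

theorem IsTope.subset_regularLocus {X : List V} {τ : Set V} (h : IsTope X τ) :
    τ ⊆ regularLocus X := by
  obtain ⟨x, hx, rfl⟩ := h
  exact connectedComponentIn_subset _ _

theorem IsTope.subset_spanOf {X : List V} {τ : Set V} (h : IsTope X τ) :
    τ ⊆ (spanOf X : Set V) := fun _ hx => (h.subset_regularLocus hx).1

theorem IsTope.eq_connectedComponentIn {X : List V} {τ : Set V} (h : IsTope X τ) {x : V}
    (hx : x ∈ τ) : τ = connectedComponentIn (regularLocus X) x := by
  obtain ⟨y, hy, rfl⟩ := h
  exact connectedComponentIn_eq hx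

theorem mem_regularLocus {X : List V} {x : V} :
    x ∈ regularLocus X ↔ x ∈ spanOf X ∧ ∀ t ∈ rationalHyperplanes X, x ∉ t := by
  simp [regularLocus]

theorem IsTope.mem_of_convex {X : List V} {τ : Set V} (h : IsTope X τ) {C : Set V}
    (hC : Convex ℝ C) (hCX : C ⊆ regularLocus X) {x y : V} (hx : x ∈ τ) (hxC : x ∈ C)
    (hy : y ∈ C) : y ∈ τ := by
  rw [h.eq_connectedComponentIn hx]
  exact hC.isPreconnected.subset_connectedComponentIn hxC hCX hy

variable [FiniteDimensional ℝ V]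

/-- There are finitely many rational hyperplanes, so their union is closed; a small ball of the span
that avoids it is convex and stays in one component. -/
theorem IsTope.exists_ball {X : List V} {τ : Set V} (h : IsTope X τ) {x : V} (hx : x ∈ τ) :
    ∃ ε > 0, ∀ y ∈ spanOf X, y ∈ Metric.ball x ε → y ∈ τ := by
  have hcl : IsClosed (⋃ t ∈ rationalHyperplanes X, (t : Set V)) :=
    (rationalHyperplanes_finite X).isClosed_biUnion fun t _ => t.closed_of_finiteDimensional
  obtain ⟨ε, hε, hb⟩ := Metric.isOpen_iff.1 hcl.isOpen_compl x (h.subset_regularLocus hx).2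
  refine ⟨ε, hε, fun y hy hyb => ?_⟩
  exact h.mem_of_convex (C := (spanOf X : Set V) ∩ Metric.ball x ε)
    ((spanOf X).convex.inter (convex_ball _ _)) (fun z hz => ⟨hz.1, hb hz.2⟩) hx
    ⟨h.subset_spanOf hx, Metric.mem_ball_self hε⟩ ⟨hy, hyb⟩

theorem pos_of_isPreconnected {τ : Set V} (hτ : IsPreconnected τ) (l : Module.Dual ℝ V)
    (hl : ∀ x ∈ τ, l x ≠ 0) {x y : V} (hx : x ∈ τ) (hy : y ∈ τ) (hpos : 0 < l x) : 0 < l y := by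
  by_contra hneg
  obtain ⟨z, hz, hz0⟩ := hτ.intermediate_value hy hx
    l.continuous_of_finiteDimensional.continuousOn ⟨not_lt.1 hneg, hpos.le⟩
  exact hl z hz hz0

/-- The linear form defining a hyperplane, with a given nonvanishing sign at a point. -/
theorem exists_linearForm {t : Submodule ℝ V}
    (ht : Module.finrank ℝ t + 1 = Module.finrank ℝ V) {x : V} (hx : x ∉ t) :
    ∃ l : Module.Dual ℝ V, (∀ y, l y = 0 ↔ y ∈ t) ∧ 0 < l x := by
  have hlt : t < ⊤ := by
    rw [lt_top_iff_ne_top]; rintro rfl; rw [finrank_top] at ht; omega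
  obtain ⟨l, hl, htl⟩ := t.exists_le_ker_of_lt_top hlt
  have hker : LinearMap.ker l = t := by
    symm
    refine Submodule.eq_of_le_of_finrank_le htl ?_
    have h1 : Module.finrank ℝ (LinearMap.ker l) < Module.finrank ℝ V :=
      Submodule.finrank_lt (fun h => hl (LinearMap.ker_eq_top.1 h))
    omega
  have hiff : ∀ y, l y = 0 ↔ y ∈ t := fun y => by rw [← hker, LinearMap.mem_ker]
  rcases lt_trichotomy (l x) 0 with h | h | h
  · exact ⟨-l, fun y => by simp [hiff], by simpa using h⟩
  · exact absurd ((hiff x).1 h) hx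
  · exact ⟨l, hiff, h⟩

-- The open polyhedral cone cut out by the forms is convex and avoids all rational hyperplanes, so
-- it cannot leave the component.
omit [FiniteDimensional ℝ V] in
theorem IsTope.mem_of_pos {X : List V} (hX : spanOf X = ⊤) {τ : Set V} (h : IsTope X τ) {y : V}
    (hy : ∀ t ∈ rationalHyperplanes X, ∃ l : Module.Dual ℝ V, (∀ x ∈ t, l x = 0) ∧
      (∀ x ∈ τ, 0 < l x) ∧ 0 < l y) : y ∈ τ := by
  choose! l hl hpos hly using hy
  obtain ⟨x, hx⟩ := h.nonempty
  refine h.mem_of_convex (C := ⋂ t ∈ rationalHyperplanes X, {z | 0 < l t z}) ?_ ?_ hx ?_ ?_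
  · exact convex_iInter₂ fun t _ => convex_halfSpace_gt (l t).isLinear 0
  · intro z hz
    refine mem_regularLocus.2 ⟨hX ▸ Submodule.mem_top, fun t ht hzt => ?_⟩
    have h1 : 0 < l t z := Set.mem_iInter₂.1 hz t ht
    rw [hl t ht z hzt] at h1
    exact lt_irrefl _ h1
  · exact Set.mem_iInter₂.2 fun t ht => hpos t ht x hx
  · exact Set.mem_iInter₂.2 fun t ht => hly t ht

theorem IsTope.exists_form {X : List V} (hX : spanOf X = ⊤) {τ : Set V} (h : IsTope X τ)
    {t : Submodule ℝ V} (ht : t ∈ rationalHyperplanes X) :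
    ∃ l : Module.Dual ℝ V, (∀ x, l x = 0 ↔ x ∈ t) ∧ ∀ x ∈ τ, 0 < l x := by
  obtain ⟨x, hx⟩ := h.nonempty
  have hne : ∀ y ∈ τ, y ∉ t := fun y hy => (mem_regularLocus.1 (h.subset_regularLocus hy)).2 t ht
  have hdim := ht.2
  rw [hX, finrank_top] at hdim
  obtain ⟨l, hl, hlx⟩ := exists_linearForm hdim (hne x hx)
  exact ⟨l, hl, fun y hy => pos_of_isPreconnected h.isPreconnected l
    (fun z hz h0 => hne z hz ((hl z).1 h0)) hx hy hlx⟩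

omit [FiniteDimensional ℝ V] in
theorem mem_closure_of_forall_pos {τ : Set V} {c y : V} (h : ∀ s : ℝ, 0 < s → c + s • y ∈ τ) :
    c ∈ closure τ := by
  have h1 : Filter.Tendsto (fun s : ℝ => c + s • y) (nhdsWithin 0 (Set.Ioi 0)) (nhds c) := by
    have : Continuous (fun s : ℝ => c + s • y) := by fun_prop
    have h2 := (this.tendsto 0).mono_left (nhdsWithin_le_nhds (s := Set.Ioi 0))
    simpa using h2
  exact mem_closure_of_tendsto h1 (Filter.eventually_of_mem self_mem_nhdsWithin fun s hs => h s hs)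

theorem nonneg_of_mem_closure {τ : Set V} {l : Module.Dual ℝ V} (h : ∀ x ∈ τ, 0 < l x) {c : V}
    (hc : c ∈ closure τ) : 0 ≤ l c := by
  have hcl : IsClosed {x | 0 ≤ l x} :=
    isClosed_le continuous_const l.continuous_of_finiteDimensional
  exact closure_minimal (fun x hx => (h x hx).le) hcl hc

/-- The local structure of two adjacent topes near a generic point of their common wall. -/
theorem exists_wall_point {X : List V} (hX : spanOf X = ⊤) {τ₁ τ₂ : Set V} (hτ₁ : IsTope X τ₁)
    (hτ₂ : IsTope X τ₂) {H : Submodule ℝ V}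
    (hH : Submodule.span ℝ (closure τ₁ ∩ closure τ₂) = H)
    (hHdim : Module.finrank ℝ H + 1 = Module.finrank ℝ V) {u : Module.Dual ℝ V}
    (huH : ∀ h ∈ H, u h = 0) (huτ₁ : ∀ x ∈ τ₁, 0 < u x) :
    H ∈ rationalHyperplanes X ∧ (∀ x, u x = 0 ↔ x ∈ H) ∧ ∃ x₀ ∈ H,
      x₀ ∈ closure τ₁ ∩ closure τ₂ ∧ x₀ ∈ regularLocus (inside X H) ∧
      closure τ₁ ∩ closure τ₂ ⊆ closure (connectedComponentIn (regularLocus (inside X H)) x₀) ∧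
      ∃ ε > 0, ∀ y ∈ Metric.ball x₀ ε, (0 < u y → y ∈ τ₁) ∧ (u y < 0 → y ∈ τ₂) := by
  classical
  obtain ⟨y₁, hy₁⟩ := hτ₁.nonempty
  obtain ⟨y₂, hy₂⟩ := hτ₂.nonempty
  have hCH : closure τ₁ ∩ closure τ₂ ⊆ (H : Set V) := by rw [← hH]; exact Submodule.subset_span
  have hHtop : H ≠ ⊤ := by rintro rfl; rw [finrank_top] at hHdim; omega
  have huker : ∀ x, u x = 0 ↔ x ∈ H := by
    refine fun x => ⟨fun hx => ?_, huH x⟩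
    have h1 : LinearMap.ker u ≠ ⊤ := fun h => by
      have := huτ₁ y₁ hy₁
      rw [LinearMap.ker_eq_top.1 h] at this
      simp at this
    have h2 := Submodule.finrank_lt h1
    have h3 : H = LinearMap.ker u :=
      Submodule.eq_of_le_of_finrank_le (fun x hx => huH x hx) (by omega)
    rw [h3]; exact hx
  choose! l hl hlpos using fun t (ht : t ∈ rationalHyperplanes X) => hτ₁.exists_form hX ht
  -- If the topes coincided, their common closure would contain a ball and could not span a proper
  -- subspace.
  have hneq : τ₁ ≠ τ₂ := by
    rintro rfl
    apply hHtop
    rw [Submodule.eq_top_iff']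
    obtain ⟨ε, hε, hb⟩ := hτ₁.exists_ball hy₁
    rw [hX] at hb
    have hsub : Metric.ball y₁ ε ⊆ (H : Set V) := fun y hy =>
      hCH ⟨subset_closure (hb y trivial hy), subset_closure (hb y trivial hy)⟩
    have := Submodule.eq_top_of_nonempty_interior' H
      ⟨y₁, interior_maximal hsub Metric.isOpen_ball (Metric.mem_ball_self hε)⟩
    intro x; rw [this]; trivial
  -- If `t` separates the topes, its form is both nonnegative and nonpositive on the common closure,
  -- so `H ≤ t`, and the dimensions agree.
  have hsep : ∀ t ∈ rationalHyperplanes X, (∀ x ∈ τ₂, 0 < l t x) ∨ H = t := by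
    intro t ht
    by_cases h0 : 0 < l t y₂
    · left
      intro x hx
      exact pos_of_isPreconnected hτ₂.isPreconnected (l t) (fun z hz hz0 =>
        (mem_regularLocus.1 (hτ₂.subset_regularLocus hz)).2 t ht ((hl t ht z).1 hz0)) hy₂ hx h0
    · right
      have hneg : ∀ x ∈ τ₂, 0 < (-l t) x := by
        intro x hx
        have hnz : ∀ z ∈ τ₂, l t z ≠ 0 := fun z hz hz0 =>
          (mem_regularLocus.1 (hτ₂.subset_regularLocus hz)).2 t ht ((hl t ht z).1 hz0)
        refine pos_of_isPreconnected hτ₂.isPreconnected (-l t) (fun z hz => ?_) hy₂ hx ?_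
        · simpa using hnz z hz
        · simpa using lt_of_le_of_ne (not_lt.1 h0) (hnz y₂ hy₂)
      have hle : H ≤ t := by
        rw [← hH]
        refine Submodule.span_le.2 fun c hc => (hl t ht c).1 (le_antisymm ?_ ?_)
        · simpa using nonneg_of_mem_closure hneg hc.2
        · exact nonneg_of_mem_closure (hlpos t ht) hc.1
      refine Submodule.eq_of_le_of_finrank_le hle ?_
      have := ht.2
      rw [hX, finrank_top] at this
      omega
  have hcomp : y₂ ∉ τ₁ := fun h => hneq
    ((hτ₁.eq_connectedComponentIn h).trans (hτ₂.eq_connectedComponentIn hy₂).symm)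
  have hHrat : H ∈ rationalHyperplanes X := by
    -- Were `H` not rational, no rational hyperplane would separate the two topes and they would be
    -- equal.
    by_contra hcon
    refine hcomp (hτ₁.mem_of_pos hX fun t ht => ⟨l t, fun x hx => (hl t ht x).2 hx, hlpos t ht, ?_⟩)
    rcases hsep t ht with h | h
    · exact h y₂ hy₂
    · exact absurd (h ▸ ht) hcon
  have huτ₂ : ∀ x ∈ τ₂, 0 < (-u) x := by
    have hnz : ∀ z ∈ τ₂, u z ≠ 0 := fun z hz hz0 =>
      (mem_regularLocus.1 (hτ₂.subset_regularLocus hz)).2 H hHrat ((huker z).1 hz0)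
    have h2 : ¬ 0 < u y₂ := fun hpos => by
      refine hcomp (hτ₁.mem_of_pos hX fun t ht => ?_)
      rcases hsep t ht with h | rfl
      · exact ⟨l t, fun x hx => (hl t ht x).2 hx, hlpos t ht, h y₂ hy₂⟩
      · exact ⟨u, huH, huτ₁, hpos⟩
    intro x hx
    refine pos_of_isPreconnected hτ₂.isPreconnected (-u) (fun z hz => ?_) hy₂ hx ?_
    · simpa using hnz z hz
    · simpa using lt_of_le_of_ne (not_lt.1 h2) (hnz y₂ hy₂)
  have hl₂ : ∀ t ∈ rationalHyperplanes X, t ≠ H → ∀ x ∈ τ₂, 0 < l t x := fun t ht htH =>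
    (hsep t ht).resolve_right (Ne.symm htH)
  -- points positive for all the walls other than `H`
  have hin₁ : ∀ y, (∀ t ∈ rationalHyperplanes X, t ≠ H → 0 < l t y) → 0 < u y → y ∈ τ₁ := by
    intro y hy huy
    refine hτ₁.mem_of_pos hX fun t ht => ?_
    by_cases htH : t = H
    · subst htH; exact ⟨u, huH, huτ₁, huy⟩
    · exact ⟨l t, fun x hx => (hl t ht x).2 hx, hlpos t ht, hy t ht htH⟩
  have hin₂ : ∀ y, (∀ t ∈ rationalHyperplanes X, t ≠ H → 0 < l t y) → u y < 0 → y ∈ τ₂ := by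
    intro y hy huy
    refine hτ₂.mem_of_pos hX fun t ht => ?_
    by_cases htH : t = H
    · subst htH; exact ⟨-u, fun x hx => by simp [huH x hx], huτ₂, by simpa using huy⟩
    · exact ⟨l t, fun x hx => (hl t ht x).2 hx, hl₂ t ht htH, hy t ht htH⟩
  have hex : ∀ t ∈ rationalHyperplanes X, t ≠ H →
      ∃ c ∈ closure τ₁ ∩ closure τ₂, 0 < l t c := by
    intro t ht htH
    by_contra! hcon
    have hle : H ≤ t := by
      rw [← hH]
      exact Submodule.span_le.2 fun c hc => (hl t ht c).1
        (le_antisymm (hcon c hc) (nonneg_of_mem_closure (hlpos t ht) hc.1))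
    refine htH (Submodule.eq_of_le_of_finrank_le hle ?_).symm
    have := ht.2
    rw [hX, finrank_top] at this
    omega
  choose! c hcC hcpos using hex
  set T := (rationalHyperplanes_finite X).toFinset.filter (fun t => t ≠ H) with hT
  have hmemT : ∀ t, t ∈ T ↔ t ∈ rationalHyperplanes X ∧ t ≠ H := fun t => by simp [hT]
  -- For each `t ≠ H` some point of the common closure is strictly positive on `t`, as otherwise `H
  -- = t`. The sum of such points is strictly positive on all of them at once.
  set x₀ := ∑ t ∈ T, c t with hx₀
  have hx₀H : x₀ ∈ H := Submodule.sum_mem _ fun t ht =>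
    hCH (hcC t ((hmemT t).1 ht).1 ((hmemT t).1 ht).2)
  have hx₀pos : ∀ t ∈ rationalHyperplanes X, t ≠ H → 0 < l t x₀ := by
    intro t ht htH
    rw [hx₀, map_sum]
    refine Finset.sum_pos' (fun s hs => ?_) ⟨t, (hmemT t).2 ⟨ht, htH⟩, hcpos t ht htH⟩
    obtain ⟨hs1, hs2⟩ := (hmemT s).1 hs
    exact nonneg_of_mem_closure (hlpos t ht) (hcC s hs1 hs2).1
  have hux₀ : u x₀ = 0 := huH _ hx₀H
  have hx₀C : x₀ ∈ closure τ₁ ∩ closure τ₂ := by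
    constructor
    · refine mem_closure_of_forall_pos (y := y₁) fun s hs => hin₁ _ (fun t ht htH => ?_) ?_
      · rw [map_add, map_smul, smul_eq_mul]
        exact add_pos (hx₀pos t ht htH) (mul_pos hs (hlpos t ht y₁ hy₁))
      · rw [map_add, map_smul, smul_eq_mul, hux₀, zero_add]
        exact mul_pos hs (huτ₁ y₁ hy₁)
    · refine mem_closure_of_forall_pos (y := y₂) fun s hs => hin₂ _ (fun t ht htH => ?_) ?_
      · rw [map_add, map_smul, smul_eq_mul]
        exact add_pos (hx₀pos t ht htH) (mul_pos hs (hl₂ t ht htH y₂ hy₂))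
      · rw [map_add, map_smul, smul_eq_mul, hux₀, zero_add]
        exact mul_neg_of_pos_of_neg hs (by simpa using huτ₂ y₂ hy₂)
  -- The open part of the common wall: convex and regular for `X ∩ H`, hence inside the tope of
  -- `x₀`. Any `z` in the common closure is the limit of `z + s • x₀ ∈ D` as `s → 0⁺`.
  set D : Set V := (H : Set V) ∩ ⋂ t ∈ T, {z | 0 < l t z} with hD
  have hDconv : Convex ℝ D :=
    H.convex.inter (convex_iInter₂ fun t _ => convex_halfSpace_gt (l t).isLinear 0)
  have hmemD : ∀ z ∈ H, (∀ t ∈ rationalHyperplanes X, t ≠ H → 0 < l t z) → z ∈ D :=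
    fun z hz h => ⟨hz, Set.mem_iInter₂.2 fun t ht =>
      h t ((hmemT t).1 ht).1 ((hmemT t).1 ht).2⟩
  have hDreg : D ⊆ regularLocus (inside X H) := by
    intro z hz
    refine mem_regularLocus.2 ⟨by rw [spanOf_inside hHrat.1]; exact hz.1, fun s hs hzs => ?_⟩
    obtain ⟨t, ht, htH, hst⟩ := exists_rationalHyperplane_ne hHrat hs
    have h1 : 0 < l t z := Set.mem_iInter₂.1 hz.2 t ((hmemT t).2 ⟨ht, htH⟩)
    rw [(hl t ht z).2 (hst hzs)] at h1
    exact lt_irrefl _ h1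
  have hx₀D : x₀ ∈ D := hmemD x₀ hx₀H hx₀pos
  refine ⟨hHrat, huker, x₀, hx₀H, hx₀C, hDreg hx₀D, fun z hz => ?_, ?_⟩
  · refine mem_closure_of_forall_pos (y := x₀) fun s hs =>
      hDconv.isPreconnected.subset_connectedComponentIn hx₀D hDreg
        (hmemD _ (H.add_mem (hCH hz) (H.smul_mem s hx₀H)) fun t ht htH => ?_)
    rw [map_add, map_smul, smul_eq_mul]
    exact add_pos_of_nonneg_of_pos (nonneg_of_mem_closure (hlpos t ht) hz.1)
      (mul_pos hs (hx₀pos t ht htH))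
  · have hopen : IsOpen (⋂ t ∈ T, {z | 0 < l t z}) :=
      isOpen_biInter_finset fun t _ =>
        isOpen_lt continuous_const (l t).continuous_of_finiteDimensional
    obtain ⟨ε, hε, hb⟩ := Metric.isOpen_iff.1 hopen x₀ hx₀D.2
    have hb' : ∀ y ∈ Metric.ball x₀ ε, ∀ t ∈ rationalHyperplanes X, t ≠ H → 0 < l t y :=
      fun y hy t ht htH => Set.mem_iInter₂.1 (hb hy) t ((hmemT t).2 ⟨ht, htH⟩)
    exact ⟨ε, hε, fun y hy => ⟨hin₁ y (hb' y hy), hin₂ y (hb' y hy)⟩⟩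

omit [FiniteDimensional ℝ V] in
/-- A tope whose closure contains a regular point contains this point. -/
theorem IsTope.eq_of_mem_closure {X : List V} {σ : Set V} (hσ : IsTope X σ) {x : V}
    (hx : x ∈ regularLocus X) (hxσ : x ∈ closure σ) :
    σ = connectedComponentIn (regularLocus X) x := by
  obtain ⟨y, hy⟩ := hσ.nonempty
  have h1 : IsPreconnected (insert x σ) :=
    hσ.isPreconnected.subset_closure (Set.subset_insert _ _)
      (Set.insert_subset hxσ subset_closure)
  have h2 : x ∈ σ := by
    have h3 := h1.subset_connectedComponentIn (Set.mem_insert_of_mem x hy)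
      (Set.insert_subset hx hσ.subset_regularLocus) (Set.mem_insert x σ)
    rwa [← hσ.eq_connectedComponentIn hy] at h3
  exact hσ.eq_connectedComponentIn h2

end Topes

/-! ### Functionals carried by a subspace -/

section Transfer

variable {V : Type*} [NormedAddCommGroup V] [NormedSpace ℝ V] [FiniteDimensional ℝ V]
  {𝕜 : Type*} [RCLike 𝕜]

/-- Restriction of test functions to a subspace. -/
def resTest (W : Submodule ℝ V) : Test V →ₗ[ℝ] Test W where
  toFun φ := mkTest (fun w : W => φ w) (φ.contDiff.comp W.subtypeL.contDiff)
    (φ.hasCompactSupport.comp_isClosedEmbedding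
      (W.closed_of_finiteDimensional.isClosedEmbedding_subtypeVal))
  map_add' _ _ := rfl
  map_smul' _ _ := rfl

theorem resTest_apply (W : Submodule ℝ V) (φ : Test V) (w : W) : resTest W φ w = φ w := rfl

theorem dOp_resTest (W : Submodule ℝ V) (v : W) (φ : Test V) :
    dOp v (resTest W φ) = resTest W (dOp (v : V) φ) := by
  ext w
  rw [resTest_apply, dOp_apply_eq_deriv, dOp_apply_eq_deriv]
  rfl

theorem dOp_pow_resTest (W : Submodule ℝ V) (v : W) (n : ℕ) (φ : Test V) :
    (dOp v ^ n) (resTest W φ) = resTest W ((dOp (v : V) ^ n) φ) := by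
  induction n with
  | zero => rfl
  | succ n ih =>
    rw [pow_succ', pow_succ', Module.End.mul_apply, Module.End.mul_apply, ih, dOp_resTest]

theorem tsupport_resTest (W : Submodule ℝ V) (φ : Test V) :
    tsupport (resTest W φ) ⊆ Subtype.val ⁻¹' tsupport φ :=
  closure_minimal (fun _ hw => subset_tsupport _ hw)
    ((isClosed_tsupport φ).preimage continuous_subtype_val)

/-- A continuous linear projection onto a subspace. -/
theorem exists_projection (W : Submodule ℝ V) : ∃ π : V →L[ℝ] W, ∀ w : W, π w = w := by
  obtain ⟨π, hπ⟩ := W.subtype.exists_leftInverse_of_injective W.ker_subtype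
  exact ⟨LinearMap.toContinuousLinearMap π, fun w => congrArg (fun f : W →ₗ[ℝ] W => f w) hπ⟩

/-- Test functions on a subspace extend, linearly and without enlarging the support. -/
theorem exists_extension (W : Submodule ℝ V) : ∃ e : Test W →ₗ[ℝ] Test V,
    ∀ φ : Test W, (∀ w : W, e φ w = φ w) ∧
      ∀ x ∈ tsupport (e φ), ∀ hx : x ∈ W, (⟨x, hx⟩ : W) ∈ tsupport φ := by
  obtain ⟨π, hπ⟩ := exists_projection W
  -- The extension is `φ ∘ π`, cut off transversally to `W` by `θ`.
  let θ : ContDiffBump (0 : V) := ⟨1, 2, one_pos, one_lt_two⟩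
  have hsupp : ∀ φ : Test W, tsupport (fun x : V => φ (π x) * θ (x - π x)) ⊆
      (π ⁻¹' tsupport φ) ∩ {x | x - π x ∈ Metric.closedBall (0 : V) 2} := by
    intro φ
    refine closure_minimal (fun x hx => ⟨?_, ?_⟩) (((isClosed_tsupport φ).preimage π.continuous).inter
      (Metric.isClosed_closedBall.preimage (by fun_prop)))
    · exact subset_tsupport _ (left_ne_zero_of_mul hx)
    · have h1 : x - (π x : V) ∈ Function.support θ := right_ne_zero_of_mul hx
      rw [θ.support_eq] at h1
      exact Metric.ball_subset_closedBall h1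
  have hcomp : ∀ φ : Test W, HasCompactSupport (fun x : V => φ (π x) * θ (x - π x)) := by
    intro φ
    refine IsCompact.of_isClosed_subset (s := (fun p : W × V => (p.1 : V) + p.2) ''
      (tsupport φ ×ˢ Metric.closedBall (0 : V) 2)) ?_ (isClosed_tsupport _) ?_
    · exact (φ.hasCompactSupport.isCompact.prod (isCompact_closedBall _ _)).image (by fun_prop)
    · intro x hx
      obtain ⟨h1, h2⟩ := hsupp φ hx
      exact ⟨(π x, x - π x), ⟨h1, h2⟩, by simp⟩
  have hsmooth : ∀ φ : Test W, ContDiff ℝ (⊤ : ℕ∞) (fun x : V => φ (π x) * θ (x - π x)) := by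
    intro φ
    refine (φ.contDiff.comp π.contDiff).mul (θ.contDiff.comp (contDiff_id.sub ?_))
    exact W.subtypeL.contDiff.comp π.contDiff
  let e : Test W →ₗ[ℝ] Test V :=
    { toFun := fun φ => mkTest _ (hsmooth φ) (hcomp φ)
      map_add' := by
        intro φ ψ
        ext x
        exact add_mul _ _ _
      map_smul' := by
        intro c φ
        ext x
        exact mul_assoc _ _ _ }
  refine ⟨e, fun φ => ⟨fun w => ?_, fun x hx hxW => ?_⟩⟩
  · change φ (π w) * θ (w - π w) = φ w
    rw [hπ, sub_self, θ.one_of_mem_closedBall (Metric.mem_closedBall_self zero_le_one), mul_one]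
  · have h1 := (hsupp φ hx).1
    have h2 : π x = ⟨x, hxW⟩ := hπ ⟨x, hxW⟩
    rw [Set.mem_preimage, h2] at h1
    exact h1

/-- The test functions whose support meets `W` inside `τ`. -/
def supportedAlong (W : Submodule ℝ V) (τ : Set V) : Submodule ℝ (Test V) where
  carrier := {φ | tsupport φ ∩ (W : Set V) ⊆ τ}
  add_mem' {φ ψ} hφ hψ := fun _ hx =>
    (tsupport_add (φ : V → ℝ) ψ hx.1).elim (fun h => hφ ⟨h, hx.2⟩) (fun h => hψ ⟨h, hx.2⟩)
  zero_mem' := by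
    change tsupport (0 : V → ℝ) ∩ (W : Set V) ⊆ τ
    simp
  smul_mem' c φ hφ := fun _ hx =>
    hφ ⟨closure_mono (Function.support_const_smul_subset c (φ : V → ℝ)) hx.1, hx.2⟩

omit [FiniteDimensional ℝ V] in
theorem dOp_mem_supportedAlong {W : Submodule ℝ V} {τ : Set V} (v : V) {φ : Test V}
    (hφ : φ ∈ supportedAlong W τ) : dOp v φ ∈ supportedAlong W τ :=
  fun _ hx => hφ ⟨tsupport_dOp_subset v φ hx.1, hx.2⟩

variable [MeasurableSpace V] [BorelSpace V]

/-- A functional carried by `W`, with nilpotent derivatives along `W` on a connected open subset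
`τ` of `W`, is a polynomial density on `τ`. -/
theorem exists_polyFun_of_nilpotent (W : Submodule ℝ V) {τ : Set V} (hτW : τ ⊆ (W : Set V))
    (hopen : ∀ x ∈ τ, ∃ ε > 0, ∀ y ∈ W, y ∈ Metric.ball x ε → y ∈ τ) (hconn : IsPreconnected τ)
    (hne : τ.Nonempty) (L : Test V →ₗ[ℝ] 𝕜) (hLW : ∀ φ : Test V, (∀ v ∈ W, φ v = 0) → L φ = 0)
    (hL : ∀ v ∈ W, ∃ N : ℕ, ∀ φ ∈ supportedAlong W τ, L ((dOp v ^ N) φ) = 0) :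
    ∃ (P : W → 𝕜) (hP : P ∈ polyFun 𝕜 W), ∀ φ ∈ supportedAlong W τ,
      L φ = integralAgainst P hP (resTest W φ) := by
  obtain ⟨e, he⟩ := exists_extension W
  have hcongr : ∀ φ ψ : Test V, (∀ v ∈ W, φ v = ψ v) → L φ = L ψ := by
    intro φ ψ h
    rw [← sub_eq_zero, ← map_sub]
    exact hLW _ fun v hv => sub_eq_zero.2 (h v hv)
  -- `L` only sees restrictions to `W`, so it may be replaced by `L ∘ e` on test functions of `W`.
  have hres : ∀ φ : Test V, L φ = L (e (resTest W φ)) := fun φ =>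
    hcongr _ _ fun v hv => ((he (resTest W φ)).1 ⟨v, hv⟩).symm
  set U : Set W := Subtype.val ⁻¹' τ with hU
  have hUopen : IsOpen U := by
    rw [Metric.isOpen_iff]
    intro x hx
    obtain ⟨ε, hε, h⟩ := hopen x hx
    exact ⟨ε, hε, fun y hy => h y y.2 hy⟩
  have himage : (fun w : W => (w : V)) '' U = τ := by
    ext x
    exact ⟨fun ⟨w, hw, h⟩ => h ▸ hw, fun hx => ⟨⟨x, hτW hx⟩, hx, rfl⟩⟩
  have hUconn : IsPreconnected U :=
    (Topology.IsInducing.subtypeVal (t := (W : Set V))).isPreconnected_image.1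
      (himage.symm ▸ hconn)
  have hUne : U.Nonempty := by
    obtain ⟨x, hx⟩ := hne
    exact ⟨⟨x, hτW hx⟩, hx⟩
  have hsupp : ∀ φ ∈ supportedIn U, e φ ∈ supportedAlong W τ := by
    rintro φ hφ x ⟨hx, hxW⟩
    exact hφ ((he φ).2 x hx hxW)
  obtain ⟨P, hP, h⟩ := isPolyOn_of_nilpotent hUopen hUconn hUne (L ∘ₗ e) (by
    intro v
    obtain ⟨N, hN⟩ := hL v v.2
    refine ⟨N, fun φ hφ => ?_⟩
    have h1 : resTest W (e φ) = φ := TestFunction.ext fun w => (he φ).1 w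
    have h2 : L (e ((dOp v ^ N) φ)) = L ((dOp (v : V) ^ N) (e φ)) := by
      rw [hres ((dOp (v : V) ^ N) (e φ)), ← dOp_pow_resTest, h1]
    exact h2.trans (hN _ (hsupp φ hφ)))
  refine ⟨P, hP, fun φ hφ => ?_⟩
  rw [hres]
  refine h _ fun w hw => hφ ⟨tsupport_resTest W φ hw, w.2⟩

/-- The distribution on `V` given by a polynomial density on a subspace. -/
def polyDist (W : Submodule ℝ V) (P : W → 𝕜) : Dist V 𝕜 :=
  (TestFunction.integralAgainstBilinCLM (Ω := (⊤ : Opens V)) (n := ⊤)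
    (ContinuousLinearMap.lsmul ℝ ℝ : ℝ →L[ℝ] 𝕜 →L[ℝ] 𝕜)
    (Measure.map Subtype.val (Measure.addHaar : Measure W))
    (fun x => P (Classical.choose (exists_projection W) x)) : 𝓓((⊤ : Opens V), ℝ) →L[ℝ] 𝕜)

/-- The projection chosen in the definition leaves no trace: it is the identity on `W`, which
carries the measure. Local integrability holds because `W` is closed. -/
theorem polyDist_apply (W : Submodule ℝ V) {P : W → 𝕜} (hP : P ∈ polyFun 𝕜 W) (φ : Test V) :
    polyDist W P φ = integralAgainst P hP (resTest W φ) := by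
  have hemb : Topology.IsClosedEmbedding (Subtype.val : W → V) :=
    W.closed_of_finiteDimensional.isClosedEmbedding_subtypeVal
  have hπ := Classical.choose_spec (exists_projection W)
  set π := Classical.choose (exists_projection W) with hπdef
  have hc : Continuous (fun x => P (π x)) := (continuous_of_mem_polyFun hP).comp π.continuous
  have hfin : IsFiniteMeasureOnCompacts
      (Measure.map Subtype.val (Measure.addHaar : Measure W)) := by
    refine ⟨fun K hK => ?_⟩
    rw [Measure.map_apply measurable_subtype_coe hK.measurableSet]
    exact (hemb.isCompact_preimage hK).measure_lt_top
  have := isLocallyFiniteMeasure_of_isFiniteMeasureOnCompacts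
    (μ := Measure.map Subtype.val (Measure.addHaar : Measure W))
  change TestFunction.integralAgainstBilinCLM _ _ _ φ = _
  rw [TestFunction.integralAgainstBilinCLM_eq_integral
    ((hc.locallyIntegrable).locallyIntegrableOn _), integralAgainst_apply,
    hemb.measurableEmbedding.integral_map]
  congr 1; ext w
  change φ w • P (π w) = φ w • P w
  rw [hπ]

theorem isPolynomialDensity_iff (W : Submodule ℝ V) (p : Dist V 𝕜) :
    IsPolynomialDensity W p ↔ ∃ (P : W → 𝕜) (hP : P ∈ polyFun 𝕜 W),
      ∀ φ : Test V, p φ = integralAgainst P hP (resTest W φ) := by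
  constructor
  · rintro ⟨P, hP, h⟩; exact ⟨P, hP, h⟩
  · rintro ⟨P, hP, h⟩; exact ⟨P, hP, h⟩

/-- A polynomial density on `W` vanishing on a nonempty open subset of `W` vanishes. -/
theorem polyFun_eq_zero_of_supportedAlong {W : Submodule ℝ V} {τ : Set V}
    (hτW : τ ⊆ (W : Set V))
    (hopen : ∀ x ∈ τ, ∃ ε > 0, ∀ y ∈ W, y ∈ Metric.ball x ε → y ∈ τ) (hne : τ.Nonempty)
    {P : W → 𝕜} (hP : P ∈ polyFun 𝕜 W)
    (h : ∀ φ ∈ supportedAlong W τ, integralAgainst P hP (resTest W φ) = 0) : P = 0 := by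
  obtain ⟨e, he⟩ := exists_extension W
  obtain ⟨x, hx⟩ := hne
  obtain ⟨ε, hε, hb⟩ := hopen x hx
  refine polyFun_eq_zero hP (Metric.isOpen_ball (x := (⟨x, hτW hx⟩ : W)) (ε := ε))
    ⟨_, Metric.mem_ball_self hε⟩ fun φ hφ => ?_
  have h1 : resTest W (e φ) = φ := TestFunction.ext fun w => (he φ).1 w
  rw [← h1]
  refine h _ ?_
  rintro y ⟨hy, hyW⟩
  exact hb y hyW (hφ ((he φ).2 y hy hyW))

/-- Derivatives, along `W`, of polynomial densities on `W` are polynomial densities. -/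
theorem exists_polyFun_dList {W : Submodule ℝ V} {P : W → 𝕜} (hP : P ∈ polyFun 𝕜 W) (Y : List V)
    (hY : ∀ a ∈ Y, a ∈ W) : ∃ (Q : W → 𝕜) (hQ : Q ∈ polyFun 𝕜 W), ∀ φ : Test V,
      integralAgainst P hP (resTest W (dList Y φ)) = integralAgainst Q hQ (resTest W φ) := by
  induction Y generalizing P with
  | nil => exact ⟨P, hP, fun φ => rfl⟩
  | cons a Y ih =>
    let a' : W := ⟨a, hY a (by simp)⟩
    obtain ⟨Q, hQ, h⟩ := ih (P := -(fun x => fderiv ℝ P x a'))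
      (Subalgebra.neg_mem _ (fderiv_mem_polyFun hP a')) (fun b hb => hY b (by simp [hb]))
    refine ⟨Q, hQ, fun φ => ?_⟩
    rw [← h, dList_cons, Module.End.mul_apply]
    have h1 : resTest W (dOp a (dList Y φ)) = dOp a' (resTest W (dList Y φ)) :=
      (dOp_resTest W a' (dList Y φ)).symm
    rw [h1, integralAgainst_dOp]
    simp only [integralAgainst_apply]
    rw [← integral_neg]
    congr 1; ext x; exact (smul_neg _ _).symm

omit [MeasurableSpace V] [BorelSpace V] in
/-- A functional annihilated by the cocircuits of `X` has nilpotent derivatives. -/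
theorem nilpotent_of_cocircuits {X : List V} (S : Submodule ℝ (Test V))
    (hS : ∀ v, ∀ φ ∈ S, dOp v φ ∈ S) (L : Test V →ₗ[ℝ] 𝕜)
    (h : ∀ t ∈ rationalHyperplanes X, ∀ φ ∈ S, L (dList (outside X t) φ) = 0) :
    ∀ v ∈ spanOf X, ∃ N : ℕ, ∀ φ ∈ S, L ((dOp v ^ N) φ) = 0 :=
  exists_pow_dOp_eq_zero S hS L (spanOf X) {c | ∃ t ∈ rationalHyperplanes X, c = outside X t}
    (by rintro c ⟨t, ht, rfl⟩; exact h t ht)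
    (fun _ hP => spanOf_le_of_meets_cocircuits fun t ht => hP _ ⟨t, ht, rfl⟩)

omit [FiniteDimensional ℝ V] [MeasurableSpace V] [BorelSpace V] in
theorem mem_distOn_spanOf {X : List V} {f : Dist V 𝕜} (hf : f ∈ G 𝕜 X) :
    f ∈ distOn 𝕜 (spanOf X) := by
  have h := hf (spanOf X) (spanOf_mem_rationalSubspaces X)
  have h1 : outside X (spanOf X) = [] := by
    rw [List.eq_nil_iff_forall_not_mem]
    intro a ha
    obtain ⟨h1, h2⟩ := mem_outside.1 ha
    exact h2 (mem_spanOf h1)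
  rw [h1] at h
  exact h

/-- Existence and uniqueness of the local pieces of the elements of `G(X)`. -/
theorem exists_isPiece {X : List V} {τ : Set V} (hτ : IsTope X τ) {f : Dist V 𝕜}
    (hf : f ∈ G 𝕜 X) : ∃ p₀ : Dist V 𝕜, ∀ p, IsPiece X τ f p ↔ p = p₀ := by
  set W := spanOf X with hW
  have hτW := hτ.subset_spanOf
  have hopen : ∀ x ∈ τ, ∃ ε > 0, ∀ y ∈ W, y ∈ Metric.ball x ε → y ∈ τ :=
    fun _ hx => hτ.exists_ball hx
  have hfW := mem_distOn_spanOf hf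
  -- A test function whose support meets `W` inside `τ` vanishes on `t`, since `t ⊆ W` and `τ`
  -- misses `t`; so a distribution carried by `t` kills it.
  have hcoc : ∀ t ∈ rationalHyperplanes X, ∀ φ ∈ supportedAlong W τ,
      f (dList (outside X t) φ) = 0 := by
    intro t ht φ hφ
    rw [dList_apply_eq_derivList, hf t ht.1 φ, smul_zero]
    intro v hv
    refine image_eq_zero_of_notMem_tsupport fun hvs => ?_
    exact (mem_regularLocus.1 (hτ.subset_regularLocus
      (hφ ⟨hvs, le_spanOf_of_rational ht.1 hv⟩))).2 t ht hv
  have hnil := nilpotent_of_cocircuits (supportedAlong W τ)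
    (fun v φ hφ => dOp_mem_supportedAlong v hφ) (f : Test V →ₗ[ℝ] 𝕜) hcoc
  obtain ⟨P, hP, hfP⟩ := exists_polyFun_of_nilpotent W hτW hopen hτ.isPreconnected hτ.nonempty
    (f : Test V →ₗ[ℝ] 𝕜) hfW hnil
  refine ⟨polyDist W P, fun p => ⟨?_, ?_⟩⟩
  · rintro ⟨-, hp, hagree⟩
    obtain ⟨Q, hQ, hpQ⟩ := (isPolynomialDensity_iff W p).1 hp
    have h1 : Q - P = 0 := by
      refine polyFun_eq_zero_of_supportedAlong hτW hopen hτ.nonempty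
        (Subalgebra.sub_mem _ hQ hP) fun φ hφ => ?_
      have h2 : integralAgainst Q hQ (resTest W φ) - integralAgainst P hP (resTest W φ) = 0 := by
        rw [← hpQ, ← hfP φ hφ, sub_eq_zero]
        exact (hagree φ hφ).symm
      rw [← h2]
      simp only [integralAgainst_apply]
      rw [← integral_sub (integrable_smul_polyFun (continuous_of_mem_polyFun hQ) _)
        (integrable_smul_polyFun (continuous_of_mem_polyFun hP) _)]
      congr 1; ext x; exact smul_sub _ _ _
    have h3 : Q = P := sub_eq_zero.1 h1
    subst h3
    ext φ
    rw [hpQ, polyDist_apply W hP]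
  · rintro rfl
    have hp := polyDist_apply W hP
    refine ⟨⟨fun φ hφ => ?_, fun t ht => ?_⟩, (isPolynomialDensity_iff W _).2 ⟨P, hP, hp⟩,
      fun φ hφ => ?_⟩
    · rw [hp, integralAgainst_apply]
      have : ∀ w : W, resTest W φ w • P w = 0 := fun w => by
        rw [resTest_apply, hφ w w.2, zero_smul]
      simp [this]
    · have hYW : ∀ a ∈ outside X t, a ∈ W := fun a ha => mem_spanOf (mem_outside.1 ha).1
      obtain ⟨Q, hQ, h⟩ := exists_polyFun_dList hP (outside X t) hYW
      -- The cocircuit derivative of the density vanishes on `τ`, where the density is `f`; being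
      -- polynomial, it vanishes on all of `W`.
      have hQ0 : Q = 0 := by
        refine polyFun_eq_zero_of_supportedAlong hτW hopen hτ.nonempty hQ fun φ hφ => ?_
        rw [← h, ← hfP]
        · exact hcoc t ht φ hφ
        · exact fun x hx => hφ ⟨tsupport_dList_subset _ _ hx.1, hx.2⟩
      ext φ
      rw [derivList_apply, hp, h]
      subst hQ0
      simp [integralAgainst_apply]
    · rw [hp]; exact hfP φ hφ

end Transfer

/-! ### Multivariate splines -/

section Splines

variable {V : Type*} [NormedAddCommGroup V] [NormedSpace ℝ V] [FiniteDimensional ℝ V]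
  [MeasurableSpace V] [BorelSpace V] {𝕜 : Type*} [RCLike 𝕜]

/-- The measure whose distribution is the multivariate spline of `Y`. -/
def splineMeasure (Y : List V) : Measure V :=
  Measure.map (fun t : Fin Y.length → ℝ => ∑ i, t i • Y.get i)
    (volume.restrict {t | ∀ i, 0 ≤ t i})

instance sFinite_splineMeasure (Y : List V) : SFinite (splineMeasure Y) := by
  unfold splineMeasure; infer_instance

instance sFinite_rayMeasure (a : V) : SFinite (rayMeasure a) := by
  unfold rayMeasure; infer_instance

theorem volume_restrict_orthant (n : ℕ) :
    (volume : Measure (Fin n → ℝ)).restrict {t | ∀ i, 0 ≤ t i} =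
      Measure.pi (fun _ => volume.restrict (Set.Ici 0)) := by
  rw [← Measure.restrict_pi_pi, ← volume_pi]
  congr 1; ext t; simp [Pi.le_def]

omit [FiniteDimensional ℝ V] [BorelSpace V] in
theorem splineMeasure_eq (Y : List V) : splineMeasure Y =
    Measure.map (fun t : Fin Y.length → ℝ => ∑ i, t i • Y.get i)
      (Measure.pi (fun _ => volume.restrict (Set.Ici 0))) := by
  rw [splineMeasure, volume_restrict_orthant]

omit [FiniteDimensional ℝ V] [BorelSpace V] in
theorem splineMeasure_nil : splineMeasure ([] : List V) = Measure.dirac 0 := by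
  rw [splineMeasure_eq]
  have : (fun t : Fin ([] : List V).length → ℝ => ∑ i, t i • ([] : List V).get i) =
      fun _ => 0 := by
    funext t; exact Fin.sum_univ_zero _
  rw [this, Measure.map_const]
  have h : Measure.pi (fun _ : Fin ([] : List V).length =>
      (volume : Measure ℝ).restrict (Set.Ici 0)) Set.univ = 1 := by
    rw [Measure.pi_univ]; exact Fin.prod_univ_zero _
  rw [h, one_smul]

/-- Fubini: the first coordinate of the orthant splits off. Invariance under permutations then
reduces to commutativity of convolution. -/
theorem splineMeasure_cons (a : V) (Y : List V) :
    splineMeasure (a :: Y) = (rayMeasure a).conv (splineMeasure Y) := by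
  have hm : Measurable (fun t : Fin Y.length → ℝ => ∑ i, t i • Y.get i) :=
    (by fun_prop : Continuous _).measurable
  have hm' : Measurable (fun t : ℝ => t • a) := by fun_prop
  rw [Measure.conv, splineMeasure_eq Y, rayMeasure, Measure.map_prod_map _ _ hm' hm,
    Measure.map_map (by fun_prop) (hm'.prodMap hm)]
  have h := measurePreserving_piFinSuccAbove (n := Y.length)
    (fun _ : Fin (Y.length + 1) => (volume : Measure ℝ).restrict (Set.Ici 0)) 0
  rw [← h.map_eq, Measure.map_map (by fun_prop) h.measurable, splineMeasure_eq]
  congr 1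
  funext t
  exact Fin.sum_univ_succ _

theorem splineMeasure_perm {Y Z : List V} (h : Y.Perm Z) : splineMeasure Y = splineMeasure Z := by
  induction h with
  | nil => rfl
  | cons a _ ih => rw [splineMeasure_cons, splineMeasure_cons, ih]
  | swap a b Y =>
    simp only [splineMeasure_cons]
    rw [← Measure.conv_assoc, ← Measure.conv_assoc, Measure.conv_comm (rayMeasure b)]
  | trans _ _ ih₁ ih₂ => rw [ih₁, ih₂]

omit [FiniteDimensional ℝ V] in
theorem ae_splineMeasure {Y : List V} {p : V → Prop} (hp : MeasurableSet {v | p v})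
    (h : ∀ t : Fin Y.length → ℝ, (∀ i, 0 ≤ t i) → p (∑ i, t i • Y.get i)) :
    ∀ᵐ v ∂splineMeasure Y, p v := by
  rw [splineMeasure, ae_map_iff (Continuous.aemeasurable (by fun_prop)) hp]
  refine ae_restrict_of_forall_mem ?_ h
  rw [show {t : Fin Y.length → ℝ | ∀ i, 0 ≤ t i} = Set.univ.pi fun _ => Set.Ici 0 by
    ext t; simp [Pi.le_def]]
  exact MeasurableSet.univ_pi fun _ => measurableSet_Ici

/-- The sums `∑ i, t i • Y i` with `0 ≤ t i` and `t i * u (Y i) ≤ C` for all `i`. -/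
def truncatedCone (u : Module.Dual ℝ V) (Y : List V) (C : ℝ) : Set V :=
  (fun t : Fin Y.length → ℝ => ∑ i, t i • Y.get i) '' Set.Icc 0 (fun i => C / u (Y.get i))

omit [FiniteDimensional ℝ V] [MeasurableSpace V] [BorelSpace V] in
theorem isCompact_truncatedCone (u : Module.Dual ℝ V) (Y : List V) (C : ℝ) :
    IsCompact (truncatedCone u Y C) :=
  isCompact_Icc.image (by fun_prop)

-- All the terms `t i * u (Y i)` are nonnegative, so each is bounded by their sum. This is the
-- properness of the map from the orthant to `V`, from which local finiteness and the compact
-- truncations follow.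
omit [FiniteDimensional ℝ V] [MeasurableSpace V] [BorelSpace V] in
theorem mem_Icc_of_sum_le {u : Module.Dual ℝ V} {Y : List V} (hY : ∀ a ∈ Y, 0 < u a) {C : ℝ}
    {t : Fin Y.length → ℝ} (ht : ∀ i, 0 ≤ t i) (hC : u (∑ i, t i • Y.get i) ≤ C) :
    t ∈ Set.Icc 0 (fun i => C / u (Y.get i)) := by
  refine ⟨fun i => ht i, fun i => ?_⟩
  rw [le_div_iff₀ (hY _ (Y.get_mem i))]
  refine le_trans ?_ hC
  rw [map_sum]
  simp only [map_smul, smul_eq_mul]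
  exact Finset.single_le_sum (f := fun i => t i * u (Y.get i))
    (fun j _ => mul_nonneg (ht j) (hY _ (Y.get_mem j)).le) (Finset.mem_univ i)

theorem nonneg_ae_splineMeasure {u : Module.Dual ℝ V} {Y : List V} (hY : ∀ a ∈ Y, 0 < u a) :
    ∀ᵐ v ∂splineMeasure Y, 0 ≤ u v := by
  have hu : Continuous u := u.continuous_of_finiteDimensional
  refine ae_splineMeasure (isClosed_le continuous_const hu).measurableSet fun t ht => ?_
  rw [map_sum]
  simp only [map_smul, smul_eq_mul]
  exact Finset.sum_nonneg fun j _ => mul_nonneg (ht j) (hY _ (Y.get_mem j)).le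

theorem mem_truncatedCone_ae_splineMeasure {u : Module.Dual ℝ V} {Y : List V}
    (hY : ∀ a ∈ Y, 0 < u a) (C : ℝ) :
    ∀ᵐ v ∂splineMeasure Y, u v ≤ C → v ∈ truncatedCone u Y C := by
  have hu : Continuous u := u.continuous_of_finiteDimensional
  refine ae_splineMeasure ?_ fun t ht h => ⟨t, mem_Icc_of_sum_le hY ht h, rfl⟩
  exact (isClosed_le hu continuous_const).measurableSet.imp
    (isCompact_truncatedCone u Y C).measurableSet

theorem mem_ae_splineMeasure {Y : List V} {W : Submodule ℝ V} (hY : ∀ a ∈ Y, a ∈ W) :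
    ∀ᵐ v ∂splineMeasure Y, v ∈ W :=
  ae_splineMeasure W.closed_of_finiteDimensional.measurableSet fun _ _ =>
    W.sum_mem fun i _ => W.smul_mem _ (hY _ (Y.get_mem i))

theorem isFiniteMeasureOnCompacts_splineMeasure {u : Module.Dual ℝ V} {Y : List V}
    (hY : ∀ a ∈ Y, 0 < u a) : IsFiniteMeasureOnCompacts (splineMeasure Y) := by
  refine ⟨fun K hK => ?_⟩
  obtain ⟨C, hC⟩ := hK.bddAbove_image (f := u) u.continuous_of_finiteDimensional.continuousOn
  have hm : Measurable (fun t : Fin Y.length → ℝ => ∑ i, t i • Y.get i) :=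
    (by fun_prop : Continuous _).measurable
  rw [splineMeasure, Measure.map_apply hm hK.measurableSet,
    Measure.restrict_apply (hm hK.measurableSet)]
  refine lt_of_le_of_lt (measure_mono (t := Set.Icc 0 fun i => C / u (Y.get i)) ?_)
    isCompact_Icc.measure_lt_top
  rintro t ⟨h1, h2⟩
  exact mem_Icc_of_sum_le hY h2 (hC ⟨_, h1, rfl⟩)

theorem isLocallyFiniteMeasure_splineMeasure {u : Module.Dual ℝ V} {Y : List V}
    (hY : ∀ a ∈ Y, 0 < u a) : IsLocallyFiniteMeasure (splineMeasure Y) := by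
  have := isFiniteMeasureOnCompacts_splineMeasure hY
  exact isLocallyFiniteMeasure_of_isFiniteMeasureOnCompacts

/-- The average of the translates of a test function with respect to a spline. -/
def splineSmear (Y : List V) (φ : Test V) (y : V) : ℝ := smear (splineMeasure Y) (fun _ => 1) φ y

omit [FiniteDimensional ℝ V] [BorelSpace V] in
theorem splineSmear_eq (Y : List V) (φ : Test V) (y : V) :
    splineSmear Y φ y = ∫ v, φ (y + v) ∂splineMeasure Y := by
  simp [splineSmear, smear]

theorem spline_apply {u : Module.Dual ℝ V} {Y : List V} (hY : ∀ a ∈ Y, 0 < u a) (φ : Test V) :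
    spline 𝕜 Y φ = ((splineSmear Y φ 0 : ℝ) : 𝕜) := by
  have := isLocallyFiniteMeasure_splineMeasure hY
  have h : LocallyIntegrable (fun _ : V => (1 : 𝕜)) (splineMeasure Y) := locallyIntegrable_const 1
  change TestFunction.integralAgainstBilinCLM _ (splineMeasure Y) _ φ = _
  rw [TestFunction.integralAgainstBilinCLM_eq_integral (h.locallyIntegrableOn _), splineSmear_eq,
    ← integral_ofReal]
  congr 1; ext v
  simp [RCLike.real_smul_eq_coe_mul]

theorem splineSmear_perm {Y Z : List V} (h : Y.Perm Z) : splineSmear Y = splineSmear Z := by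
  unfold splineSmear; rw [splineMeasure_perm h]

theorem splineSmear_nil (φ : Test V) (y : V) : splineSmear [] φ y = φ y := by
  rw [splineSmear_eq, splineMeasure_nil, integral_dirac, add_zero]

/-- The fundamental theorem of calculus on the ray generated by `a`, after splitting off that ray
from the spline. -/
theorem splineSmear_cons_dOp {u : Module.Dual ℝ V} {a : V} {Y : List V}
    (hY : ∀ b ∈ a :: Y, 0 < u b) (φ : Test V) (y : V) :
    splineSmear (a :: Y) (dOp a φ) y = -splineSmear Y φ y := by
  have := isFiniteMeasureOnCompacts_splineMeasure hY
  have ha : a ≠ 0 := fun h => by simpa [h] using hY a (by simp)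
  have hi := integrable_translate (μ := splineMeasure (a :: Y)) (dOp a φ) y
  rw [splineSmear_eq, splineSmear_eq, ← integral_neg]
  rw [splineMeasure_cons, Measure.conv_comm] at hi ⊢
  rw [integral_conv hi]
  congr 1; ext v
  rw [← integral_Ioi_dOp ha φ (y + v), rayMeasure,
    integral_map (by fun_prop) (Continuous.aestronglyMeasurable (by fun_prop)),
    integral_Ici_eq_integral_Ioi]
  simp only [add_assoc]

theorem splineSmear_append_dList {u : Module.Dual ℝ V} {Z Y : List V}
    (h : ∀ b ∈ Z ++ Y, 0 < u b) (φ : Test V) (y : V) :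
    splineSmear (Z ++ Y) (dList Z φ) y = (-1 : ℝ) ^ Z.length * splineSmear Y φ y := by
  induction Z with
  | nil => simp
  | cons a Z ih =>
    rw [List.cons_append] at h ⊢
    rw [dList_cons, Module.End.mul_apply, splineSmear_cons_dOp h,
      ih fun b hb => h b (List.mem_cons_of_mem _ hb), List.length_cons, pow_succ]
    ring

/-- The spline of a list of vectors in an open half-space belongs to `G`. -/
theorem derivList_outside_spline {u : Module.Dual ℝ V} {X : List V} (hX : ∀ a ∈ X, 0 < u a)
    (r : Submodule ℝ V) : derivList (outside X r) (spline 𝕜 X) = spline 𝕜 (inside X r) := by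
  have hperm := outside_append_inside_perm X r
  ext φ
  rw [derivList_apply, spline_apply hX, spline_apply fun a ha => hX a (mem_inside.1 ha).1,
    ← splineSmear_perm hperm,
    splineSmear_append_dList fun b hb => hX b (hperm.subset hb), RCLike.real_smul_eq_coe_mul,
    ← RCLike.ofReal_mul, ← mul_assoc, ← mul_pow]
  norm_num

theorem spline_mem_distOn {u : Module.Dual ℝ V} {Y : List V} (hY : ∀ a ∈ Y, 0 < u a)
    {r : Submodule ℝ V} (hr : ∀ a ∈ Y, a ∈ r) : spline 𝕜 Y ∈ distOn 𝕜 r := by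
  intro φ hφ
  rw [spline_apply hY, splineSmear, smear_eq_zero, RCLike.ofReal_zero]
  filter_upwards [mem_ae_splineMeasure hr] with v hv
  rw [zero_add]; exact hφ v hv

theorem spline_mem_G {u : Module.Dual ℝ V} {X : List V} (hX : ∀ a ∈ X, 0 < u a) :
    spline 𝕜 X ∈ G 𝕜 X := by
  intro r _
  rw [derivList_outside_spline hX]
  exact spline_mem_distOn (fun a ha => hX a (mem_inside.1 ha).1) fun a ha => (mem_inside.1 ha).2

omit [FiniteDimensional ℝ V] [MeasurableSpace V] [BorelSpace V] in
/-- Nonzero vectors generating a pointed cone lie in an open half-space. -/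
theorem exists_pos_of_generatesPointedCone {X : List V} (hX0 : ∀ a ∈ X, a ≠ 0)
    (hX : GeneratesPointedCone X) : ∃ u : Module.Dual ℝ V, ∀ a ∈ X, 0 < u a := by
  classical
  have h0 : (0 : V) ∉ convexHull ℝ {a | a ∈ X} := by
    intro h0
    rw [show {a | a ∈ X} = (X.toFinset : Set V) by ext; simp, Finset.mem_convexHull'] at h0
    obtain ⟨w, hw, hw1, hw0⟩ := h0
    obtain ⟨b, hb, hwb⟩ : ∃ b ∈ X.toFinset, 0 < w b := by
      by_contra! hcon
      linarith [Finset.sum_nonpos hcon]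
    have hmem : ∀ y ∈ X.toFinset, w y • y ∈ Submodule.span NNReal {a | a ∈ X} := fun y hy =>
      Submodule.smul_mem _ (⟨w y, hw y hy⟩ : NNReal)
        (Submodule.subset_span (List.mem_toFinset.1 hy))
    -- A convex relation with value `0` puts both `w b • b` and its opposite in the cone, against
    -- pointedness.
    have h1 : -(w b • b) = ∑ y ∈ X.toFinset.erase b, w y • y := by
      rw [neg_eq_iff_add_eq_zero, Finset.add_sum_erase _ (fun y => w y • y) hb, hw0]
    have h2 := hX _ (hmem b hb) (h1 ▸ Submodule.sum_mem _ fun y hy =>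
      hmem y (Finset.mem_of_mem_erase hy))
    exact (smul_ne_zero hwb.ne' (hX0 b (List.mem_toFinset.1 hb))) h2
  have hfin : {a | a ∈ X}.Finite := X.finite_toSet
  obtain ⟨f, c, hc, hf⟩ := geometric_hahn_banach_point_closed (convex_convexHull ℝ {a | a ∈ X})
    (hfin.isClosed_convexHull ℝ) h0
  refine ⟨(f : V →ₗ[ℝ] ℝ), fun a ha => ?_⟩
  rw [map_zero] at hc
  exact hc.trans (hf a (subset_convexHull ℝ _ ha))

end Splines

/-! ### Splines attached to a regular face -/

section Face

variable {V : Type*} [NormedAddCommGroup V] [NormedSpace ℝ V]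

open Classical in
/-- The number of vectors of `Y` on which `u` is negative. -/
def numNeg (u : Module.Dual ℝ V) (Y : List V) : ℕ := (Y.filter (fun a => u a < 0)).length

open Classical in
/-- The list of the vectors of `Y`, up to signs, on which `u` is positive. -/
def flipped (u : Module.Dual ℝ V) (Y : List V) : List V :=
  Y.filter (fun a => 0 < u a) ++ (Y.filter (fun a => u a < 0)).map (fun b => -b)

theorem pos_of_mem_flipped (u : Module.Dual ℝ V) (Y : List V) : ∀ a ∈ flipped u Y, 0 < u a := by
  intro a ha
  rcases List.mem_append.1 ha with h | h
  · simpa using (List.mem_filter.1 h).2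
  · obtain ⟨b, hb, rfl⟩ := List.mem_map.1 h
    simpa using (List.mem_filter.1 hb).2

theorem dList_map_neg (Y : List V) : dList (Y.map fun b => -b) = (-1 : ℝ) ^ Y.length • dList Y := by
  induction Y with
  | nil => simp
  | cons a Y ih =>
    rw [List.map_cons, dList_cons, dList_cons, ih, List.length_cons, pow_succ, map_neg,
      mul_smul_comm, neg_mul, mul_neg_one, neg_smul, smul_neg]

open Classical in
theorem filter_append_filter_perm {u : Module.Dual ℝ V} {Y : List V} (hY : ∀ a ∈ Y, u a ≠ 0) :
    (Y.filter (fun a => 0 < u a) ++ Y.filter (fun a => u a < 0)).Perm Y := by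
  have h : Y.filter (fun a => u a < 0) = Y.filter (fun a => !decide (0 < u a)) := by
    refine List.filter_congr fun a ha => ?_
    rcases lt_or_gt_of_ne (hY a ha) with h | h <;> simp [h, h.le, not_lt]
  rw [h]
  exact List.filter_append_perm _ Y

theorem dList_eq_flipped {u : Module.Dual ℝ V} {Y : List V} (hY : ∀ a ∈ Y, u a ≠ 0) :
    dList Y = (-1 : ℝ) ^ numNeg u Y • dList (flipped u Y) := by
  rw [flipped, dList_append, dList_map_neg, mul_smul_comm, smul_smul, numNeg, ← mul_pow,
    ← dList_append, dList_perm (filter_append_filter_perm hY)]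
  norm_num

theorem length_flipped {u : Module.Dual ℝ V} {Y : List V} (hY : ∀ a ∈ Y, u a ≠ 0) :
    (flipped u Y).length = Y.length := by
  rw [← (filter_append_filter_perm hY).length_eq, flipped]
  simp

variable [FiniteDimensional ℝ V] [MeasurableSpace V] [BorelSpace V] {𝕜 : Type*} [RCLike 𝕜]

/-- The average of the translates of a test function with respect to the spline of a face. -/
def faceSmear (u : Module.Dual ℝ V) (Y : List V) (φ : Test V) (y : V) : ℝ :=
  (-1 : ℝ) ^ numNeg u Y * splineSmear (flipped u Y) φ y

theorem faceSpline_apply (u : Module.Dual ℝ V) (Y : List V) (φ : Test V) :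
    faceSpline u Y φ = faceSmear u Y φ 0 := by
  have h := spline_apply (𝕜 := ℝ) (pos_of_mem_flipped u Y) φ
  change (-1 : ℝ) ^ numNeg u Y • spline ℝ (flipped u Y) φ = _
  rw [h]; rfl

/-- `T_Y^u` is a fundamental solution of `∂_Y`: the sign `(-1)^|B|` in its definition compensates
for the operators `∂_{-b} = -∂_b`. Neither the sign nor the result depends on the side chosen, so
both faces give the same value. -/
theorem faceSmear_dList {u : Module.Dual ℝ V} {Y : List V} (hY : ∀ a ∈ Y, u a ≠ 0) (φ : Test V)
    (y : V) : faceSmear u Y (dList Y φ) y = (-1 : ℝ) ^ Y.length * φ y := by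
  have h := splineSmear_append_dList (u := u) (Z := flipped u Y) (Y := [])
    (by simpa using pos_of_mem_flipped u Y) ((-1 : ℝ) ^ numNeg u Y • φ) y
  rw [List.append_nil, splineSmear_nil, length_flipped hY] at h
  have h1 : dList Y φ = dList (flipped u Y) ((-1 : ℝ) ^ numNeg u Y • φ) := by
    rw [dList_eq_flipped hY, map_smul]; rfl
  have h2 : ((-1 : ℝ) ^ numNeg u Y • φ) y = (-1 : ℝ) ^ numNeg u Y * φ y := rfl
  rw [faceSmear, h1, h, h2, mul_left_comm, ← mul_assoc ((-1 : ℝ) ^ numNeg u Y), ← mul_pow]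
  norm_num

theorem faceSmear_eq_zero {u : Module.Dual ℝ V} {Y : List V} {φ : Test V} {y : V}
    (h : ∀ v, 0 ≤ u v → φ (y + v) = 0) : faceSmear u Y φ y = 0 := by
  rw [faceSmear, splineSmear, smear_eq_zero, mul_zero]
  filter_upwards [nonneg_ae_splineMeasure (pos_of_mem_flipped u Y)] with v hv
  exact h v hv

theorem contDiff_faceSmear (u : Module.Dual ℝ V) (Y : List V) (φ : Test V) :
    ContDiff ℝ (⊤ : ℕ∞) (faceSmear u Y φ) := by
  have := isLocallyFiniteMeasure_splineMeasure (pos_of_mem_flipped u Y)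
  exact contDiff_const.mul (contDiff_smear (locallyIntegrable_const 1) φ)

theorem hasDerivAt_faceSmear (u : Module.Dual ℝ V) (Y : List V) (φ : Test V) (y v : V) :
    HasDerivAt (fun t : ℝ => faceSmear u Y φ (y + t • v)) (faceSmear u Y (dOp v φ) y) 0 := by
  have := isLocallyFiniteMeasure_splineMeasure (pos_of_mem_flipped u Y)
  have hw : LocallyIntegrable (fun _ : V => (1 : ℝ)) (splineMeasure (flipped u Y)) :=
    locallyIntegrable_const 1
  have h1 := ((contDiff_smear hw φ).differentiable (by simp) y).hasFDerivAt.hasLineDerivAt v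
  have h2 : HasDerivAt (fun t : ℝ => splineSmear (flipped u Y) φ (y + t • v))
      (splineSmear (flipped u Y) (dOp v φ) y) 0 := by
    rw [fderiv_smear hw] at h1
    exact h1
  exact h2.const_mul _

theorem faceSmear_add (u : Module.Dual ℝ V) (Y : List V) (φ ψ : Test V) (y : V) :
    faceSmear u Y (φ + ψ) y = faceSmear u Y φ y + faceSmear u Y ψ y := by
  have := isFiniteMeasureOnCompacts_splineMeasure (pos_of_mem_flipped u Y)
  simp only [faceSmear, splineSmear_eq]
  rw [← mul_add, ← integral_add (integrable_translate φ y) (integrable_translate ψ y)]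
  rfl

omit [FiniteDimensional ℝ V] [BorelSpace V] in
theorem faceSmear_smul (u : Module.Dual ℝ V) (Y : List V) (c : ℝ) (φ : Test V) (y : V) :
    faceSmear u Y (c • φ) y = c * faceSmear u Y φ y := by
  simp only [faceSmear, splineSmear_eq]
  rw [mul_left_comm, ← integral_const_mul c]
  rfl

/-- The part of the cone generated by `flipped u Y` that is needed to average a function supported
where `u ≤ C`. -/
theorem exists_isCompact_faceSmear (u : Module.Dual ℝ V) (Y : List V) (φ : Test V) (c : ℝ) :
    ∃ K : Set V, IsCompact K ∧ ∀ y, -c ≤ u y →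
      ∀ᵐ v ∂splineMeasure (flipped u Y), φ (y + v) ≠ 0 → v ∈ K := by
  obtain ⟨C, hC⟩ := φ.hasCompactSupport.isCompact.bddAbove_image (f := u)
    u.continuous_of_finiteDimensional.continuousOn
  refine ⟨_, isCompact_truncatedCone u (flipped u Y) (C + c), fun y hy => ?_⟩
  filter_upwards [mem_truncatedCone_ae_splineMeasure (pos_of_mem_flipped u Y) (C + c)] with v hv h
  have h1 : u (y + v) ≤ C := hC ⟨_, subset_tsupport _ h, rfl⟩
  rw [map_add] at h1
  exact hv (by linarith)

/-- A smooth cutoff on the line. -/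
def unitBump : ContDiffBump (0 : ℝ) := ⟨1, 2, one_pos, one_lt_two⟩

/-- The cutoff confines `y` to `|u y| < 2`, where only a compact part `K` of the cone contributes;
then `y` lies in `tsupport φ - K`. The bound `2` is the outer radius of `unitBump`. -/
theorem hasCompactSupport_faceSmear (u : Module.Dual ℝ V) (Y : List V) (φ : Test V) :
    HasCompactSupport (fun y => unitBump (u y) * faceSmear u Y φ y) := by
  obtain ⟨K, hK, h⟩ := exists_isCompact_faceSmear u Y φ 2
  refine HasCompactSupport.of_support_subset_isCompact
    ((φ.hasCompactSupport.isCompact.prod hK).image (f := fun p : V × V => p.1 - p.2) (by fun_prop))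
    fun y hy => ?_
  have h1 : u y ∈ Function.support unitBump := left_ne_zero_of_mul hy
  rw [unitBump.support_eq] at h1
  change u y ∈ Metric.ball (0 : ℝ) 2 at h1
  have h2 : faceSmear u Y φ y ≠ 0 := right_ne_zero_of_mul hy
  rw [mem_ball_zero_iff, Real.norm_eq_abs, abs_lt] at h1
  obtain ⟨v, hv, hvK⟩ : ∃ v, φ (y + v) ≠ 0 ∧ v ∈ K := by
    by_contra! hcon
    apply h2
    rw [faceSmear, splineSmear, smear_eq_zero, mul_zero]
    filter_upwards [h y h1.1.le] with v hv
    by_contra hne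
    exact hcon v hne (hv hne)
  exact ⟨(y + v, v), ⟨subset_tsupport _ hv, hvK⟩, by simp⟩

/-- A test function extending the restriction of `faceSmear u Y φ` to the hyperplane `u = 0`. -/
def faceTest (u : Module.Dual ℝ V) (Y : List V) : Test V →ₗ[ℝ] Test V where
  toFun φ := mkTest (fun y => unitBump (u y) * faceSmear u Y φ y)
    ((unitBump.contDiff.comp (LinearMap.toContinuousLinearMap u).contDiff).mul
      (contDiff_faceSmear u Y φ)) (hasCompactSupport_faceSmear u Y φ)
  map_add' φ ψ := TestFunction.ext fun y => by
    change unitBump (u y) * _ = unitBump (u y) * _ + unitBump (u y) * _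
    rw [faceSmear_add, mul_add]
  map_smul' c φ := TestFunction.ext fun y => by
    change unitBump (u y) * _ = c * (unitBump (u y) * _)
    rw [faceSmear_smul, mul_left_comm]

theorem faceTest_apply (u : Module.Dual ℝ V) (Y : List V) (φ : Test V) (y : V) :
    faceTest u Y φ y = unitBump (u y) * faceSmear u Y φ y := rfl

theorem faceTest_apply_of_eq_zero {u : Module.Dual ℝ V} (Y : List V) (φ : Test V) {y : V}
    (hy : u y = 0) : faceTest u Y φ y = faceSmear u Y φ y := by
  rw [faceTest_apply, hy,
    unitBump.one_of_mem_closedBall (Metric.mem_closedBall_self zero_le_one), one_mul]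

/-- The cutoff depends on `u y` alone, hence is constant along `h`. Nilpotency of derivatives along
`H` therefore passes from `q` to `T_Y^u * q`. -/
theorem dOp_faceTest {u : Module.Dual ℝ V} (Y : List V) {h : V} (hu : u h = 0) (φ : Test V) :
    dOp h (faceTest u Y φ) = faceTest u Y (dOp h φ) := by
  ext y
  rw [dOp_apply_eq_deriv]
  have h1 : (fun t : ℝ => faceTest u Y φ (y + t • h)) =
      fun t : ℝ => unitBump (u y) * faceSmear u Y φ (y + t • h) := by
    funext t
    rw [faceTest_apply, map_add, map_smul, hu, smul_zero, add_zero]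
  rw [h1]
  exact ((hasDerivAt_faceSmear u Y φ y h).const_mul _).deriv

theorem dOp_pow_faceTest {u : Module.Dual ℝ V} (Y : List V) {h : V} (hu : u h = 0) (n : ℕ)
    (φ : Test V) : (dOp h ^ n) (faceTest u Y φ) = faceTest u Y ((dOp h ^ n) φ) := by
  induction n with
  | zero => rfl
  | succ n ih =>
    rw [pow_succ', Module.End.mul_apply, Module.End.mul_apply, ih, dOp_faceTest Y hu]

/-- Near the hyperplane `u = 0`, the spline of a face may be replaced by a cutoff of it. -/
theorem exists_isCompact_faceSpline (u : Module.Dual ℝ V) (Y : List V) (φ : Test V) :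
    ∃ K : Set V, IsCompact K ∧ ∀ χ : Test V, (∀ x ∈ K, χ x = 1) →
      ContDiff ℝ (⊤ : ℕ∞) (fun y => faceSpline u Y (cutoffTranslate χ φ y)) ∧
      ∀ y, u y = 0 → faceSpline u Y (cutoffTranslate χ φ y) = faceSmear u Y φ y := by
  obtain ⟨K, hK, h⟩ := exists_isCompact_faceSmear u Y φ 0
  have := isLocallyFiniteMeasure_splineMeasure (pos_of_mem_flipped u Y)
  refine ⟨K, hK, fun χ hχ => ?_⟩
  have h1 : ∀ y, faceSpline u Y (cutoffTranslate χ φ y) =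
      (-1 : ℝ) ^ numNeg u Y * smear (splineMeasure (flipped u Y)) χ φ y := by
    intro y
    rw [faceSpline_apply, faceSmear, splineSmear_eq, smear]
    congr 2; ext v
    change χ (0 + v) * φ (0 + v + y) = χ v * φ (y + v)
    rw [zero_add, add_comm]
  constructor
  · simp only [h1]
    exact contDiff_const.mul (contDiff_smear χ.contDiff.continuous.locallyIntegrable φ)
  · intro y hy
    rw [h1, faceSmear, splineSmear, smear, smear]
    congr 1
    refine integral_congr_ae ?_
    filter_upwards [h y (by simp [hy])] with v hv
    by_cases h0 : φ (y + v) = 0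
    · simp [h0]
    · simp [hχ v (hv h0)]

end Face

/-! ### Crossing a wall -/

section Crossing

variable {V : Type*} [NormedAddCommGroup V] [NormedSpace ℝ V] {𝕜 : Type*} [RCLike 𝕜]

/-- For `r ≤ H` the operator `∂_{X∖r}` factors as `∂_{(X∩H)∖r} ∂_{X∖H}`, and `r` is also rational
for `X`. -/
theorem derivList_outside_mem_G {X : List V} {f : Dist V 𝕜} (hf : f ∈ G 𝕜 X)
    (H : Submodule ℝ V) : derivList (outside X H) f ∈ G 𝕜 (inside X H) := by
  intro r hr
  obtain ⟨hrX, hrH⟩ := rational_of_rational_inside hr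
  rw [← derivList_append, derivList_perm (outside_inside_append_perm hrH)]
  exact hf r hrX

/-- A distribution annihilated by the cocircuits of `X` has nilpotent derivatives. -/
theorem exists_pow_dOp_eq_zero_of_mem_D [FiniteDimensional ℝ V] {X : List V} {f : Dist V 𝕜}
    (hf : f ∈ D 𝕜 X) {v : V} (hv : v ∈ spanOf X) : ∃ N : ℕ, ∀ φ, f ((dOp v ^ N) φ) = 0 := by
  obtain ⟨N, hN⟩ := nilpotent_of_cocircuits (X := X) ⊤ (fun _ _ _ => trivial)
    (f : Test V →ₗ[ℝ] 𝕜) (fun t ht φ _ => by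
      change f (dList (outside X t) φ) = 0
      rw [dList_apply_eq_derivList, hf.2 t ht]
      simp) v hv
  exact ⟨N, fun φ => hN φ trivial⟩

theorem pow_dOp_eq_zero_of_le {F : Type*} [AddCommGroup F] [Module ℝ F] {L : Test V →ₗ[ℝ] F}
    {v : V} {N M : ℕ} (hN : ∀ φ, L ((dOp v ^ N) φ) = 0) (h : N ≤ M) (φ : Test V) :
    L ((dOp v ^ M) φ) = 0 := by
  rw [← Nat.add_sub_cancel' h, pow_add, Module.End.mul_apply]
  exact hN _

variable [FiniteDimensional ℝ V] [MeasurableSpace V] [BorelSpace V]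

/-- The functional `T_Y^u * q`, for `q` a distribution on the hyperplane `u = 0`. -/
def faceConv (u : Module.Dual ℝ V) (Y : List V) (q : Dist V 𝕜) : Test V →ₗ[ℝ] 𝕜 :=
  (q : Test V →ₗ[ℝ] 𝕜) ∘ₗ faceTest u Y

omit [FiniteDimensional ℝ V] [MeasurableSpace V] [BorelSpace V] in
theorem apply_eq_of_mem_distOn {H : Submodule ℝ V} {q : Dist V 𝕜} (hq : q ∈ distOn 𝕜 H)
    {φ ψ : Test V} (h : ∀ v ∈ H, φ v = ψ v) : q φ = q ψ := by
  rw [← sub_eq_zero, ← map_sub]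
  exact hq _ fun v hv => sub_eq_zero.2 (h v hv)

theorem faceConv_dList {u : Module.Dual ℝ V} {H : Submodule ℝ V} (huH : ∀ x, u x = 0 ↔ x ∈ H)
    {q : Dist V 𝕜} (hq : q ∈ distOn 𝕜 H) {Y : List V} (hY : ∀ a ∈ Y, u a ≠ 0) (φ : Test V) :
    faceConv u Y q (dList Y φ) = (-1 : ℝ) ^ Y.length • q φ := by
  change q (faceTest u Y (dList Y φ)) = _
  rw [← map_smul]
  refine apply_eq_of_mem_distOn hq fun v hv => ?_
  rw [faceTest_apply_of_eq_zero Y _ ((huH v).2 hv), faceSmear_dList hY]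
  rfl

/-- `T_Y^u` is carried by `u ≥ 0` and `q` by `u = 0`, so the convolution only sees the closed side
`u ≥ 0`. -/
theorem faceConv_eq_zero {u : Module.Dual ℝ V} {H : Submodule ℝ V} (huH : ∀ x, u x = 0 ↔ x ∈ H)
    {q : Dist V 𝕜} (hq : q ∈ distOn 𝕜 H) (Y : List V) {φ : Test V}
    (hφ : ∀ x, 0 ≤ u x → φ x = 0) : faceConv u Y q φ = 0 := by
  refine hq _ fun y hy => ?_
  have hy0 := (huH y).2 hy
  rw [faceTest_apply_of_eq_zero Y _ hy0]
  exact faceSmear_eq_zero fun v hv => hφ _ (by rw [map_add, hy0, zero_add]; exact hv)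

theorem faceConv_pow_dOp {u : Module.Dual ℝ V} (Y : List V) {q : Dist V 𝕜} {h : V} (hu : u h = 0)
    {N : ℕ} (hN : ∀ φ, q ((dOp h ^ N) φ) = 0) (φ : Test V) :
    faceConv u Y q ((dOp h ^ N) φ) = 0 := by
  change q (faceTest u Y ((dOp h ^ N) φ)) = 0
  rw [← dOp_pow_faceTest Y hu]
  exact hN _

/-- The functionals `T_Y^u * q` and `T_Y^{-u} * q` represent a convolution. -/
theorem isConvolution_of_eq_faceConv {u : Module.Dual ℝ V} {H : Submodule ℝ V}
    (huH : ∀ x, u x = 0 ↔ x ∈ H) {q R : Dist V 𝕜} (hq : q ∈ distOn 𝕜 H) (Y : List V)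
    (hR : ∀ φ, R φ = faceConv u Y q φ - faceConv (-u) Y q φ) :
    IsConvolution (faceSpline u Y - faceSpline (-u) Y) q R := by
  intro φ
  obtain ⟨K₁, hK₁, h₁⟩ := exists_isCompact_faceSpline u Y φ
  obtain ⟨K₂, hK₂, h₂⟩ := exists_isCompact_faceSpline (-u) Y φ
  -- `K₁` and `K₂` make the cutoff harmless in the spline variable for `y ∈ H`; the two supports
  -- make it harmless in the variable of `q`.
  refine ⟨K₁ ∪ K₂ ∪ (tsupport (faceTest u Y φ) ∪ tsupport (faceTest (-u) Y φ)),
    (hK₁.union hK₂).union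
      ((faceTest u Y φ).hasCompactSupport.isCompact.union
        (faceTest (-u) Y φ).hasCompactSupport.isCompact), fun χ hχ => ?_⟩
  obtain ⟨hs₁, he₁⟩ := h₁ χ fun x hx => hχ x (Or.inl (Or.inl hx))
  obtain ⟨hs₂, he₂⟩ := h₂ χ fun x hx => hχ x (Or.inl (Or.inr hx))
  refine ⟨mkTest (fun y => χ y * (faceSpline u Y (cutoffTranslate χ φ y) -
    faceSpline (-u) Y (cutoffTranslate χ φ y))) (χ.contDiff.mul (hs₁.sub hs₂))
    χ.hasCompactSupport.mul_right, fun y => rfl, ?_⟩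
  rw [hR]
  change q _ - q _ = _
  rw [← map_sub]
  refine apply_eq_of_mem_distOn hq fun y hy => ?_
  have hy0 := (huH y).2 hy
  have hy1 : (-u) y = 0 := by simp [hy0]
  rw [mkTest_apply, he₁ y hy0, he₂ y hy1, ← faceTest_apply_of_eq_zero Y φ hy0,
    ← faceTest_apply_of_eq_zero Y φ hy1]
  change faceTest u Y φ y - faceTest (-u) Y φ y = _
  by_cases hyK : y ∈ tsupport (faceTest u Y φ) ∪ tsupport (faceTest (-u) Y φ)
  · rw [hχ y (Or.inr hyK), one_mul]
  · rw [image_eq_zero_of_notMem_tsupport fun h => hyK (Or.inl h),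
      image_eq_zero_of_notMem_tsupport fun h => hyK (Or.inr h), sub_zero, mul_zero]

/-- A functional with polynomial behaviour, vanishing on a nonempty open set, vanishes. -/
theorem eq_zero_of_nilpotent_of_open (L : Test V →ₗ[ℝ] 𝕜)
    (hL : ∀ v : V, ∃ N : ℕ, ∀ φ, L ((dOp v ^ N) φ) = 0) {U : Set V} (hU : IsOpen U)
    (hne : U.Nonempty) (h : ∀ φ : Test V, tsupport φ ⊆ U → L φ = 0) (φ : Test V) : L φ = 0 := by
  obtain ⟨P, hP, hLP⟩ := isPolyOn_of_nilpotent isOpen_univ isPreconnected_univ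
    ⟨0, trivial⟩ L fun v => (hL v).imp fun N hN φ _ => hN φ
  have hP0 : P = 0 := polyFun_eq_zero hP hU hne fun φ hφ => by
    rw [← hLP φ (Set.subset_univ _)]; exact h φ hφ
  rw [hLP φ (Set.subset_univ _)]
  subst hP0
  simp [integralAgainst_apply]

/-- The difference of the two local pieces on both sides of a wall. -/
theorem sub_eq_faceConv_sub {X : List V} (hX : spanOf X = ⊤) {H : Submodule ℝ V}
    (hH : H ∈ rationalHyperplanes X) {u : Module.Dual ℝ V} (huH : ∀ x, u x = 0 ↔ x ∈ H)
    {τ₁ τ₂ τ₁₂ : Set V} {x₀ : V} (hx₀ : x₀ ∈ H) (hτ₁₂ : IsTope (inside X H) τ₁₂)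
    (hx₀τ : x₀ ∈ τ₁₂) {ε : ℝ} (hε : 0 < ε)
    (hball : ∀ y ∈ Metric.ball x₀ ε, (0 < u y → y ∈ τ₁) ∧ (u y < 0 → y ∈ τ₂))
    {f f₁ f₂ q : Dist V 𝕜} (h₁ : IsPiece X τ₁ f f₁) (h₂ : IsPiece X τ₂ f f₂)
    (hq : IsPiece (inside X H) τ₁₂ (derivList (outside X H) f) q) (φ : Test V) :
    (f₁ - f₂) φ = faceConv u (outside X H) q φ - faceConv (-u) (outside X H) q φ := by
  set Y := outside X H with hYdef
  have hY : ∀ a ∈ Y, u a ≠ 0 := fun a ha h => (mem_outside.1 ha).2 ((huH a).1 h)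
  have hY' : ∀ a ∈ Y, (-u) a ≠ 0 := fun a ha h => hY a ha (by simpa using h)
  have huH' : ∀ x, (-u) x = 0 ↔ x ∈ H := fun x => by rw [← huH x]; simp
  have hHtop : H ≠ ⊤ := by
    rintro rfl
    have := hH.2
    rw [hX] at this
    omega
  have hspan : spanOf (inside X H) = H := spanOf_inside hH.1
  have hqH : q ∈ distOn 𝕜 H := by rw [← hspan]; exact hq.1.1
  obtain ⟨ε', hε', hball'⟩ := hτ₁₂.exists_ball hx₀τ
  rw [hspan] at hball'
  have hr : 0 < min ε ε' := lt_min hε hε'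
  have hagree : ∀ {τ : Set V} {p : Dist V 𝕜}, IsPiece X τ f p → ∀ φ : Test V,
      tsupport φ ⊆ τ → f φ = p φ := fun hp φ hφ => hp.2.2 φ fun x hx => hφ hx.1
  have hD : ∀ {τ : Set V} {p : Dist V 𝕜}, IsPiece X τ f p → ∀ φ : Test V,
      p (dList Y φ) = 0 := fun hp φ => by
    rw [dList_apply_eq_derivList, hp.1.2 H hH]; simp
  -- the uniqueness argument on the negative side
  obtain ⟨r, hr0, -, hL⟩ := exists_ball_forall_eq_zero u ((huH x₀).2 hx₀) Y hY hr
    ((f : Test V →ₗ[ℝ] 𝕜) - (f₂ : Test V →ₗ[ℝ] 𝕜) - faceConv u Y q)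
    -- Near `x₀`, `∂_Y` kills `f₂`, while `∂_Y f` and `∂_Y (T_Y^u * q)` both equal `q`, as `supp φ ∩
    -- H ⊆ τ₁₂`.
    (fun φ hφ => by
      change f (dList Y φ) - f₂ (dList Y φ) - faceConv u Y q (dList Y φ) = 0
      rw [hD h₂, faceConv_dList huH hqH hY, dList_apply_eq_derivList,
        hq.2.2 φ (fun x hx => ?_), sub_zero, sub_self]
      rw [hspan] at hx
      exact hball' x hx.2 (Metric.ball_subset_ball (min_le_right _ _) (hφ hx.1)))
    (fun φ hφ => by
      change f φ - f₂ φ - faceConv u Y q φ = 0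
      rw [faceConv_eq_zero huH hqH, hagree h₂, sub_self, sub_zero]
      · exact fun x hx =>
          (hball x (Metric.ball_subset_ball (min_le_left _ _) (hφ hx).1)).2 (hφ hx).2
      · intro x hx
        exact image_eq_zero_of_notMem_tsupport fun h => not_lt.2 hx (hφ h).2)
  -- the positive side
  set U : Set V := Metric.ball x₀ (min r ε) ∩ {x | 0 < u x} with hU
  have hUopen : IsOpen U :=
    Metric.isOpen_ball.inter (isOpen_lt continuous_const u.continuous_of_finiteDimensional)
  have hUne : U.Nonempty := by
    obtain ⟨w, hw⟩ : ∃ w, 0 < u w := by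
      obtain ⟨v, -, hv⟩ := SetLike.exists_of_lt (lt_top_iff_ne_top.2 hHtop)
      rcases lt_or_gt_of_ne (fun h => hv ((huH v).1 h)) with h | h
      · exact ⟨-v, by rw [map_neg]; linarith⟩
      · exact ⟨v, h⟩
    have ht : Filter.Tendsto (fun t : ℝ => x₀ + t • w) (nhdsWithin 0 (Set.Ioi 0)) (nhds x₀) := by
      have : Continuous fun t : ℝ => x₀ + t • w := by fun_prop
      simpa using (this.tendsto 0).mono_left nhdsWithin_le_nhds
    obtain ⟨t, htb, ht0⟩ := ((ht.eventually (Metric.ball_mem_nhds x₀ (lt_min hr0 hε))).and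
      self_mem_nhdsWithin).exists
    refine ⟨_, htb, ?_⟩
    change 0 < u (x₀ + t • w)
    rw [map_add, (huH x₀).2 hx₀, map_smul, zero_add]
    exact mul_pos ht0 hw
  rw [← sub_eq_zero]
  refine eq_zero_of_nilpotent_of_open
    ((f₁ : Test V →ₗ[ℝ] 𝕜) - (f₂ : Test V →ₗ[ℝ] 𝕜) - (faceConv u Y q - faceConv (-u) Y q))
    (fun v => ?_) hUopen hUne (fun φ hφ => ?_) φ
  -- Global nilpotency comes from the single list `Y` together with constant lists of vectors of
  -- `H`: a subspace meeting all of them contains `H` and a vector off `H`, hence is everything.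
  · obtain ⟨N, hN⟩ := exists_pow_dOp_eq_zero ⊤ (fun _ _ _ => trivial)
      ((f₁ : Test V →ₗ[ℝ] 𝕜) - (f₂ : Test V →ₗ[ℝ] 𝕜) - (faceConv u Y q - faceConv (-u) Y q)) ⊤
      ({Y} ∪ {c | ∃ h ∈ H, ∃ N, c = List.replicate N h ∧ ∀ φ,
        f₁ ((dOp h ^ N) φ) = 0 ∧ f₂ ((dOp h ^ N) φ) = 0 ∧ q ((dOp h ^ N) φ) = 0})
      (by
        rintro c (rfl | ⟨h, hh, N, rfl, hN⟩) φ -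
        · change f₁ (dList Y φ) - f₂ (dList Y φ) -
            (faceConv u Y q (dList Y φ) - faceConv (-u) Y q (dList Y φ)) = 0
          rw [hD h₁, hD h₂, faceConv_dList huH hqH hY, faceConv_dList huH' hqH hY']
          simp
        · rw [dList_replicate]
          change f₁ ((dOp h ^ N) φ) - f₂ ((dOp h ^ N) φ) -
            (faceConv u Y q ((dOp h ^ N) φ) - faceConv (-u) Y q ((dOp h ^ N) φ)) = 0
          rw [(hN φ).1, (hN φ).2.1, faceConv_pow_dOp Y ((huH h).2 hh) fun φ => (hN φ).2.2,
            faceConv_pow_dOp Y ((huH' h).2 hh) fun φ => (hN φ).2.2]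
          simp)
      (by
        intro P hP v _
        have hHP : H ≤ P := by
          intro h hh
          obtain ⟨N₁, hN₁⟩ := exists_pow_dOp_eq_zero_of_mem_D h₁.1 (v := h) (hX ▸ trivial)
          obtain ⟨N₂, hN₂⟩ := exists_pow_dOp_eq_zero_of_mem_D h₂.1 (v := h) (hX ▸ trivial)
          obtain ⟨N₃, hN₃⟩ := exists_pow_dOp_eq_zero_of_mem_D hq.1 (v := h) (hspan.symm ▸ hh)
          -- The sum of the three exponents is a common one for `f₁`, `f₂` and `q`.
          obtain ⟨a, ha, haP⟩ := hP _ (Or.inr ⟨h, hh, N₁ + N₂ + N₃, rfl, fun φ =>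
            ⟨pow_dOp_eq_zero_of_le (L := (f₁ : Test V →ₗ[ℝ] 𝕜)) hN₁ (by omega) φ,
              pow_dOp_eq_zero_of_le (L := (f₂ : Test V →ₗ[ℝ] 𝕜)) hN₂ (by omega) φ,
              pow_dOp_eq_zero_of_le (L := (q : Test V →ₗ[ℝ] 𝕜)) hN₃ (by omega) φ⟩⟩)
          rwa [List.eq_of_mem_replicate ha] at haP
        obtain ⟨a, ha, haP⟩ := hP Y (Or.inl rfl)
        have hv : v = (v - (u v / u a) • a) + (u v / u a) • a := by abel
        rw [hv]
        refine P.add_mem (hHP ((huH _).1 ?_)) (P.smul_mem _ haP)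
        rw [map_sub, map_smul, smul_eq_mul, div_mul_cancel₀ _ (hY a ha), sub_self])
      v trivial
    exact ⟨N, fun φ => hN φ trivial⟩
  · have h3 : f φ - f₂ φ - faceConv u Y q φ = 0 :=
      hL φ fun x hx => Metric.ball_subset_ball (min_le_left _ _) (hφ hx).1
    have h4 : f φ = f₁ φ := hagree h₁ φ fun x hx =>
      (hball x (Metric.ball_subset_ball (min_le_right _ _) (hφ hx).1)).1 (hφ hx).2
    have h5 : faceConv (-u) Y q φ = 0 := faceConv_eq_zero huH' hqH Y fun x hx =>
      image_eq_zero_of_notMem_tsupport fun h => by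
        have := (hφ h).2
        simp only [LinearMap.neg_apply, Left.nonneg_neg_iff] at hx
        exact not_lt.2 hx this
    change f₁ φ - f₂ φ - (faceConv u Y q φ - faceConv (-u) Y q φ) = 0
    rw [h5, sub_zero, ← h4]
    exact h3

/-- The wall crossing formula. -/
theorem exists_pieces_isConvolution {X : List V} (hX : spanOf X = ⊤) {H : Submodule ℝ V}
    (hH : H ∈ rationalHyperplanes X) {u : Module.Dual ℝ V} (huH : ∀ x, u x = 0 ↔ x ∈ H)
    {τ₁ τ₂ : Set V} (hτ₁ : IsTope X τ₁) (hτ₂ : IsTope X τ₂) {τ₁₂ : Set V} {x₀ : V} (hx₀ : x₀ ∈ H)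
    (hτ₁₂ : IsTope (inside X H) τ₁₂) (hx₀τ : x₀ ∈ τ₁₂) {ε : ℝ} (hε : 0 < ε)
    (hball : ∀ y ∈ Metric.ball x₀ ε, (0 < u y → y ∈ τ₁) ∧ (u y < 0 → y ∈ τ₂))
    {f : Dist V 𝕜} (hf : f ∈ G 𝕜 X) :
    ∃ f₁ f₂ q : Dist V 𝕜, (∀ p, IsPiece X τ₁ f p ↔ p = f₁) ∧ (∀ p, IsPiece X τ₂ f p ↔ p = f₂) ∧
      (∀ p, IsPiece (inside X H) τ₁₂ (derivList (outside X H) f) p ↔ p = q) ∧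
      IsConvolution (faceSpline u (outside X H) - faceSpline (-u) (outside X H)) q (f₁ - f₂) := by
  obtain ⟨f₁, h₁⟩ := exists_isPiece hτ₁ hf
  obtain ⟨f₂, h₂⟩ := exists_isPiece hτ₂ hf
  obtain ⟨q, hq⟩ := exists_isPiece hτ₁₂ (derivList_outside_mem_G hf H)
  have hq' := (hq q).2 rfl
  refine ⟨f₁, f₂, q, h₁, h₂, hq, isConvolution_of_eq_faceConv huH
    (by simpa only [spanOf_inside hH.1] using hq'.1.1) _ fun φ => ?_⟩
  exact sub_eq_faceConv_sub hX hH huH hx₀ hτ₁₂ hx₀τ hε hball ((h₁ f₁).2 rfl) ((h₂ f₂).2 rfl) hq' φ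

end Crossing

end WallCrossing

end

/-! ### The wall crossing theorem -/

open WallCrossing in
theorem theorem4p7 {𝕜 : Type*} [RCLike 𝕜]
    {V : Type*} [NormedAddCommGroup V] [NormedSpace ℝ V] [FiniteDimensional ℝ V]
    [MeasurableSpace V] [BorelSpace V]
    (X : List V) (hX0 : ∀ a ∈ X, a ≠ 0) (hXspan : spanOf X = ⊤)
    (τ₁ τ₂ : Set V) (hτ₁ : IsTope X τ₁) (hτ₂ : IsTope X τ₂)
    (H : Submodule ℝ V) (hH : Submodule.span ℝ (closure τ₁ ∩ closure τ₂) = H)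
    (hHdim : Module.finrank ℝ H + 1 = Module.finrank ℝ V)
    (u : Module.Dual ℝ V) (huH : ∀ h ∈ H, u h = 0) (huτ₁ : ∀ x ∈ τ₁, 0 < u x) :
    H ∈ rationalSubspaces X ∧
    ∃ τ₁₂ : Set V,
      (∀ σ : Set V,
        (IsTope (inside X H) σ ∧ closure τ₁ ∩ closure τ₂ ⊆ closure σ) ↔ σ = τ₁₂) ∧
      (∀ f ∈ G 𝕜 X,
        derivList (outside X H) f ∈ G 𝕜 (inside X H) ∧
        ∃ f₁ f₂ q : Dist V 𝕜,
          (∀ p, IsPiece X τ₁ f p ↔ p = f₁) ∧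
          (∀ p, IsPiece X τ₂ f p ↔ p = f₂) ∧
          (∀ p, IsPiece (inside X H) τ₁₂ (derivList (outside X H) f) p ↔ p = q) ∧
          IsConvolution (faceSpline u (outside X H) - faceSpline (-u) (outside X H))
            q (f₁ - f₂)) ∧
      (GeneratesPointedCone X →
        spline 𝕜 X ∈ G 𝕜 X ∧
        ∃ T₁ T₂ Q : Dist V 𝕜,
          (∀ p, IsPiece X τ₁ (spline 𝕜 X) p ↔ p = T₁) ∧
          (∀ p, IsPiece X τ₂ (spline 𝕜 X) p ↔ p = T₂) ∧
          (∀ p, IsPiece (inside X H) τ₁₂ (spline 𝕜 (inside X H)) p ↔ p = Q) ∧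
          IsConvolution (faceSpline u (outside X H) - faceSpline (-u) (outside X H))
            Q (T₁ - T₂)) := by
  obtain ⟨hHr, huker, x₀, hx₀H, hx₀C, hx₀r, hsub, ε, hε, hball⟩ :=
    exists_wall_point hXspan hτ₁ hτ₂ hH hHdim huH huτ₁
  have hx₀τ := mem_connectedComponentIn hx₀r
  have hτ₁₂ : IsTope (inside X H) (connectedComponentIn (regularLocus (inside X H)) x₀) :=
    ⟨x₀, hx₀r, rfl⟩
  -- `τ₁₂` is the tope of `x₀`. Any competitor has the regular point `x₀` in its closure and so is
  -- this component.
  refine ⟨hHr.1, _, fun σ => ⟨fun hσ => hσ.1.eq_of_mem_closure hx₀r (hσ.2 hx₀C), ?_⟩,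
    fun f hf => ⟨derivList_outside_mem_G hf H,
      exists_pieces_isConvolution hXspan hHr huker hτ₁ hτ₂ hx₀H hτ₁₂ hx₀τ hε hball hf⟩,
    fun hcone => ?_⟩
  · rintro rfl
    exact ⟨hτ₁₂, hsub⟩
  -- Pointedness enters only through a form positive on `X`; it puts `T_X` in `G(X)` and identifies
  -- `∂_{X∖H} T_X` with `T_{X∩H}` in the general formula.
  · obtain ⟨w, hw⟩ := exists_pos_of_generatesPointedCone hX0 hcone
    refine ⟨spline_mem_G hw, ?_⟩
    have h := exists_pieces_isConvolution hXspan hHr huker hτ₁ hτ₂ hx₀H hτ₁₂ hx₀τ hε hball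
      (spline_mem_G (𝕜 := 𝕜) hw)
    rwa [derivList_outside_spline hw] at h
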